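/- Theorem 2.7. Let $(\Omega,\mathcal F,P)$ be a probability space, $T$ a finite horizon, $(\mathcal F_t)_{0\le t\le T}$ a filtration such that $\mathcal F_0$ contains all $P$-null sets of $\mathcal F$, and $(S_t)_{0\le t\le T}$ an adapted $\mathbb R^d$-valued process; put $\Delta S_t=S_t-S_{t-1}$. Let $\Xi_t$ be the set of all $\mathcal F_t$-measurable $\mathbb R^d$-valued random variables and $\Phi$ the set of all strategies $\phi=(\phi_t)_{1\le t\le T}$ with $\phi_t\in\Xi_{t-1}$. For $c\in\mathbb R$ put $V_t^{c,\phi}=c+\sum_{i=1}^t\langle\phi_i,\Delta S_i\rangle$. Assume (NA) for every $\phi\in\Phi$, if $V_T^{0,\phi}\ge 0$ a.s. then $V_T^{0,\phi}=0$ a.s. Let $U:\mathbb R\to\mathbb R$ be concave and nondecreasing with $U(0)=0$, and suppose that at least one of the following holds: (a) there are $\tilde x>0$ and $0<\gamma<1$ with $U(\lambda x)\le\lambda^{\gamma}U(x)$ for all $x\ge\tilde x$ and $\lambda\ge1$; (b) there are $\alpha>0$ and $\tilde x\le0$ with $U(\lambda x)\le\lambda^{1+\alpha}U(x)$ for all $x\le\tilde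 x$ and $\lambda\ge1$. Expectations and conditional expectations are generalized ones, $E(X\mid\mathcal G)=E(X^+\mid\mathcal G)-E(X^-\mid\mathcal G)\in[-\infty,\infty]$, well defined if (almost surely) the two terms are not both infinite. Define $U_T(x)=U(x)$ and, backwards for $0\le t<T$, $$U_t(x)=\operatorname{ess\,sup}_{\xi\in\Xi_t}E\bigl(U_{t+1}(x+\langle\xi,\Delta S_{t+1}\rangle)\,\big|\,\mathcal F_t\bigr),\qquad x\in\mathbb R;$$ here, for $t<T$, random arguments are inserted in the version of $U_t$ that is nondecreasing and left-continuous in $x$, namely the supremum over rationals $q<x$ of the essential suprema at $q$. Assume that for all $0\le t<T$ and $x\in\mathbb R$ the conditional expectations above are well defined for every $\xi\in\Xi_t$ and the essential supremum is $<\infty$ a.s., and that $EU_0(x)<\infty$ for all $x\in\mathbb R$. Then for every $c\in\mathbb R$ there is a strategy $\phi^*=\phi^*(c)\in\Phi(U,c)$ with $$u(c)=EU(V_T^{c,\phi^*})\quad\text{and}\quad -\infty<u(c)<\infty,$$ where $u(c)=\sup_{\phi\in\Phi(U,c)}EU(V_T^{c,\phi})$ and $\Phi(U,c)$ is the set of $\phi\in\Phi$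 for which $EU(V_T^{c,\phi})$ is well defined. -/

import Mathlib

open MeasureTheory ProbabilityTheory
open scoped ENNReal

namespace UtilityMax

/-! ### Generalized expectations of extended-real random variables -/

section Expectation

variable {Ω : Type*} {mΩ : MeasurableSpace Ω}

/-- The expectation `E X = E X⁺ - E X⁻` of an extended-real random variable is well defined:
the two parts are not both infinite. -/
def ExpDefined (μ : Measure Ω) (X : Ω → EReal) : Prop :=
  ¬ ((∫⁻ ω, (X ω).toENNReal ∂μ) = ∞ ∧ (∫⁻ ω, (-X ω).toENNReal ∂μ) = ∞)

/-- The expectation `E X = E X⁺ - E X⁻`, with values in `[-∞, ∞]`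
(meaningful when `ExpDefined μ X`). -/
noncomputable def extExp (μ : Measure Ω) (X : Ω → EReal) : EReal :=
  ((∫⁻ ω, (X ω).toENNReal ∂μ : ℝ≥0∞) : EReal) - ((∫⁻ ω, (-X ω).toENNReal ∂μ : ℝ≥0∞) : EReal)

/-- The generalized conditional expectation `E(X | m) = E(X⁺ | m) - E(X⁻ | m)` is well defined:
almost surely the two terms are not both infinite. -/
def CondExpDefined (μ : Measure Ω) (m : MeasurableSpace Ω) (X : Ω → EReal) : Prop :=
  ∀ᵐ ω ∂μ, ¬ (condLExp m μ (fun ω' => (X ω').toENNReal) ω = ∞ ∧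
    condLExp m μ (fun ω' => (-X ω').toENNReal) ω = ∞)

/-- The generalized conditional expectation `E(X | m) = E(X⁺ | m) - E(X⁻ | m)`, with values in
`[-∞, ∞]` (meaningful when `CondExpDefined μ m X`). -/
noncomputable def extCondExp (μ : Measure Ω) (m : MeasurableSpace Ω) (X : Ω → EReal) (ω : Ω) :
    EReal :=
  ((condLExp m μ (fun ω' => (X ω').toENNReal) ω : ℝ≥0∞) : EReal) -
    ((condLExp m μ (fun ω' => (-X ω').toENNReal) ω : ℝ≥0∞) : EReal)

theorem measurable_extCondExp (μ : Measure Ω) (m : MeasurableSpace Ω) (X : Ω → EReal) :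
    Measurable[m] (extCondExp μ m X) := by
  have h1 := (measurable_condLExp m μ fun ω' => (X ω').toENNReal).coe_ereal_ennreal
  have h2 := (measurable_condLExp m μ fun ω' => (-X ω').toENNReal).coe_ereal_ennreal
  have h : extCondExp μ m X = fun ω =>
      ((condLExp m μ (fun ω' => (X ω').toENNReal) ω : ℝ≥0∞) : EReal) +
        -((condLExp m μ (fun ω' => (-X ω').toENNReal) ω : ℝ≥0∞) : EReal) := rfl
  rw [h]
  exact h1.add h2.neg

end Expectation

/-! ### Essential supremum of a family of random variables -/

section EssSup

variable {Ω : Type*} {mΩ : MeasurableSpace Ω}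

/-- `g` is (a version of) the essential supremum of the family `f i`, `i ∈ I`, of `m`-measurable
random variables: it is `m`-measurable, it dominates every member of the family almost surely,
and it is almost surely the smallest random variable that does so. -/
def IsEssSup (μ : Measure Ω) (m : MeasurableSpace Ω) {ι : Type*} (I : Set ι)
    (f : ι → Ω → EReal) (g : Ω → EReal) : Prop :=
  Measurable[m] g ∧ (∀ i ∈ I, f i ≤ᵐ[μ] g) ∧
    ∀ h : Ω → EReal, Measurable[mΩ] h → (∀ i ∈ I, f i ≤ᵐ[μ] h) → g ≤ᵐ[μ] h

/-- The essential supremum of the family `f i`, `i ∈ I`: a chosen version. -/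
noncomputable def essSupFam (μ : Measure Ω) (m : MeasurableSpace Ω) {ι : Type*} (I : Set ι)
    (f : ι → Ω → EReal) : Ω → EReal :=
  Classical.epsilon (IsEssSup μ m I f)

/-- Essential suprema exist. -/
theorem isEssSup_essSupFam (μ : Measure Ω) [IsFiniteMeasure μ] (m : MeasurableSpace Ω)
    (hm : m ≤ mΩ) {ι : Type*} (I : Set ι) (f : ι → Ω → EReal)
    (hf : ∀ i ∈ I, Measurable[m] (f i)) : IsEssSup μ m I f (essSupFam μ m I f) := by
  apply Classical.epsilon_spec (p := IsEssSup μ m I f)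
  -- minimize the integral of a bounded strictly decreasing function of countable suprema
  let ψ : EReal → ℝ≥0∞ := fun x => (1 + EReal.exp x)⁻¹
  have hψm : Measurable ψ := (measurable_const.add EReal.measurable_exp).inv
  have hψlt : ∀ x y, x < y → ψ y < ψ x := fun x y h =>
    ENNReal.inv_lt_inv.2 (ENNReal.add_lt_add_left ENNReal.one_ne_top (EReal.exp_lt_exp_iff.2 h))
  have hψle : ∀ x y, x ≤ y → ψ y ≤ ψ x := fun x y h =>
    h.eq_or_lt.elim (fun e => e ▸ le_rfl) (fun h => (hψlt x y h).le)
  have hψ1 : ∀ x, ψ x ≤ 1 := fun x => ENNReal.inv_le_one.2 le_self_add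
  let g : Set ι → Ω → EReal := fun s ω => ⨆ i ∈ s, f i ω
  have hgm : ∀ s ⊆ I, s.Countable → Measurable[m] (g s) := fun s hs hc =>
    Measurable.biSup s hc (fun i hi => hf i (hs hi))
  let A : Set (Set ι) := {s | s ⊆ I ∧ s.Countable}
  let J : Set ℝ≥0∞ := (fun s => ∫⁻ ω, ψ (g s ω) ∂μ) '' A
  have hJ : J.Nonempty := ⟨_, ∅, ⟨Set.empty_subset _, Set.countable_empty⟩, rfl⟩
  obtain ⟨u, -, -, hu, huJ⟩ := exists_seq_tendsto_sInf hJ (OrderBot.bddBelow J) |>.imp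
    fun u h => (⟨trivial, trivial, h.2.1, h.2.2⟩ : True ∧ True ∧ _ ∧ _)
  choose s hsA hsu using huJ
  let s₀ : Set ι := ⋃ n, s n
  have hs₀ : s₀ ∈ A := ⟨Set.iUnion_subset fun n => (hsA n).1,
    Set.countable_iUnion fun n => (hsA n).2⟩
  have hmono : ∀ a b : Set ι, a ⊆ b → ∀ ω, g a ω ≤ g b ω := fun a b h ω => biSup_mono h
  have hmin : ∀ t ∈ A, ∫⁻ ω, ψ (g s₀ ω) ∂μ ≤ ∫⁻ ω, ψ (g t ω) ∂μ := by
    intro t ht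
    refine le_trans ?_ (sInf_le (show ∫⁻ ω, ψ (g t ω) ∂μ ∈ J from ⟨t, ht, rfl⟩))
    refine ge_of_tendsto' hu fun n => ?_
    rw [← hsu n]
    exact lintegral_mono fun ω => hψle _ _ (hmono _ _ (Set.subset_iUnion s n) ω)
  refine ⟨g s₀, hgm _ hs₀.1 hs₀.2, fun i hi => ?_, fun h _ hh => ?_⟩
  · have ht : insert i s₀ ∈ A := ⟨Set.insert_subset hi hs₀.1, hs₀.2.insert i⟩
    have hle : ∀ ω, ψ (g (insert i s₀) ω) ≤ ψ (g s₀ ω) := fun ω =>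
      hψle _ _ (hmono _ _ (Set.subset_insert i s₀) ω)
    have hfinite : ∫⁻ ω, ψ (g (insert i s₀) ω) ∂μ ≠ ∞ :=
      ((lintegral_mono fun ω => hψ1 _).trans_lt (by simp)).ne
    have hae := ae_eq_of_ae_le_of_lintegral_le (Filter.Eventually.of_forall hle) hfinite
      (hψm.comp ((hgm _ hs₀.1 hs₀.2).mono hm le_rfl)).aemeasurable (hmin _ ht)
    filter_upwards [hae] with ω hω
    have h1 : f i ω ≤ g (insert i s₀) ω := le_biSup (fun j => f j ω) (Set.mem_insert i s₀)
    refine h1.trans (le_of_not_gt fun hlt => ?_)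
    exact absurd hω (hψlt _ _ hlt).ne
  · have := (ae_ball_iff hs₀.2).2 fun i hi => hh i (hs₀.1 hi)
    filter_upwards [this] with ω hω
    exact iSup₂_le hω

end EssSup

/-! ### The market -/

section Market

variable {Ω : Type*} {mΩ : MeasurableSpace Ω} {d : ℕ}

/-- Predictable strategies over the horizon `T`: `φ t` is `ℱ (t - 1)`-measurable, `1 ≤ t ≤ T`. -/
def Strategies (ℱ : Filtration ℕ mΩ) (T : ℕ) : Set (ℕ → Ω → EuclideanSpace ℝ (Fin d)) :=
  {φ | ∀ t < T, Measurable[ℱ t] (φ (t + 1))}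

/-- The price increment `ΔS_t = S_t - S_{t-1}`, for `t ≥ 1`. -/
def increment (S : ℕ → Ω → EuclideanSpace ℝ (Fin d)) (t : ℕ) (ω : Ω) :
    EuclideanSpace ℝ (Fin d) :=
  S t ω - S (t - 1) ω

/-- The portfolio value `V_t = c + ∑_{i=1}^t ⟨φ_i, ΔS_i⟩`. -/
noncomputable def wealth (S : ℕ → Ω → EuclideanSpace ℝ (Fin d)) (c : ℝ)
    (φ : ℕ → Ω → EuclideanSpace ℝ (Fin d)) (t : ℕ) (ω : Ω) : ℝ :=
  c + ∑ i ∈ Finset.Icc 1 t, inner ℝ (φ i ω) (increment S i ω)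

/-- Absence of arbitrage. -/
def NoArbitrage (μ : Measure Ω) (ℱ : Filtration ℕ mΩ) (T : ℕ)
    (S : ℕ → Ω → EuclideanSpace ℝ (Fin d)) : Prop :=
  ∀ φ ∈ Strategies (d := d) ℱ T,
    (∀ᵐ ω ∂μ, 0 ≤ wealth S 0 φ T ω) → ∀ᵐ ω ∂μ, wealth S 0 φ T ω = 0

/-- The terminal utility `U(V_T)` of a strategy. -/
noncomputable def terminalUtility (U : ℝ → ℝ) (T : ℕ) (S : ℕ → Ω → EuclideanSpace ℝ (Fin d))
    (c : ℝ) (φ : ℕ → Ω → EuclideanSpace ℝ (Fin d)) (ω : Ω) : EReal :=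
  ((U (wealth S c φ T ω) : ℝ) : EReal)

/-- The strategies whose expected terminal utility is well defined. -/
def AdmissibleStrategies (μ : Measure Ω) (ℱ : Filtration ℕ mΩ) (T : ℕ)
    (S : ℕ → Ω → EuclideanSpace ℝ (Fin d)) (U : ℝ → ℝ) (c : ℝ) :
    Set (ℕ → Ω → EuclideanSpace ℝ (Fin d)) :=
  {φ | φ ∈ Strategies (d := d) ℱ T ∧ ExpDefined μ (terminalUtility U T S c φ)}

/-- The optimal value `u(c)`, the supremum of the expected terminal utility over all strategies
for which it is well defined. -/
noncomputable def optimalValue (μ : Measure Ω) (ℱ : Filtration ℕ mΩ) (T : ℕ)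
    (S : ℕ → Ω → EuclideanSpace ℝ (Fin d)) (U : ℝ → ℝ) (c : ℝ) : EReal :=
  ⨆ φ ∈ AdmissibleStrategies μ ℱ T S U c, extExp μ (terminalUtility U T S c φ)

/-! ### Dynamic value functions -/

/-- One-step gain: the random variable `V(x + ⟨ξ, Y⟩)` for a random function `V`. -/
noncomputable def stepGain (V : ℝ → Ω → EReal) (Y : Ω → EuclideanSpace ℝ (Fin d)) (x : ℝ)
    (ξ : Ω → EuclideanSpace ℝ (Fin d)) (ω : Ω) : EReal :=
  V (x + inner ℝ (ξ ω) (Y ω)) ω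

/-- `ess sup_ξ E(V(x + ⟨ξ, Y⟩) | m)` over all `m`-measurable `ξ`, for one fixed `x`. -/
noncomputable def stepEssSup (μ : Measure Ω) (m : MeasurableSpace Ω) (V : ℝ → Ω → EReal)
    (Y : Ω → EuclideanSpace ℝ (Fin d)) (x : ℝ) : Ω → EReal :=
  essSupFam μ m {ξ : Ω → EuclideanSpace ℝ (Fin d) | Measurable[m] ξ}
    (fun ξ => extCondExp μ m (stepGain V Y x ξ))

theorem isEssSup_stepEssSup (μ : Measure Ω) [IsFiniteMeasure μ] (m : MeasurableSpace Ω)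
    (hm : m ≤ mΩ) (V : ℝ → Ω → EReal) (Y : Ω → EuclideanSpace ℝ (Fin d)) (x : ℝ) :
    IsEssSup μ m {ξ : Ω → EuclideanSpace ℝ (Fin d) | Measurable[m] ξ}
      (fun ξ => extCondExp μ m (stepGain V Y x ξ)) (stepEssSup μ m V Y x) :=
  isEssSup_essSupFam μ m hm _ _ fun _ _ => measurable_extCondExp μ m _

/-- The regular version in `x` of the random function `x ↦ ess sup_ξ E(V(x + ⟨ξ, Y⟩) | m)`.
For each single `x` the essential supremum is determined only up to a null set, so it is taken
at rational points and extended to the real line as a nondecreasing left-continuous function. -/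
noncomputable def stepValue (μ : Measure Ω) (m : MeasurableSpace Ω) (V : ℝ → Ω → EReal)
    (Y : Ω → EuclideanSpace ℝ (Fin d)) (x : ℝ) (ω : Ω) : EReal :=
  ⨆ (q : ℚ) (_ : (q : ℝ) < x), stepEssSup μ m V Y (q : ℝ) ω

/-- The value function with `k` trading periods to go, that is, at time `T - k`. -/
noncomputable def valueToGo (μ : Measure Ω) (ℱ : Filtration ℕ mΩ) (T : ℕ)
    (S : ℕ → Ω → EuclideanSpace ℝ (Fin d)) (U : ℝ → ℝ) : ℕ → ℝ → Ω → EReal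
  | 0 => fun x _ => ((U x : ℝ) : EReal)
  | k + 1 => stepValue μ (ℱ (T - (k + 1))) (valueToGo μ ℱ T S U k) (increment S (T - k))

/-- The dynamic value function `U_t`, for `t ≤ T`: `U_T = U`, and `U_t` is the regular version of
`x ↦ ess sup_ξ E(U_{t+1}(x + ⟨ξ, ΔS_{t+1}⟩) | ℱ_t)` for `t < T`. -/
noncomputable def valueFn (μ : Measure Ω) (ℱ : Filtration ℕ mΩ) (T : ℕ)
    (S : ℕ → Ω → EuclideanSpace ℝ (Fin d)) (U : ℝ → ℝ) (t : ℕ) : ℝ → Ω → EReal :=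
  valueToGo μ ℱ T S U (T - t)

theorem valueFn_horizon (μ : Measure Ω) (ℱ : Filtration ℕ mΩ) (T : ℕ)
    (S : ℕ → Ω → EuclideanSpace ℝ (Fin d)) (U : ℝ → ℝ) :
    valueFn μ ℱ T S U T = fun x _ => ((U x : ℝ) : EReal) := by
  simp [valueFn, valueToGo]

theorem valueFn_of_lt (μ : Measure Ω) (ℱ : Filtration ℕ mΩ) {T t : ℕ} (ht : t < T)
    (S : ℕ → Ω → EuclideanSpace ℝ (Fin d)) (U : ℝ → ℝ) :
    valueFn μ ℱ T S U t =
      stepValue μ (ℱ t) (valueFn μ ℱ T S U (t + 1)) (increment S (t + 1)) := by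
  obtain ⟨k, rfl⟩ : ∃ k, T = t + 1 + k := ⟨T - (t + 1), by omega⟩
  have h1 : t + 1 + k - t = k + 1 := by omega
  have h2 : t + 1 + k - (t + 1) = k := by omega
  have h3 : t + 1 + k - (k + 1) = t := by omega
  have h4 : t + 1 + k - k = t + 1 := by omega
  simp only [valueFn, h1, h2, valueToGo, h3, h4]

/-- The value functions are well defined and finite: at each time `t < T` and for each `x`, the
conditional expectations under the essential supremum are well defined and the essential supremum
is almost surely `< ∞`; and `E U_0(x) < ∞` for each `x`. (Taking `ξ = 0` shows that
`U_0(x) ≥ U(x)`, so that `E U_0(x)` has no negative infinite part.) -/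
def ValueFinite (μ : Measure Ω) (ℱ : Filtration ℕ mΩ) (T : ℕ)
    (S : ℕ → Ω → EuclideanSpace ℝ (Fin d)) (U : ℝ → ℝ) : Prop :=
  (∀ t < T, ∀ x : ℝ,
    (∀ ξ : Ω → EuclideanSpace ℝ (Fin d), Measurable[ℱ t] ξ →
      CondExpDefined μ (ℱ t)
        (stepGain (valueFn μ ℱ T S U (t + 1)) (increment S (t + 1)) x ξ)) ∧
    ∀ᵐ ω ∂μ, stepEssSup μ (ℱ t) (valueFn μ ℱ T S U (t + 1)) (increment S (t + 1)) x ω < ⊤) ∧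
  ∀ x : ℝ, extExp μ (valueFn μ ℱ T S U 0 x) < ⊤

end Market

/-! ### Conditions on the utility function -/

/-- Utility functions: concave, nondecreasing, and vanishing at `0`. -/
def IsUtility (U : ℝ → ℝ) : Prop :=
  ConcaveOn ℝ Set.univ U ∧ Monotone U ∧ U 0 = 0

/-- Asymptotic elasticity condition at `+∞`. -/
def ElasticityAtTop (U : ℝ → ℝ) : Prop :=
  ∃ x₀ > (0 : ℝ), ∃ γ : ℝ, 0 < γ ∧ γ < 1 ∧
    ∀ x ≥ x₀, ∀ l ≥ (1 : ℝ), U (l * x) ≤ l ^ γ * U x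

/-- Asymptotic elasticity condition at `-∞`. -/
def ElasticityAtBot (U : ℝ → ℝ) : Prop :=
  ∃ α > (0 : ℝ), ∃ x₀ ≤ (0 : ℝ),
    ∀ x ≤ x₀, ∀ l ≥ (1 : ℝ), U (l * x) ≤ l ^ (1 + α) * U x

end UtilityMax

namespace UtilityMax

open Filter Topology

/-! ### Conditional expectations of `[0, ∞]`-valued random variables -/

section CondLExp

variable {Ω : Type*} {m mΩ : MeasurableSpace Ω} {μ : Measure Ω}

/-! If `U` is nowhere negative, concavity and `U 0 = 0` force `U = 0`, and every strategy is
optimal. Otherwise `U` is unbounded below, and either elasticity condition gives exponents `a < b`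
and a constant `C ≥ 0` such that `U (n x)` is at most both `n ^ a (U x + C)` and `n ^ b (U x + C)`
for integers `n ≥ 1` (`IsUtility.exists_exponents`); concavity supplies one of the exponents, namely
`1`. These bounds, together with concavity, monotonicity, domination of `U` and unboundedness below,
form `UtilityField`, a class that backward induction preserves.

The heart is coercivity (`IsMarketStep.nonneg_of_normalized`, `IsMarketStep.null_of_explosion`).
Divide an exploding sequence of positions by integers `N` proportional to its size. The exponent `b`
bounds the conditional negative part of the utility from below by `N ^ b` times that of the scaled
gain; the exponent `a` bounds the positive part by `N ^ a` times a finite quantity. If the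
conditional utility stays bounded below, the scaled negative parts are `O(N ^ (a - b))`, so by Fatou
every multiple `k` of the limiting normalized gain has utility at least `-C`. As the utility is
unbounded below, that gain is nonnegative. With capitals bounded above, absence of arbitrage makes
the limiting position redundant; chosen orthogonal to all redundant positions, it vanishes,
contradicting normalization.

Maximizing sequences can therefore be taken reduced and almost surely bounded; a measurable random
subsequence converges, and a reverse Fatou lemma shows that the limit is optimal
(`IsMarketStep.exists_condGe`). Optimizers then transfer the properties of the utility to the value
function: mixing them gives concavity, dividing them by `n` gives the growth bounds, and coercivity
along the capitals `-n` gives unboundedness below (`IsMarketStep.exists_value`).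

Gluing the periods together needs integrability. Comparing an optimal position with its half, and
using `2 ^ (-b) < 2 ^ (-a)`, bounds the positive part of its utility by integrable quantities
(`IsMarketStep.lintegral_gain_lt_top`). The one-step inequalities can then be integrated and
chained: forwards with equality in effect for the optimizer, backwards as upper bounds for any
strategy with integrable negative part. -/

/-- Both `g` and its conditional expectation are densities of the same measure on `m`, and the
`m`-measurable factor `f` is integrated only against that measure. -/
theorem condLExp_mul_left [IsProbabilityMeasure μ] (hm : m ≤ mΩ)
    {f g : Ω → ℝ≥0∞} (hf : Measurable[m] f)
    (hg : AEMeasurable g μ) :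
    condLExp m μ (fun ω => f ω * g ω) =ᵐ[μ] fun ω => f ω * condLExp m μ g ω := by
  refine (ae_eq_condLExp hm μ _ (hf.mul (measurable_condLExp m μ g)) fun s hs => ?_).symm
  have key : ∀ u : Ω → ℝ≥0∞, AEMeasurable u μ →
      ∫⁻ ω in s, f ω * u ω ∂μ = ∫⁻ ω, s.indicator f ω ∂((μ.withDensity u).trim hm) := by
    intro u hu
    have h1 : Measurable[m] (s.indicator f) := hf.indicator hs
    rw [lintegral_trim hm h1, lintegral_withDensity_eq_lintegral_mul₀ hu
      (h1.mono hm le_rfl).aemeasurable, ← lintegral_indicator (hm s hs)]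
    refine lintegral_congr fun ω => ?_
    by_cases h : ω ∈ s <;> simp [h, mul_comm]
  simp only [Pi.mul_apply]
  rw [key _ (measurable_condLExp' m μ g).aemeasurable, key _ hg]
  congr 1
  refine @Measure.ext _ m _ _ fun t ht => ?_
  rw [trim_measurableSet_eq hm ht, trim_measurableSet_eq hm ht, withDensity_apply _ (hm t ht),
    withDensity_apply _ (hm t ht), setLIntegral_condLExp hm μ g ht]

theorem lintegral_paste {ι : Type*} [Countable ι] [MeasurableSpace ι]
    [MeasurableSingletonClass ι] {τ : Ω → ι} (hτ : Measurable τ) (f : ι → Ω → ℝ≥0∞)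
    (s : Set Ω) (hs : MeasurableSet s) :
    ∫⁻ ω in s, f (τ ω) ω ∂μ = ∑' i, ∫⁻ ω in s ∩ τ ⁻¹' {i}, f i ω ∂μ := by
  have h1 : s = ⋃ i, s ∩ τ ⁻¹' {i} := by ext; simp
  have h2 : ∀ i, MeasurableSet (s ∩ τ ⁻¹' {i}) := fun i =>
    hs.inter (hτ (measurableSet_singleton i))
  conv_lhs => rw [h1]
  rw [lintegral_iUnion h2]
  · refine tsum_congr fun i => setLIntegral_congr_fun (h2 i) ?_
    rintro ω ⟨-, rfl⟩
    rfl
  · intro i j hij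
    refine Set.disjoint_left.2 ?_
    rintro ω ⟨-, rfl⟩ ⟨-, h⟩
    exact hij h

theorem measurable_paste {α ι β : Type*} [MeasurableSpace α] [Countable ι] [MeasurableSpace ι]
    [MeasurableSingletonClass ι] [MeasurableSpace β] {τ : α → ι} (hτ : Measurable τ)
    {f : ι → α → β} (hf : ∀ i, Measurable (f i)) : Measurable fun ω => f (τ ω) ω := by
  intro t ht
  have : (fun ω => f (τ ω) ω) ⁻¹' t = ⋃ i, τ ⁻¹' {i} ∩ f i ⁻¹' t := by ext; simp
  rw [this]
  exact MeasurableSet.iUnion fun i => (hτ (measurableSet_singleton i)).inter (hf i ht)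

/-- Conditioning is local on the countably many `m`-measurable sets where `τ` is constant. This
permits random choices of an index inside conditional expectations. -/
theorem condLExp_paste [IsProbabilityMeasure μ] (hm : m ≤ mΩ) {ι : Type*} [Countable ι] [MeasurableSpace ι]
    [MeasurableSingletonClass ι] {τ : Ω → ι} (hτ : Measurable[m] τ) (f : ι → Ω → ℝ≥0∞) :
    condLExp m μ (fun ω => f (τ ω) ω) =ᵐ[μ] fun ω => condLExp m μ (f (τ ω)) ω := by
  refine (ae_eq_condLExp hm μ _ ?_ fun s hs => ?_).symm
  · exact @measurable_paste Ω ι _ m _ _ _ _ _ hτ (fun i => condLExp m μ (f i)) fun i => measurable_condLExp m μ _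
  · have hτ' : Measurable τ := hτ.mono hm le_rfl
    rw [lintegral_paste hτ' (fun i => condLExp m μ (f i)) s (hm s hs),
      lintegral_paste hτ' f s (hm s hs)]
    exact tsum_congr fun i => setLIntegral_condLExp hm μ _ (hs.inter (hτ (measurableSet_singleton i)))

theorem condLExp_iSup [IsProbabilityMeasure μ] (hm : m ≤ mΩ) {f : ℕ → Ω → ℝ≥0∞} (hf : ∀ n, Measurable (f n))
    (hmono : ∀ ω, Monotone fun n => f n ω) :
    condLExp m μ (fun ω => ⨆ n, f n ω) =ᵐ[μ] fun ω => ⨆ n, condLExp m μ (f n) ω := by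
  refine (ae_eq_condLExp hm μ _ (Measurable.iSup fun n => measurable_condLExp m μ _)
    fun s hs => ?_).symm
  rw [lintegral_iSup hf fun i j h ω => hmono ω h,
    lintegral_iSup_ae (fun n => measurable_condLExp' m μ _) fun n => ae_restrict_of_ae
      (condLExp_mono (Eventually.of_forall fun ω => hmono ω n.le_succ))]
  exact iSup_congr fun n => setLIntegral_condLExp hm μ _ hs

theorem condLExp_liminf_le [IsProbabilityMeasure μ] (hm : m ≤ mΩ) {f : ℕ → Ω → ℝ≥0∞} (hf : ∀ n, Measurable (f n)) :
    condLExp m μ (fun ω => liminf (fun n => f n ω) atTop) ≤ᵐ[μ]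
      fun ω => liminf (fun n => condLExp m μ (f n) ω) atTop := by
  have h1 : (fun ω => liminf (fun n => f n ω) atTop) = fun ω => ⨆ k, ⨅ n ≥ k, f n ω := by
    funext ω; exact liminf_eq_iSup_iInf_of_nat
  rw [h1]
  have h2 := condLExp_iSup (μ := μ) hm (f := fun k ω => ⨅ n ≥ k, f n ω)
    (fun k => Measurable.biInf _ (Set.to_countable _) fun n _ => hf n)
    (fun ω i j hij => biInf_mono fun n hn => le_trans hij hn)
  have h3 : ∀ᵐ ω ∂μ, ∀ k n, k ≤ n →
      condLExp m μ (fun ω => ⨅ n ≥ k, f n ω) ω ≤ condLExp m μ (f n) ω := by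
    rw [ae_all_iff]; intro k; rw [ae_all_iff]; intro n
    by_cases hkn : k ≤ n
    · filter_upwards [condLExp_mono (mΩ := m) (P := μ) (X := fun ω => ⨅ n ≥ k, f n ω) (Y := f n)
        (Eventually.of_forall fun ω => iInf₂_le n hkn)] with ω h _ using h
    · exact Eventually.of_forall fun ω h => absurd h hkn
  filter_upwards [h2, h3] with ω h2 h3
  rw [h2, liminf_eq_iSup_iInf_of_nat]
  exact iSup_mono fun k => le_iInf₂ fun n hn => h3 k n hn

theorem ae_eq_zero_of_condLExp_eq_zero [IsProbabilityMeasure μ] (hm : m ≤ mΩ) {f : Ω → ℝ≥0∞} (hf : Measurable f)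
    {B : Set Ω} (hB : MeasurableSet[m] B) (h : ∀ᵐ ω ∂μ, ω ∈ B → condLExp m μ f ω = 0) :
    ∀ᵐ ω ∂μ, ω ∈ B → f ω = 0 := by
  have h1 := setLIntegral_condLExp hm μ f hB
  have h2 : ∫⁻ ω in B, condLExp m μ f ω ∂μ = 0 := by
    rw [lintegral_eq_zero_iff (measurable_condLExp' m μ f)]
    exact (ae_restrict_iff' (hm B hB)).2 h
  rw [h2] at h1
  have h3 := (lintegral_eq_zero_iff hf).1 h1.symm
  exact (ae_restrict_iff' (hm B hB)).1 h3

theorem condLExp_add_left' {X Y : Ω → ℝ≥0∞} (hX : Measurable X) :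
    condLExp m μ (fun ω => X ω + Y ω) =ᵐ[μ] fun ω => condLExp m μ X ω + condLExp m μ Y ω :=
  condLExp_add_left Y hX.aemeasurable

end CondLExp

/-! ### Measurable selection of convergent subsequences -/

section RandomSubsequence

variable {Ω : Type*} [MeasurableSpace Ω]

/-- The limit is the pointwise limsup, and the `k`-th index is the first one beyond `k` whose value
lies within `1 / (k + 1)` of it; a first index is measurable. -/
theorem exists_random_subsequence_real {y : ℕ → Ω → ℝ} (hy : ∀ n, Measurable (y n))
    (hb : ∀ ω, ∃ K, ∀ n, |y n ω| ≤ K) :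
    ∃ σ : ℕ → Ω → ℕ, (∀ k, Measurable (σ k)) ∧ (∀ k ω, k ≤ σ k ω) ∧ ∃ L : Ω → ℝ, Measurable L ∧
      ∀ ω, Tendsto (fun k => y (σ k ω) ω) atTop (𝓝 (L ω)) := by
  classical
  let L : Ω → ℝ := fun ω => limsup (fun n => y n ω) atTop
  have hL : Measurable L := Measurable.limsup hy
  have hex : ∀ (k : ℕ) ω, ∃ n, k ≤ n ∧ |y n ω - L ω| < 1 / ((k : ℝ) + 1) := by
    intro k ω
    obtain ⟨K, hK⟩ := hb ω
    have hpos : (0 : ℝ) < 1 / ((k : ℝ) + 1) := by positivity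
    have hbdd : IsBoundedUnder (· ≤ ·) atTop fun n => y n ω :=
      isBoundedUnder_of ⟨K, fun n => (abs_le.1 (hK n)).2⟩
    have hcob : IsCoboundedUnder (· ≤ ·) atTop fun n => y n ω :=
      (isBoundedUnder_of ⟨-K, fun n => (abs_le.1 (hK n)).1⟩ :
        IsBoundedUnder (· ≥ ·) atTop fun n => y n ω).isCoboundedUnder_le
    have h1 : ∃ᶠ n in atTop, L ω - 1 / ((k : ℝ) + 1) < y n ω :=
      frequently_lt_of_lt_limsup hcob (by simp only [L] at *; linarith)
    have h2 : ∀ᶠ n in atTop, y n ω < L ω + 1 / ((k : ℝ) + 1) :=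
      eventually_lt_of_limsup_lt (by simp only [L] at *; linarith) hbdd
    obtain ⟨n, h1, h2, h3⟩ := (h1.and_eventually (h2.and (eventually_ge_atTop k))).exists
    exact ⟨n, h3, abs_lt.2 ⟨by linarith, by linarith⟩⟩
  refine ⟨fun k ω => Nat.find (hex k ω), fun k => ?_, fun k ω => (Nat.find_spec (hex k ω)).1,
    L, hL, fun ω => ?_⟩
  · refine measurable_find _ fun n => ?_
    by_cases hkn : k ≤ n
    · simp only [hkn, true_and]
      exact measurableSet_lt ((hy n).sub hL).abs measurable_const
    · simp [hkn]
  · rw [tendsto_iff_dist_tendsto_zero]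
    refine squeeze_zero (fun _ => dist_nonneg) (fun k => ?_)
      (tendsto_one_div_add_atTop_nhds_zero_nat (𝕜 := ℝ))
    exact (Nat.find_spec (hex k ω)).2.le

/-- Coordinates are treated one at a time: passing to a further subsequence keeps the limits already
obtained. -/
theorem exists_random_subsequence {ι : Type*} [Finite ι] {y : ι → ℕ → Ω → ℝ}
    (hy : ∀ i n, Measurable (y i n)) (hb : ∀ i ω, ∃ K, ∀ n, |y i n ω| ≤ K) :
    ∃ σ : ℕ → Ω → ℕ, (∀ k, Measurable (σ k)) ∧ (∀ k ω, k ≤ σ k ω) ∧ ∃ L : ι → Ω → ℝ,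
      (∀ i, Measurable (L i)) ∧
      ∀ i ω, Tendsto (fun k => y i (σ k ω) ω) atTop (𝓝 (L i ω)) := by
  classical
  cases nonempty_fintype ι
  suffices h : ∀ s : Finset ι, ∃ σ : ℕ → Ω → ℕ, (∀ k, Measurable (σ k)) ∧ (∀ k ω, k ≤ σ k ω) ∧
      ∃ L : ι → Ω → ℝ, (∀ i, Measurable (L i)) ∧
      ∀ i ∈ s, ∀ ω, Tendsto (fun k => y i (σ k ω) ω) atTop (𝓝 (L i ω)) by
    obtain ⟨σ, h1, h2, L, h3, h4⟩ := h Finset.univ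
    exact ⟨σ, h1, h2, L, h3, fun i => h4 i (Finset.mem_univ i)⟩
  intro s
  induction s using Finset.induction_on with
  | empty => exact ⟨fun k _ => k, fun k => measurable_const, fun _ _ => le_rfl, fun _ _ => 0,
      fun _ => measurable_const, by simp⟩
  | insert j s hj ih =>
    obtain ⟨σ, h1, h2, L, h3, h4⟩ := ih
    obtain ⟨τ, t1, t2, l, t3, t4⟩ := exists_random_subsequence_real
      (y := fun k ω => y j (σ k ω) ω) (fun k => measurable_paste (h1 k) (hy j))
      (fun ω => (hb j ω).imp fun K hK n => hK _)
    refine ⟨fun k ω => σ (τ k ω) ω, fun k => measurable_paste (t1 k) h1,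
      fun k ω => (t2 k ω).trans (h2 _ ω), Function.update L j l, fun i => ?_, fun i hi ω => ?_⟩
    · by_cases h : i = j
      · subst h; simpa using t3
      · simpa [h] using h3 i
    · by_cases h : i = j
      · subst h; simpa using t4 ω
      · rw [Function.update_of_ne h]
        have hi' : i ∈ s := by simpa [h] using hi
        exact (h4 i hi' ω).comp (tendsto_atTop_mono (fun k => t2 k ω) tendsto_id)

end RandomSubsequence

/-! ### Orthogonal projection of measurable vector fields -/

section Projection

variable {Ω : Type*} [MeasurableSpace Ω] {ν : Measure Ω} [IsProbabilityMeasure ν] {d : ℕ}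

/-- Orthogonal decomposition of measurable vector fields along a family `N` that is stable under
sums, measurable scalings and almost sure limits. -/
theorem exists_orthogonal_part (N : (Ω → EuclideanSpace ℝ (Fin d)) → Prop)
    (hcongr : ∀ f g, f =ᵐ[ν] g → N f → N g) (h0 : N 0)
    (hadd : ∀ f g, N f → N g → N (f + g))
    (hsmul : ∀ (c : Ω → ℝ) f, Measurable c → N f → N (fun ω => c ω • f ω))
    (hlim : ∀ (f : ℕ → Ω → EuclideanSpace ℝ (Fin d)) g, (∀ n, N (f n)) →
      (∀ᵐ ω ∂ν, Tendsto (fun n => f n ω) atTop (𝓝 (g ω))) → N g)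
    {ξ : Ω → EuclideanSpace ℝ (Fin d)} (hξ : Measurable ξ) :
    ∃ ζ, Measurable ζ ∧ N ζ ∧
      ∀ η, Measurable η → N η → ∀ᵐ ω ∂ν, inner ℝ (ξ ω - ζ ω) (η ω) = (0 : ℝ) := by
  classical
  let K : Submodule ℝ (Lp (EuclideanSpace ℝ (Fin d)) 2 ν) :=
    { carrier := {f | N f}
      add_mem' := fun {f g} hf hg => hcongr _ _ (Lp.coeFn_add f g).symm (hadd _ _ hf hg)
      zero_mem' := hcongr _ _ (Lp.coeFn_zero _ _ _).symm h0
      smul_mem' := fun c f hf => hcongr _ _ (Lp.coeFn_smul c f).symm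
        (hsmul (fun _ => c) _ measurable_const hf) }
  have hK : IsClosed (K : Set (Lp (EuclideanSpace ℝ (Fin d)) 2 ν)) := by
    refine IsSeqClosed.isClosed fun f g hf hg => ?_
    obtain ⟨ns, -, h⟩ := (tendstoInMeasure_of_tendsto_Lp hg).exists_seq_tendsto_ae
    exact hlim (fun n => f (ns n)) g (fun n => hf _) h
  have : CompleteSpace K := hK.completeSpace_coe
  -- Only the constant basis fields, which are square integrable, are projected; the field `ξ`
  -- itself need not lie in `L²`.
  let e : Fin d → Lp (EuclideanSpace ℝ (Fin d)) 2 ν := fun i =>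
    (memLp_const (EuclideanSpace.single i (1 : ℝ))).toLp _
  let p : Fin d → Lp (EuclideanSpace ℝ (Fin d)) 2 ν := fun i => K.starProjection (e i)
  have hp : ∀ i, N (p i) := fun i => K.starProjection_apply_mem (e i)
  have hpm : ∀ i, Measurable (p i) := fun i => (Lp.stronglyMeasurable (p i)).measurable
  have hperp : ∀ i η, Measurable η → N η →
      ∀ᵐ ω ∂ν, inner ℝ (EuclideanSpace.single i (1 : ℝ) - p i ω) (η ω) = (0 : ℝ) := by
    intro i η hη hN
    let g : Ω → ℝ := fun ω => inner ℝ (EuclideanSpace.single i (1 : ℝ) - p i ω) (η ω)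
    have hg : Measurable g := (measurable_const.sub (hpm i)).inner hη
    -- This factor makes `c • η` bounded and has the sign of `g`. Orthogonality in `L²` then says
    -- that the nonnegative function `c g` has integral zero, which upgrades to pointwise
    -- orthogonality.
    let c : Ω → ℝ := fun ω => g ω / ((1 + |g ω|) * (1 + ‖η ω‖))
    have hc : Measurable c := hg.div ((measurable_const.add hg.abs).mul
      (measurable_const.add hη.norm))
    have hbd : ∀ ω, ‖c ω • η ω‖ ≤ 1 := by
      intro ω
      have h1 : 0 ≤ |g ω| := abs_nonneg _
      have h2 : 0 ≤ ‖η ω‖ := norm_nonneg _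
      rw [norm_smul, Real.norm_eq_abs, abs_div, abs_of_pos (show 0 < (1 + |g ω|) * (1 + ‖η ω‖) by
        positivity), div_mul_eq_mul_div, div_le_one (by positivity)]
      nlinarith
    have hL : MemLp (fun ω => c ω • η ω) 2 ν :=
      MemLp.of_bound (hc.smul hη).aestronglyMeasurable 1 (Eventually.of_forall hbd)
    have hmem : hL.toLp _ ∈ K := hcongr _ _ hL.coeFn_toLp.symm (hsmul c η hc hN)
    have hin : inner ℝ (e i - p i) (hL.toLp _) = (0 : ℝ) :=
      (Submodule.mem_orthogonal' K _).1 (K.sub_starProjection_mem_orthogonal (e i)) _ hmem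
    have hae : ∀ᵐ ω ∂ν, inner ℝ ((e i - p i : Lp (EuclideanSpace ℝ (Fin d)) 2 ν) ω)
        (hL.toLp _ ω) = c ω * g ω := by
      filter_upwards [Lp.coeFn_sub (e i) (p i), hL.coeFn_toLp,
        (memLp_const (p := 2) (μ := ν) (EuclideanSpace.single i (1 : ℝ))).coeFn_toLp]
        with ω h1 h2 h3
      have h3' : (e i) ω = EuclideanSpace.single i (1 : ℝ) := h3
      rw [h1, h2, Pi.sub_apply, h3', real_inner_smul_right]
    have hint := L2.integrable_inner (𝕜 := ℝ) (e i - p i) (hL.toLp _)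
    rw [L2.inner_def, integral_congr_ae hae] at hin
    have hnn : ∀ ω, 0 ≤ c ω * g ω := fun ω => by
      simp only [c]
      rw [div_mul_eq_mul_div]
      exact div_nonneg (mul_self_nonneg _) (by positivity)
    have hz := (integral_eq_zero_iff_of_nonneg hnn (hint.congr hae)).1 hin
    filter_upwards [hz] with ω hω
    have h1 : 0 < (1 + |g ω|) * (1 + ‖η ω‖) := by positivity
    have h2 : c ω * g ω = 0 := hω
    simp only [c] at h2
    rw [div_mul_eq_mul_div, div_eq_zero_iff] at h2
    rcases h2 with h2 | h2
    · exact mul_self_eq_zero.1 h2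
    · exact absurd h2 h1.ne'
  have hξi : ∀ i, Measurable fun ω => ξ ω i := fun i =>
    (EuclideanSpace.proj (𝕜 := ℝ) i).continuous.measurable.comp hξ
  -- Stability under measurable scalings lets the projection be extended from the basis by random
  -- coefficients.
  refine ⟨fun ω => ∑ i, ξ ω i • p i ω, ?_, ?_, fun η hη hN => ?_⟩
  · exact Finset.measurable_sum _ fun i _ => (hξi i).smul (hpm i)
  · have : ∀ s : Finset (Fin d), N (fun ω => ∑ i ∈ s, ξ ω i • p i ω) := by
      intro s
      induction s using Finset.induction_on with
      | empty => simp only [Finset.sum_empty]; exact h0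
      | insert i s hi ih =>
        simp only [Finset.sum_insert hi]
        exact hadd _ _ (hsmul _ _ (hξi i) (hp i)) ih
    exact this _
  · filter_upwards [ae_all_iff.2 fun i => hperp i η hη hN] with ω hω
    have h1 : ξ ω - ∑ i, ξ ω i • p i ω
        = ∑ i, ξ ω i • (EuclideanSpace.single i (1 : ℝ) - p i ω) := by
      simp only [smul_sub, Finset.sum_sub_distrib]
      congr 1
      ext j
      simp [Finset.sum_apply, Pi.single_apply]
    rw [h1, sum_inner]
    exact Finset.sum_eq_zero fun i _ => by rw [real_inner_smul_left, hω i, mul_zero]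

end Projection

/-! ### Redundant and reduced positions -/

section Reduced

variable {Ω : Type*} {mΩ : MeasurableSpace Ω} {d : ℕ}

/-- A position whose gain vanishes almost surely. -/
def IsRedundant (μ : Measure Ω) (m : MeasurableSpace Ω) (Y η : Ω → EuclideanSpace ℝ (Fin d)) :
    Prop :=
  Measurable[m] η ∧ ∀ᵐ ω ∂μ, inner ℝ (η ω) (Y ω) = (0 : ℝ)

/-- A position orthogonal to all redundant ones. -/
def IsReduced (μ : Measure Ω) (m : MeasurableSpace Ω) (Y ξ : Ω → EuclideanSpace ℝ (Fin d)) :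
    Prop :=
  Measurable[m] ξ ∧ ∀ η, IsRedundant μ m Y η → ∀ᵐ ω ∂μ, inner ℝ (ξ ω) (η ω) = (0 : ℝ)

end Reduced

section Reduced

variable {Ω : Type*} {m mΩ : MeasurableSpace Ω} {d : ℕ} {μ : Measure Ω}
  {Y : Ω → EuclideanSpace ℝ (Fin d)}

/-- Subtracting the redundant component leaves the gain unchanged. The projection is carried out for
the trimmed measure so that the result is `m`-measurable. -/
theorem exists_isReduced [IsProbabilityMeasure μ] (hm : m ≤ mΩ)
    {ξ : Ω → EuclideanSpace ℝ (Fin d)} (hξ : Measurable[m] ξ) :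
    ∃ ζ, IsReduced μ m Y ζ ∧ ∀ᵐ ω ∂μ, inner ℝ (ζ ω) (Y ω) = (inner ℝ (ξ ω) (Y ω) : ℝ) := by
  have : IsProbabilityMeasure (μ.trim hm) :=
    ⟨by rw [trim_measurableSet_eq hm MeasurableSet.univ, measure_univ]⟩
  obtain ⟨ζ, h1, h2, h3⟩ := @exists_orthogonal_part Ω m (μ.trim hm) _ d
    (fun η => ∀ᵐ ω ∂μ, inner ℝ (η ω) (Y ω) = (0 : ℝ))
    (fun f g hfg hf => by
      filter_upwards [ae_eq_of_ae_eq_trim hfg, hf] with ω h1 h2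
      rw [← h1, h2])
    (by simp)
    (fun f g hf hg => by
      filter_upwards [hf, hg] with ω h1 h2
      simp [inner_add_left, h1, h2])
    (fun c f _ hf => by
      filter_upwards [hf] with ω h1
      simp [real_inner_smul_left, h1])
    (fun f g hf hg => by
      filter_upwards [ae_all_iff.2 hf, ae_of_ae_trim hm hg] with ω h1 h2
      refine tendsto_nhds_unique (h2.inner tendsto_const_nhds) ?_
      simp [h1])
    ξ hξ
  refine ⟨fun ω => ξ ω - ζ ω, ⟨hξ.sub h1, fun η hη => ae_of_ae_trim hm (h3 η hη.1 hη.2)⟩, ?_⟩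
  filter_upwards [h2] with ω h2
  rw [inner_sub_left, h2, sub_zero]

theorem IsReduced.smul {ξ : Ω → EuclideanSpace ℝ (Fin d)} (h : IsReduced μ m Y ξ) {c : Ω → ℝ}
    (hc : Measurable[m] c) : IsReduced μ m Y fun ω => c ω • ξ ω :=
  ⟨hc.smul h.1, fun η hη => by
    filter_upwards [h.2 η hη] with ω h1
    rw [real_inner_smul_left, h1, mul_zero]⟩

theorem IsReduced.paste {ι : Type*} [Countable ι] [MeasurableSpace ι]
    [MeasurableSingletonClass ι] {ξ : ι → Ω → EuclideanSpace ℝ (Fin d)}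
    (h : ∀ i, IsReduced μ m Y (ξ i)) {τ : Ω → ι} (hτ : Measurable[m] τ) :
    IsReduced μ m Y fun ω => ξ (τ ω) ω :=
  ⟨@measurable_paste Ω ι _ m _ _ _ _ _ hτ ξ fun i => (h i).1, fun η hη => by
    filter_upwards [ae_all_iff.2 fun i => (h i).2 η hη] with ω h1 using h1 _⟩

theorem IsReduced.lim {ξ : ℕ → Ω → EuclideanSpace ℝ (Fin d)} (h : ∀ i, IsReduced μ m Y (ξ i))
    {ζ : Ω → EuclideanSpace ℝ (Fin d)} (hζ : Measurable[m] ζ)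
    (hlim : ∀ ω, Tendsto (fun n => ξ n ω) atTop (𝓝 (ζ ω))) : IsReduced μ m Y ζ :=
  ⟨hζ, fun η hη => by
    filter_upwards [ae_all_iff.2 fun i => (h i).2 η hη] with ω h1
    refine tendsto_nhds_unique ((hlim ω).inner tendsto_const_nhds) ?_
    simp [h1]⟩

end Reduced

/-! ### Conditional inequalities, random utilities and the one-period market -/

section Definitions

variable {Ω : Type*} {mΩ : MeasurableSpace Ω} {d : ℕ}

/-- Conditional expectation of the positive part of a real random variable. -/
noncomputable def condPos (μ : Measure Ω) (m : MeasurableSpace Ω) (X : Ω → ℝ) : Ω → ℝ≥0∞ :=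
  condLExp m μ fun ω => ENNReal.ofReal (X ω)

/-- Conditional expectation of the negative part of a real random variable. -/
noncomputable def condNeg (μ : Measure Ω) (m : MeasurableSpace Ω) (X : Ω → ℝ) : Ω → ℝ≥0∞ :=
  condLExp m μ fun ω => ENNReal.ofReal (-X ω)

/-- `E(X | m) ≥ A` almost surely, in subtraction-free form. -/
def CondGe (μ : Measure Ω) (m : MeasurableSpace Ω) (X A : Ω → ℝ) : Prop :=
  ∀ᵐ ω ∂μ, condNeg μ m X ω + ENNReal.ofReal (A ω) ≤ condPos μ m X ω + ENNReal.ofReal (-A ω)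

/-- `E(X | m) ≤ A` almost surely, in subtraction-free form. -/
def CondLe (μ : Measure Ω) (m : MeasurableSpace Ω) (X A : Ω → ℝ) : Prop :=
  ∀ᵐ ω ∂μ, condPos μ m X ω + ENNReal.ofReal (-A ω) ≤ condNeg μ m X ω + ENNReal.ofReal (A ω)

/-- The random variable `v(X + ⟨ξ, Y⟩)` for a real random field `v`. -/
noncomputable def gain (v : ℝ → Ω → ℝ) (Y : Ω → EuclideanSpace ℝ (Fin d)) (X : Ω → ℝ)
    (ξ : Ω → EuclideanSpace ℝ (Fin d)) (ω : Ω) : ℝ :=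
  v (X ω + inner ℝ (ξ ω) (Y ω)) ω

/-- Random utility functions dominating `U`, with growth exponents `a` and `b`. -/
structure UtilityField (m : MeasurableSpace Ω) (U : ℝ → ℝ) (a b C : ℝ) (v : ℝ → Ω → ℝ) :
    Prop where
  meas : ∀ x, Measurable[m] (v x)
  concave : ∀ ω, ConcaveOn ℝ Set.univ fun x => v x ω
  mono : ∀ ω, Monotone fun x => v x ω
  lower : ∀ x ω, U x ≤ v x ω
  unbdd : ∀ ω M, ∃ x, v x ω < M
  scale_left : ∀ ω x (n : ℕ), 1 ≤ n → v (n * x) ω ≤ (n : ℝ) ^ a * (v x ω + C)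
  scale_right : ∀ ω x (n : ℕ), 1 ≤ n → v (n * x) ω ≤ (n : ℝ) ^ b * (v x ω + C)

/-- A one-period arbitrage-free market with a random utility function at the end. -/
structure IsMarketStep (μ : Measure Ω) (m : MeasurableSpace Ω) (U : ℝ → ℝ) (a b C : ℝ)
    (v : ℝ → Ω → ℝ) (Y : Ω → EuclideanSpace ℝ (Fin d)) : Prop where
  le : m ≤ mΩ
  measY : Measurable[mΩ] Y
  field : UtilityField mΩ U a b C v
  fin : ∀ (x : ℝ) (ξ : Ω → EuclideanSpace ℝ (Fin d)), Measurable[m] ξ →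
    ∀ᵐ ω ∂μ, condPos μ m (gain v Y (fun _ => x) ξ) ω < ∞
  na : ∀ ξ : Ω → EuclideanSpace ℝ (Fin d), Measurable[m] ξ →
    (∀ᵐ ω ∂μ, 0 ≤ (inner ℝ (ξ ω) (Y ω) : ℝ)) → ∀ᵐ ω ∂μ, (inner ℝ (ξ ω) (Y ω) : ℝ) = 0
  a_pos : 0 < a
  a_lt_b : a < b
  C_nonneg : 0 ≤ C

end Definitions

section Field

variable {Ω : Type*} {m mΩ : MeasurableSpace Ω} {d : ℕ} {U : ℝ → ℝ} {a b C : ℝ}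
  {v : ℝ → Ω → ℝ}

theorem UtilityField.le (h : UtilityField m U a b C v) (hm : m ≤ mΩ) :
    UtilityField mΩ U a b C v :=
  ⟨fun x => (h.meas x).mono hm le_rfl, h.concave, h.mono, h.lower, h.unbdd, h.scale_left,
    h.scale_right⟩

theorem UtilityField.continuous (h : UtilityField m U a b C v) (ω : Ω) :
    Continuous fun x => v x ω :=
  continuousOn_univ.1 ((h.concave ω).continuousOn isOpen_univ)

theorem UtilityField.measurable_comp (h : UtilityField m U a b C v) {X : Ω → ℝ}
    (hX : Measurable[m] X) : Measurable[m] fun ω => v (X ω) ω :=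
  (measurable_uncurry_of_continuous_of_measurable (m := m) (u := v) h.continuous h.meas).comp
    (hX.prodMk measurable_id)

end Field

/-! ### Conditional inequalities: pasting and passage to the limit -/

section Calculus

variable {Ω : Type*} {m mΩ : MeasurableSpace Ω} {μ : Measure Ω} {X X' D A : Ω → ℝ}

theorem condPos_congr (h : X =ᵐ[μ] X') : condPos μ m X =ᵐ[μ] condPos μ m X' :=
  condLExp_congr_ae (h.fun_comp ENNReal.ofReal)

theorem condNeg_congr (h : X =ᵐ[μ] X') : condNeg μ m X =ᵐ[μ] condNeg μ m X' :=
  condLExp_congr_ae (h.fun_comp fun x => ENNReal.ofReal (-x))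

theorem condPos_mono (h : X ≤ᵐ[μ] X') : condPos μ m X ≤ᵐ[μ] condPos μ m X' :=
  condLExp_mono (h.mono fun _ h => ENNReal.ofReal_le_ofReal h)

theorem condNeg_anti (h : X ≤ᵐ[μ] X') : condNeg μ m X' ≤ᵐ[μ] condNeg μ m X :=
  condLExp_mono (h.mono fun _ h => ENNReal.ofReal_le_ofReal (neg_le_neg h))

theorem CondGe.congr (h : CondGe μ m X A) (hX : X =ᵐ[μ] X') : CondGe μ m X' A := by
  filter_upwards [h, condPos_congr (m := m) hX, condNeg_congr (m := m) hX] with ω h h1 h2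
  rwa [← h1, ← h2]

variable [IsProbabilityMeasure μ]

theorem condPos_paste (hm : m ≤ mΩ) {ι : Type*} [Countable ι] [MeasurableSpace ι]
    [MeasurableSingletonClass ι] {τ : Ω → ι} (hτ : Measurable[m] τ) (f : ι → Ω → ℝ) :
    condPos μ m (fun ω => f (τ ω) ω) =ᵐ[μ] fun ω => condPos μ m (f (τ ω)) ω :=
  condLExp_paste hm hτ fun i ω => ENNReal.ofReal (f i ω)

theorem condNeg_paste (hm : m ≤ mΩ) {ι : Type*} [Countable ι] [MeasurableSpace ι]
    [MeasurableSingletonClass ι] {τ : Ω → ι} (hτ : Measurable[m] τ) (f : ι → Ω → ℝ) :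
    condNeg μ m (fun ω => f (τ ω) ω) =ᵐ[μ] fun ω => condNeg μ m (f (τ ω)) ω :=
  condLExp_paste hm hτ fun i ω => ENNReal.ofReal (-f i ω)

theorem CondGe.paste (hm : m ≤ mΩ) {ι : Type*} [Countable ι] [MeasurableSpace ι]
    [MeasurableSingletonClass ι] {τ : Ω → ι} (hτ : Measurable[m] τ) {f A : ι → Ω → ℝ}
    (h : ∀ i, CondGe μ m (f i) (A i)) :
    CondGe μ m (fun ω => f (τ ω) ω) fun ω => A (τ ω) ω := by
  filter_upwards [ae_all_iff.2 h, condPos_paste (μ := μ) hm hτ f, condNeg_paste (μ := μ) hm hτ f]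
    with ω h h1 h2
  rw [h1, h2]
  exact h _

theorem ofReal_sub_add_ofReal {D X : ℝ} (hD : 0 ≤ D) (hX : X ≤ D) :
    ENNReal.ofReal (D - X) + ENNReal.ofReal X = ENNReal.ofReal D + ENNReal.ofReal (-X) := by
  rcases le_total 0 X with h | h
  · rw [← ENNReal.ofReal_add (by linarith) h, ENNReal.ofReal_of_nonpos (p := -X) (by linarith)]
    simp
  · rw [← ENNReal.ofReal_add hD (by linarith), ENNReal.ofReal_of_nonpos (p := X) h, add_zero,
      sub_eq_add_neg]

/-- Reverse Fatou lemma for generalized conditional expectations. -/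
theorem CondGe.lim (hm : m ≤ mΩ) {X : ℕ → Ω → ℝ} {Z D : Ω → ℝ} {A : ℕ → Ω → ℝ} {L : Ω → ℝ}
    (hX : ∀ n, Measurable (X n)) (hD : Measurable D) (hXD : ∀ n ω, X n ω ≤ D ω)
    (hfin : ∀ᵐ ω ∂μ, condPos μ m D ω < ∞)
    (hlim : ∀ ω, Tendsto (fun n => X n ω) atTop (𝓝 (Z ω)))
    (hA : ∀ᵐ ω ∂μ, Tendsto (fun n => A n ω) atTop (𝓝 (L ω)))
    (h : ∀ n, CondGe μ m (X n) (A n)) : CondGe μ m Z L := by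
  have hZ : Measurable Z := measurable_of_tendsto_metrizable hX (tendsto_pi_nhds.2 hlim)
  -- Replacing the bound by its positive part keeps `condPos` and allows `D'` to be split off with
  -- no negative part of its own.
  let D' : Ω → ℝ := fun ω => max (D ω) 0
  have hD' : Measurable D' := hD.max measurable_const
  have hofD : condPos μ m D = condPos μ m D' := by
    simp only [condPos, D']
    congr 1
    funext ω
    rcases le_total (D ω) 0 with h | h
    · simp [h, ENNReal.ofReal_of_nonpos h]
    · simp [h]
  -- A rearranged form of `E(D' - W) = E(D') - E(W)`. It translates the ordinary Fatou lemma for the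
  -- nonnegative variables `D' - X n` into a statement on positive and negative parts.
  have key : ∀ W : Ω → ℝ, Measurable W → (∀ ω, W ω ≤ D ω) → ∀ᵐ ω ∂μ,
      condLExp m μ (fun ω => ENNReal.ofReal (D' ω - W ω)) ω + condPos μ m W ω
        = condPos μ m D ω + condNeg μ m W ω := by
    intro W hW hWD
    have e1 := condLExp_add_left' (m := m) (μ := μ)
      (X := fun ω => ENNReal.ofReal (D' ω - W ω)) (Y := fun ω => ENNReal.ofReal (W ω))
      (hD'.sub hW).ennreal_ofReal
    have e2 := condLExp_add_left' (m := m) (μ := μ)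
      (X := fun ω => ENNReal.ofReal (D' ω)) (Y := fun ω => ENNReal.ofReal (-W ω))
      hD'.ennreal_ofReal
    have e3 : (fun ω => ENNReal.ofReal (D' ω - W ω) + ENNReal.ofReal (W ω))
        = fun ω => ENNReal.ofReal (D' ω) + ENNReal.ofReal (-W ω) := by
      funext ω
      exact ofReal_sub_add_ofReal (le_max_right _ _) ((hWD ω).trans (le_max_left _ _))
    rw [e3] at e1
    rw [hofD]
    filter_upwards [e1, e2] with ω h1 h2
    exact h1.symm.trans h2
  have hZD : ∀ ω, Z ω ≤ D ω := fun ω => le_of_tendsto' (hlim ω) fun n => hXD n ω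
  have fatou := condLExp_liminf_le (μ := μ) hm (f := fun n ω => ENNReal.ofReal (D' ω - X n ω))
    fun n => (hD'.sub (hX n)).ennreal_ofReal
  have hl : (fun ω => liminf (fun n => ENNReal.ofReal (D' ω - X n ω)) atTop)
      = fun ω => ENNReal.ofReal (D' ω - Z ω) := by
    funext ω
    exact (ENNReal.tendsto_ofReal (tendsto_const_nhds.sub (hlim ω))).liminf_eq
  rw [hl] at fatou
  filter_upwards [fatou, hfin, hA, ae_all_iff.2 h, key Z hZ hZD,
    ae_all_iff.2 fun n => key (X n) (hX n) (hXD n),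
    ae_all_iff.2 fun n => condPos_mono (m := m) (Eventually.of_forall (hXD n)),
    condPos_mono (m := m) (μ := μ) (Eventually.of_forall hZD)]
    with ω fatou hfin hA h kZ kX mX mZ
  set e : ℕ → ℝ≥0∞ := fun n => condLExp m μ (fun ω => ENNReal.ofReal (D' ω - X n ω)) ω
  have h1 : ∀ n, e n + ENNReal.ofReal (A n ω) ≤ condPos μ m D ω + ENNReal.ofReal (-A n ω) := by
    intro n
    have hf : condPos μ m (X n) ω ≠ ∞ := ((mX n).trans_lt hfin).ne
    refine (ENNReal.add_le_add_iff_right hf).1 ?_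
    calc e n + ENNReal.ofReal (A n ω) + condPos μ m (X n) ω
        = condPos μ m D ω + (condNeg μ m (X n) ω + ENNReal.ofReal (A n ω)) := by
          rw [add_right_comm, kX n, add_assoc]
      _ ≤ condPos μ m D ω + (condPos μ m (X n) ω + ENNReal.ofReal (-A n ω)) := by
          exact add_le_add_right (h n) _
      _ = _ := by ring
  have hA1 : Tendsto (fun n => ENNReal.ofReal (A n ω)) atTop (𝓝 (ENNReal.ofReal (L ω))) :=
    ENNReal.tendsto_ofReal hA
  have hA2 : Tendsto (fun n => ENNReal.ofReal (-A n ω)) atTop (𝓝 (ENNReal.ofReal (-L ω))) :=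
    ENNReal.tendsto_ofReal hA.neg
  have h2 : liminf e atTop + ENNReal.ofReal (L ω)
      ≤ condPos μ m D ω + ENNReal.ofReal (-L ω) := by
    have t1 : Tendsto (fun n => condPos μ m D ω + ENNReal.ofReal (-A n ω)) atTop
        (𝓝 (condPos μ m D ω + ENNReal.ofReal (-L ω))) := tendsto_const_nhds.add hA2
    have t2 : ENNReal.ofReal (L ω) ≤ condPos μ m D ω + ENNReal.ofReal (-L ω) :=
      le_of_tendsto_of_tendsto' hA1 t1 fun n => le_trans le_add_self (h1 n)
    have t3 : liminf e atTop
        ≤ condPos μ m D ω + ENNReal.ofReal (-L ω) - ENNReal.ofReal (L ω) := by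
      rw [← (ENNReal.Tendsto.sub t1 hA1 (Or.inr ENNReal.ofReal_ne_top)).liminf_eq]
      exact liminf_le_liminf (Eventually.of_forall fun n =>
        ENNReal.le_sub_of_add_le_right ENNReal.ofReal_ne_top (h1 n))
    calc liminf e atTop + ENNReal.ofReal (L ω) ≤ _ := add_le_add_left t3 _
      _ = _ := tsub_add_cancel_of_le t2
  have h3 : condLExp m μ (fun ω => ENNReal.ofReal (D' ω - Z ω)) ω + ENNReal.ofReal (L ω)
      ≤ condPos μ m D ω + ENNReal.ofReal (-L ω) := le_trans (by gcongr) h2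
  refine (ENNReal.add_le_add_iff_left hfin.ne).1 ?_
  calc condPos μ m D ω + (condNeg μ m Z ω + ENNReal.ofReal (L ω))
      = (condLExp m μ (fun ω => ENNReal.ofReal (D' ω - Z ω)) ω + ENNReal.ofReal (L ω))
          + condPos μ m Z ω := by rw [← add_assoc, ← kZ]; ring
    _ ≤ (condPos μ m D ω + ENNReal.ofReal (-L ω)) + condPos μ m Z ω := by gcongr
    _ = _ := by ring

end Calculus

/-! ### Finiteness of positive parts and nonnegativity of normalized limits -/

section MarketStep

variable {Ω : Type*} {m mΩ : MeasurableSpace Ω} {μ : Measure Ω} {d : ℕ}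
  {U : ℝ → ℝ} {a b C : ℝ} {v : ℝ → Ω → ℝ} {Y : Ω → EuclideanSpace ℝ (Fin d)}

theorem gain_congr {X : Ω → ℝ} {ξ ζ : Ω → EuclideanSpace ℝ (Fin d)}
    (h : ∀ᵐ ω ∂μ, inner ℝ (ζ ω) (Y ω) = (inner ℝ (ξ ω) (Y ω) : ℝ)) :
    gain v Y X ζ =ᵐ[μ] gain v Y X ξ := by
  filter_upwards [h] with ω h
  simp only [gain, h]

namespace IsMarketStep

theorem measurable_gain (h : IsMarketStep μ m U a b C v Y) {X : Ω → ℝ} (hX : Measurable[m] X)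
    {ξ : Ω → EuclideanSpace ℝ (Fin d)} (hξ : Measurable[m] ξ) : Measurable (gain v Y X ξ) :=
  h.field.measurable_comp ((hX.mono h.le le_rfl).add ((hξ.mono h.le le_rfl).inner h.measY))

variable [IsProbabilityMeasure μ]

/-- Finiteness is assumed for constant capitals only; by monotonicity, rounding up to the integer
`⌈X⌉` and pasting give it for random ones. -/
theorem condPos_gain_lt_top (h : IsMarketStep μ m U a b C v Y) {X : Ω → ℝ}
    (hX : Measurable[m] X) {ξ : Ω → EuclideanSpace ℝ (Fin d)} (hξ : Measurable[m] ξ) :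
    ∀ᵐ ω ∂μ, condPos μ m (gain v Y X ξ) ω < ∞ := by
  have hτ : Measurable[m] fun ω => ⌈X ω⌉ := Int.measurable_ceil.comp hX
  have h1 := condPos_paste (μ := μ) h.le hτ fun i : ℤ => gain v Y (fun _ => (i : ℝ)) ξ
  have h2 := condPos_mono (μ := μ) (m := m) (X := gain v Y X ξ)
    (X' := fun ω => gain v Y (fun _ => (⌈X ω⌉ : ℝ)) ξ ω)
    (Eventually.of_forall fun ω => h.field.mono ω (by gcongr; exact Int.le_ceil _))
  filter_upwards [h1, h2, ae_all_iff.2 fun i : ℤ => h.fin i ξ hξ] with ω h1 h2 h3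
  exact h2.trans_lt (h1.trans_lt (h3 _))

/-- The norm of `Y` is at most its `ℓ¹` norm, the largest inner product of `Y` with one of the `2 ^
d` sign vectors. Hence finitely many admissible positions dominate all positions of norm at most
`R`; this supplies the majorant for Fatou. -/
theorem condPos_norm_lt_top (h : IsMarketStep μ m U a b C v Y) {X R : Ω → ℝ}
    (hX : Measurable[m] X) (hR : Measurable[m] R) (hR0 : ∀ ω, 0 ≤ R ω) :
    ∀ᵐ ω ∂μ, condPos μ m (fun ω => v (X ω + R ω * ‖Y ω‖) ω) ω < ∞ := by
  classical
  let θ : (Fin d → Bool) → EuclideanSpace ℝ (Fin d) := fun s =>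
    WithLp.toLp 2 fun i => if s i then (1 : ℝ) else -1
  have hθ : ∀ s, Measurable[m] fun ω => R ω • θ s := fun s => hR.smul measurable_const
  have hle : ∀ y : EuclideanSpace ℝ (Fin d), ∃ s, ‖y‖ ≤ inner ℝ (θ s) y := by
    intro y
    refine ⟨fun i => decide (0 ≤ y i), ?_⟩
    have h1 : inner ℝ (θ fun i => decide (0 ≤ y i)) y = ∑ i, |y i| := by
      rw [PiLp.inner_apply]
      refine Finset.sum_congr rfl fun i _ => ?_
      by_cases hi : 0 ≤ y i
      · simp [θ, hi, abs_of_nonneg hi]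
      · simp [θ, hi, abs_of_neg (not_le.1 hi)]
    rw [h1]
    have h2 : y = ∑ i, EuclideanSpace.single i (y i) := by
      ext j
      simp [Finset.sum_apply, Pi.single_apply]
    calc ‖y‖ = ‖∑ i, EuclideanSpace.single i (y i)‖ := by rw [← h2]
      _ ≤ ∑ i, ‖EuclideanSpace.single i (y i)‖ := norm_sum_le _ _
      _ = ∑ i, |y i| := by simp
  have hsum := condLExp_finsetSum m (P := μ) Finset.univ
    (X := fun s ω => ENNReal.ofReal (gain v Y X (fun ω => R ω • θ s) ω))
    fun s => (h.measurable_gain hX (hθ s)).ennreal_ofReal.aemeasurable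
  have hmono : condPos μ m (fun ω => v (X ω + R ω * ‖Y ω‖) ω) ≤ᵐ[μ] condLExp m μ
      (∑ s, fun ω => ENNReal.ofReal (gain v Y X (fun ω => R ω • θ s) ω)) := by
    refine condLExp_mono (Eventually.of_forall fun ω => ?_)
    obtain ⟨s, hs⟩ := hle (Y ω)
    simp only [Finset.sum_apply]
    refine le_trans (ENNReal.ofReal_le_ofReal ?_) (Finset.single_le_sum
      (f := fun s => ENNReal.ofReal (gain v Y X (fun ω => R ω • θ s) ω))
      (fun _ _ => zero_le) (Finset.mem_univ s))
    refine h.field.mono ω ?_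
    rw [real_inner_smul_left]
    gcongr
    exact hR0 ω
  filter_upwards [hsum, hmono, ae_all_iff.2 fun s => h.condPos_gain_lt_top hX (hθ s)]
    with ω h1 h2 h3
  refine h2.trans_lt (h1.trans_lt ?_)
  simp only [Finset.sum_apply]
  exact ENNReal.sum_lt_top.2 fun s _ => h3 s

/-- If positions of exploding size keep their conditional utility bounded below, then the limit
of the normalized gains is almost surely nonnegative. -/
theorem nonneg_of_normalized (h : IsMarketStep μ m U a b C v Y) {X : ℕ → Ω → ℝ}
    {ξ : ℕ → Ω → EuclideanSpace ℝ (Fin d)} (hX : ∀ n, Measurable[m] (X n))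
    (hξ : ∀ n, Measurable[m] (ξ n)) {B : Set Ω} (hB : MeasurableSet[m] B)
    (hinf : ∀ ω ∈ B, Tendsto (fun n => |X n ω| + ‖ξ n ω‖) atTop atTop)
    (hM : ∀ᵐ ω ∂μ, ω ∈ B → ∃ M : ℝ≥0∞, M ≠ ∞ ∧ ∀ n,
      condNeg μ m (gain v Y (X n) (ξ n)) ω ≤ condPos μ m (gain v Y (X n) (ξ n)) ω + M)
    {r : Ω → ℝ} {η : Ω → EuclideanSpace ℝ (Fin d)}
    (hr : ∀ ω, Tendsto (fun n => X n ω / (|X n ω| + ‖ξ n ω‖)) atTop (𝓝 (r ω)))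
    (hη : ∀ ω, Tendsto (fun n => (|X n ω| + ‖ξ n ω‖)⁻¹ • ξ n ω) atTop (𝓝 (η ω))) :
    ∀ᵐ ω ∂μ, ω ∈ B → 0 ≤ r ω + inner ℝ (η ω) (Y ω) := by
  let l : ℕ → Ω → ℝ := fun n ω => |X n ω| + ‖ξ n ω‖
  have hl0 : ∀ n ω, 0 ≤ l n ω := fun n ω => by positivity
  have hlm : ∀ n, Measurable[m] (l n) := fun n => (continuous_abs.measurable.comp (hX n)).add (measurable_norm.comp (hξ n))
  have key : ∀ k : ℕ, 1 ≤ k → ∀ᵐ ω ∂μ, ω ∈ B → -C ≤ v (k * (r ω + inner ℝ (η ω) (Y ω))) ω := by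
    intro k hk
    have hk0 : (0 : ℝ) < k := by exact_mod_cast hk
    -- An integer, as the growth bounds require, with `l ≤ k N` and `l / N → k`. The scaled gain `u`
    -- is thus at most `k + k ‖Y‖` and converges to `k` times the normalized limit.
    let N : ℕ → Ω → ℕ := fun n ω => ⌊l n ω / k⌋₊ + 1
    have hN1 : ∀ n ω, 1 ≤ N n ω := fun n ω => Nat.le_add_left _ _
    have hNpos : ∀ n ω, (0 : ℝ) < N n ω := fun n ω => by exact_mod_cast hN1 n ω
    have hNl : ∀ n ω, l n ω ≤ k * N n ω := fun n ω => by
      have := (Nat.lt_floor_add_one (l n ω / k)).le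
      rw [div_le_iff₀ hk0] at this
      simp only [N]; push_cast; linarith
    have hNm : ∀ n, Measurable[m] fun ω => (N n ω : ℝ) := fun n => by
      have : Measurable[m] fun ω => ⌊l n ω / k⌋₊ := Nat.measurable_floor.comp ((hlm n).div_const _)
      exact (measurable_from_top (f := fun i : ℕ => ((i + 1 : ℕ) : ℝ))).comp this
    let u : ℕ → Ω → ℝ := fun n ω => (X n ω + inner ℝ (ξ n ω) (Y ω)) / N n ω
    have hum : ∀ n, Measurable (u n) := fun n =>
      (((hX n).mono h.le le_rfl).add (((hξ n).mono h.le le_rfl).inner h.measY)).div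
        ((hNm n).mono h.le le_rfl)
    have hu : ∀ n ω, u n ω ≤ k + k * ‖Y ω‖ := fun n ω => by
      rw [div_le_iff₀ (hNpos n ω)]
      have h1 : X n ω ≤ k * N n ω := le_trans (le_trans (le_abs_self _)
        (le_add_of_nonneg_right (norm_nonneg _))) (hNl n ω)
      have h2 : ‖ξ n ω‖ ≤ k * N n ω := le_trans (le_add_of_nonneg_left (abs_nonneg _)) (hNl n ω)
      have h3 : inner ℝ (ξ n ω) (Y ω) ≤ k * N n ω * ‖Y ω‖ :=
        (real_inner_le_norm _ _).trans (mul_le_mul_of_nonneg_right h2 (norm_nonneg _))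
      linarith
    let f : ℕ → Ω → ℝ≥0∞ := fun n ω => ENNReal.ofReal (-(v (u n ω) ω + C))
    have hfm : ∀ n, Measurable (f n) := fun n =>
      ((h.field.measurable_comp (hum n)).add_const C).neg.ennreal_ofReal
    let G : Ω → ℝ := fun ω => v (k + k * ‖Y ω‖) ω
    have hGm : Measurable G := h.field.measurable_comp
      (measurable_const.add (measurable_const.mul h.measY.norm))
    have hGfin : ∀ᵐ ω ∂μ, condPos μ m G ω < ∞ :=
      h.condPos_norm_lt_top (X := fun _ => (k : ℝ)) (R := fun _ => (k : ℝ)) measurable_const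
        measurable_const fun _ => hk0.le
    have hgu : ∀ n ω, gain v Y (X n) (ξ n) ω = v (N n ω * u n ω) ω := fun n ω => by
      simp only [gain, u]
      rw [mul_div_cancel₀ _ (hNpos n ω).ne']
    have hpa : ∀ n, Measurable[m] fun ω => ENNReal.ofReal ((N n ω : ℝ) ^ a) := fun n =>
      ((hNm n).pow_const a).ennreal_ofReal
    have hpb : ∀ n, Measurable[m] fun ω => ENNReal.ofReal ((N n ω : ℝ) ^ b) := fun n =>
      ((hNm n).pow_const b).ennreal_ofReal
    have hneg : ∀ n, ∀ᵐ ω ∂μ, ENNReal.ofReal ((N n ω : ℝ) ^ b) * condLExp m μ (f n) ω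
        ≤ condNeg μ m (gain v Y (X n) (ξ n)) ω := fun n => by
      have h1 := condLExp_mono (mΩ := m) (P := μ)
        (X := fun ω => ENNReal.ofReal ((N n ω : ℝ) ^ b) * f n ω)
        (Y := fun ω => ENNReal.ofReal (-gain v Y (X n) (ξ n) ω)) (Eventually.of_forall fun ω => by
          simp only [f]
          rw [← ENNReal.ofReal_mul (by positivity)]
          refine ENNReal.ofReal_le_ofReal ?_
          have := h.field.scale_right ω (u n ω) (N n ω) (hN1 n ω)
          rw [hgu]; linarith)
      filter_upwards [h1, condLExp_mul_left (μ := μ) h.le (hpb n) (hfm n).aemeasurable]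
        with ω h1 h2
      rw [← h2]; exact h1
    have hpos : ∀ n, ∀ᵐ ω ∂μ, condPos μ m (gain v Y (X n) (ξ n)) ω ≤
        ENNReal.ofReal ((N n ω : ℝ) ^ a) * (condPos μ m G ω + ENNReal.ofReal C) := fun n => by
      have h1 := condLExp_mono (mΩ := m) (P := μ)
        (X := fun ω => ENNReal.ofReal (gain v Y (X n) (ξ n) ω))
        (Y := fun ω => ENNReal.ofReal ((N n ω : ℝ) ^ a) *
          (ENNReal.ofReal (G ω) + ENNReal.ofReal C)) (Eventually.of_forall fun ω => by
          refine le_trans (ENNReal.ofReal_le_ofReal (q := (N n ω : ℝ) ^ a * (G ω + C)) ?_) ?_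
          · rw [hgu]
            refine (h.field.scale_left ω (u n ω) (N n ω) (hN1 n ω)).trans ?_
            exact mul_le_mul_of_nonneg_left (add_le_add_left (h.field.mono ω (hu n ω)) C)
              (by positivity)
          · rw [ENNReal.ofReal_mul (by positivity)]
            exact mul_le_mul' le_rfl ENNReal.ofReal_add_le)
      filter_upwards [h1, condLExp_mul_left (μ := μ) h.le (hpa n)
        (hGm.ennreal_ofReal.add_const (ENNReal.ofReal C)).aemeasurable,
        condLExp_add_left' (μ := μ) (m := m) (Y := fun _ => ENNReal.ofReal C) hGm.ennreal_ofReal]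
        with ω h1 h2 h3
      refine h1.trans (h2.le.trans ?_)
      rw [h3, condLExp_const h.le]
      rfl
    have fatou := condLExp_liminf_le (μ := μ) h.le hfm
    have hzero : ∀ᵐ ω ∂μ, ω ∈ B → condLExp m μ (fun ω => liminf (fun n => f n ω) atTop) ω = 0 := by
      filter_upwards [fatou, hM, hGfin, ae_all_iff.2 hneg, ae_all_iff.2 hpos]
        with ω fatou hM hG hneg hpos hωB
      obtain ⟨M, hMtop, hM⟩ := hM hωB
      set g : ℝ≥0∞ := condPos μ m G ω + ENNReal.ofReal C
      have hg : g + M ≠ ∞ := by simp [g, hG.ne, hMtop]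
      -- Here the strict inequality `a < b` enters: the negative side scales with `N ^ b`, the
      -- positive side and the slack `M` at most with `N ^ a`.
      have hbd : ∀ n, condLExp m μ (f n) ω
          ≤ ENNReal.ofReal ((N n ω : ℝ) ^ (-(b - a))) * (g + M) := fun n => by
        have hp1 : (1 : ℝ) ≤ (N n ω : ℝ) ^ a :=
          Real.one_le_rpow (by exact_mod_cast hN1 n ω) h.a_pos.le
        have e1 : ENNReal.ofReal ((N n ω : ℝ) ^ b) * condLExp m μ (f n) ω
            ≤ ENNReal.ofReal ((N n ω : ℝ) ^ a) * (g + M) := by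
          rw [mul_add]
          refine (hneg n).trans ((hM n).trans (add_le_add (hpos n) ?_))
          exact le_mul_of_one_le_left' (by simpa using hp1)
        calc condLExp m μ (f n) ω
            = ENNReal.ofReal ((N n ω : ℝ) ^ (-b)) *
                (ENNReal.ofReal ((N n ω : ℝ) ^ b) * condLExp m μ (f n) ω) := by
              rw [← mul_assoc, ← ENNReal.ofReal_mul (by positivity), ← Real.rpow_add (hNpos n ω)]
              simp
          _ ≤ ENNReal.ofReal ((N n ω : ℝ) ^ (-b)) *
                (ENNReal.ofReal ((N n ω : ℝ) ^ a) * (g + M)) := by gcongr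
          _ = _ := by
              rw [← mul_assoc, ← ENNReal.ofReal_mul (by positivity), ← Real.rpow_add (hNpos n ω)]
              congr 3; ring
      have hNinf : Tendsto (fun n => (N n ω : ℝ)) atTop atTop := by
        refine tendsto_atTop_mono (fun n => ?_) ((hinf ω hωB).atTop_div_const hk0)
        rw [div_le_iff₀ hk0, mul_comm]
        exact hNl n ω
      have ht : Tendsto (fun n => ENNReal.ofReal ((N n ω : ℝ) ^ (-(b - a))) * (g + M)) atTop
          (𝓝 0) := by
        have h1 := (tendsto_rpow_neg_atTop (sub_pos.2 h.a_lt_b)).comp hNinf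
        have h2 := ENNReal.Tendsto.mul_const (ENNReal.tendsto_ofReal h1) (Or.inr hg)
        simpa using h2
      refine le_antisymm (fatou.trans ?_) zero_le
      rw [← ht.liminf_eq]
      exact liminf_le_liminf (Eventually.of_forall hbd)
    have hz := ae_eq_zero_of_condLExp_eq_zero h.le (Measurable.liminf hfm) hB hzero
    filter_upwards [hz] with ω hz hωB
    have hinfω := hinf ω hωB
    have hlN : Tendsto (fun n => l n ω / N n ω) atTop (𝓝 (k : ℝ)) := by
      have h1 : Tendsto (fun n => (⌊l n ω / k⌋₊ : ℝ) / (l n ω / k)) atTop (𝓝 1) :=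
        (tendsto_nat_floor_div_atTop (R := ℝ)).comp (hinfω.atTop_div_const hk0)
      have h2 : Tendsto (fun n => 1 / (l n ω / k)) atTop (𝓝 0) :=
        (hinfω.atTop_div_const hk0).const_div_atTop 1
      have h3 := (h1.add h2).inv₀ (by norm_num)
      have h4 := h3.const_mul (k : ℝ)
      simp only [add_zero, inv_one, mul_one] at h4
      refine h4.congr' ?_
      filter_upwards [hinfω.eventually_gt_atTop 0] with n hn
      have hn' : l n ω ≠ 0 := ne_of_gt hn
      simp only [N]
      rw [← add_div, inv_div]
      push_cast
      field_simp
    have hu_lim : Tendsto (fun n => u n ω) atTop (𝓝 (k * (r ω + inner ℝ (η ω) (Y ω)))) := by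
      have h1 := hlN.mul ((hr ω).add ((hη ω).inner (𝕜 := ℝ) (tendsto_const_nhds (x := Y ω))))
      refine h1.congr' ?_
      filter_upwards [hinfω.eventually_gt_atTop 0] with n hn
      have hn' : |X n ω| + ‖ξ n ω‖ ≠ 0 := ne_of_gt hn
      have hN' := (hNpos n ω).ne'
      simp only [u, l, real_inner_smul_left]
      field_simp
    have hf_lim : Tendsto (fun n => f n ω) atTop
        (𝓝 (ENNReal.ofReal (-(v (k * (r ω + inner ℝ (η ω) (Y ω))) ω + C)))) :=
      ENNReal.tendsto_ofReal
        ((((h.field.continuous ω).tendsto _).comp hu_lim).add_const C).neg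
    have := hz hωB
    rw [hf_lim.liminf_eq, ENNReal.ofReal_eq_zero] at this
    linarith
  have hall : ∀ᵐ ω ∂μ, ∀ k : ℕ, 1 ≤ k → ω ∈ B → -C ≤ v (k * (r ω + inner ℝ (η ω) (Y ω))) ω := by
    refine ae_all_iff.2 fun k => ?_
    by_cases hk : 1 ≤ k
    · filter_upwards [key k hk] with ω hω _ using hω
    · exact Eventually.of_forall fun ω h => absurd h hk
  filter_upwards [hall] with ω hω hωB
  by_contra! hneg
  -- If the limiting gain were negative, large multiples of it would fall below a point where the
  -- utility is already less than `-C`.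
  obtain ⟨x, hx⟩ := h.field.unbdd ω (-C)
  obtain ⟨k, hk⟩ := exists_nat_ge (|x| / -(r ω + inner ℝ (η ω) (Y ω)))
  rw [div_le_iff₀ (by linarith)] at hk
  have h1 := hω (k + 1) (by omega) hωB
  have h2 : ((k + 1 : ℕ) : ℝ) * (r ω + inner ℝ (η ω) (Y ω)) ≤ x := by
    push_cast
    have := neg_abs_le x
    linarith
  exact absurd (h1.trans (h.field.mono ω h2)) (not_le.2 hx)

end IsMarketStep

end MarketStep

/-! ### Coercivity and attainment of limits -/

section MarketStep

variable {Ω : Type*} {m mΩ : MeasurableSpace Ω} {μ : Measure Ω} {d : ℕ}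
  {U : ℝ → ℝ} {a b C : ℝ} {v : ℝ → Ω → ℝ} {Y : Ω → EuclideanSpace ℝ (Fin d)}

theorem measurable_coord {α : Type*} [MeasurableSpace α] {ξ : α → EuclideanSpace ℝ (Fin d)}
    (hξ : Measurable ξ) (i : Fin d) : Measurable fun ω => ξ ω i :=
  (EuclideanSpace.proj (𝕜 := ℝ) i).continuous.measurable.comp hξ

theorem measurable_of_coord {α : Type*} [MeasurableSpace α] {ξ : Fin d → α → ℝ}
    (hξ : ∀ i, Measurable (ξ i)) :
    Measurable fun ω => (WithLp.toLp 2 fun i => ξ i ω : EuclideanSpace ℝ (Fin d)) :=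
  (PiLp.continuous_toLp 2 _).measurable.comp (measurable_pi_lambda _ hξ)

theorem tendsto_of_coord {ξ : ℕ → EuclideanSpace ℝ (Fin d)} {x : Fin d → ℝ}
    (h : ∀ i, Tendsto (fun n => ξ n i) atTop (𝓝 (x i))) :
    Tendsto ξ atTop (𝓝 (WithLp.toLp 2 x)) :=
  ((PiLp.continuous_toLp 2 _).tendsto x).comp (tendsto_pi_nhds.2 h)

theorem abs_coord_le_norm (x : EuclideanSpace ℝ (Fin d)) (i : Fin d) : |x i| ≤ ‖x‖ := by
  simpa using PiLp.norm_apply_le x i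

namespace IsMarketStep

variable [IsProbabilityMeasure μ]

/-- Capitals bounded above give `r ≤ 0`, so the limiting position has nonnegative gain on `B`. By
absence of arbitrage it is redundant there, and being reduced it is orthogonal to itself. Then `η =
0` and `r = 0` on `B`, although `|r| + ‖η‖ = 1`. -/
theorem null_of_normalized (h : IsMarketStep μ m U a b C v Y) {X : ℕ → Ω → ℝ}
    {ξ : ℕ → Ω → EuclideanSpace ℝ (Fin d)} (hX : ∀ n, Measurable[m] (X n))
    (hξ : ∀ n, IsReduced μ m Y (ξ n)) {K : Ω → ℝ} (hK : ∀ n ω, X n ω ≤ K ω)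
    {B : Set Ω} (hB : MeasurableSet[m] B)
    (hinf : ∀ ω ∈ B, Tendsto (fun n => |X n ω| + ‖ξ n ω‖) atTop atTop)
    (hM : ∀ᵐ ω ∂μ, ω ∈ B → ∃ M : ℝ≥0∞, M ≠ ∞ ∧ ∀ n,
      condNeg μ m (gain v Y (X n) (ξ n)) ω ≤ condPos μ m (gain v Y (X n) (ξ n)) ω + M)
    {r : Ω → ℝ} {η : Ω → EuclideanSpace ℝ (Fin d)} (hηm : Measurable[m] η)
    (hr : ∀ ω, Tendsto (fun n => X n ω / (|X n ω| + ‖ξ n ω‖)) atTop (𝓝 (r ω)))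
    (hη : ∀ ω, Tendsto (fun n => (|X n ω| + ‖ξ n ω‖)⁻¹ • ξ n ω) atTop (𝓝 (η ω))) :
    ∀ᵐ ω ∂μ, ω ∉ B := by
  classical
  have hnn := h.nonneg_of_normalized hX (fun n => (hξ n).1) hB hinf hM hr hη
  have hr0 : ∀ ω ∈ B, r ω ≤ 0 := fun ω hω => by
    refine le_of_tendsto_of_tendsto' (hr ω) ((hinf ω hω).const_div_atTop (K ω)) fun n => ?_
    exact div_le_div_of_nonneg_right (hK n ω) (by positivity)
  have hηred : IsReduced μ m Y η := IsReduced.lim (fun n => (hξ n).smul (c := fun ω =>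
    (|X n ω| + ‖ξ n ω‖)⁻¹) ((continuous_abs.measurable.comp (hX n)).add
      (measurable_norm.comp (hξ n).1)).inv) hηm hη
  have hind : Measurable[m] (B.indicator η) := hηm.indicator hB
  have hgain : ∀ ω, (inner ℝ (B.indicator η ω) (Y ω) : ℝ)
      = B.indicator (fun ω => inner ℝ (η ω) (Y ω)) ω := fun ω => by
    by_cases hω : ω ∈ B <;> simp [hω]
  have hzero := h.na (B.indicator η) hind (by
    filter_upwards [hnn] with ω hω
    rw [hgain]
    by_cases hωB : ω ∈ B
    · have := hω hωB
      have := hr0 ω hωB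
      rw [Set.indicator_of_mem hωB]
      linarith
    · simp [hωB])
  have horth := hηred.2 _ ⟨hind, hzero⟩
  filter_upwards [hnn, hzero, horth] with ω h1 h2 h3 hωB
  rw [hgain, Set.indicator_of_mem hωB] at h2
  rw [Set.indicator_of_mem hωB, real_inner_self_eq_norm_sq] at h3
  have h4 : r ω = 0 := le_antisymm (hr0 ω hωB) (by have := h1 hωB; linarith)
  have h5 : ‖η ω‖ = 0 := by simpa using h3
  have h6 := (hr ω).abs.add (hη ω).norm
  rw [h4, h5, abs_zero, add_zero] at h6
  have h7 : Tendsto (fun _ : ℕ => (1 : ℝ)) atTop (𝓝 0) := by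
    refine h6.congr' ?_
    filter_upwards [(hinf ω hωB).eventually_gt_atTop 0] with n hn
    rw [abs_div, norm_smul, norm_inv, Real.norm_of_nonneg hn.le, abs_of_pos hn, div_eq_inv_mul,
      ← mul_add, inv_mul_cancel₀ hn.ne']
  exact one_ne_zero (tendsto_nhds_unique tendsto_const_nhds h7)

/-- Coercivity: reduced positions with conditional utility bounded below do not explode. -/
theorem null_of_explosion (h : IsMarketStep μ m U a b C v Y) {X : ℕ → Ω → ℝ}
    {ξ : ℕ → Ω → EuclideanSpace ℝ (Fin d)} (hX : ∀ n, Measurable[m] (X n))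
    (hξ : ∀ n, IsReduced μ m Y (ξ n)) {K : Ω → ℝ} (hK : ∀ n ω, X n ω ≤ K ω)
    {B : Set Ω} (hB : MeasurableSet[m] B)
    (hinf : ∀ ω ∈ B, Tendsto (fun n => |X n ω| + ‖ξ n ω‖) atTop atTop)
    (hM : ∀ᵐ ω ∂μ, ω ∈ B → ∃ M : ℝ≥0∞, M ≠ ∞ ∧ ∀ n,
      condNeg μ m (gain v Y (X n) (ξ n)) ω ≤ condPos μ m (gain v Y (X n) (ξ n)) ω + M) :
    ∀ᵐ ω ∂μ, ω ∉ B := by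
  -- The index `none` carries the normalized capital and `some i` the normalized coordinates, so
  -- that one random subsequence serves them all.
  let y : Option (Fin d) → ℕ → Ω → ℝ := fun o n ω =>
    o.elim (X n ω / (|X n ω| + ‖ξ n ω‖)) fun i => (|X n ω| + ‖ξ n ω‖)⁻¹ * ξ n ω i
  have hlm : ∀ n, Measurable[m] fun ω => |X n ω| + ‖ξ n ω‖ := fun n =>
    (continuous_abs.measurable.comp (hX n)).add (measurable_norm.comp (hξ n).1)
  have hym : ∀ o n, Measurable[m] (y o n) := by
    rintro (_ | i) n
    · exact (hX n).div (hlm n)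
    · exact (hlm n).inv.mul (@measurable_coord d Ω m _ (hξ n).1 i)
  have hyb : ∀ o ω, ∃ K, ∀ n, |y o n ω| ≤ K := by
    rintro (_ | i) ω
    · refine ⟨1, fun n => ?_⟩
      simp only [y, Option.elim]
      rw [abs_div, abs_of_nonneg (show 0 ≤ |X n ω| + ‖ξ n ω‖ by positivity)]
      exact div_le_one_of_le₀ (le_add_of_nonneg_right (norm_nonneg _)) (by positivity)
    · refine ⟨1, fun n => ?_⟩
      simp only [y, Option.elim]
      rw [abs_mul, abs_inv, abs_of_nonneg (show 0 ≤ |X n ω| + ‖ξ n ω‖ by positivity),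
        inv_mul_eq_div]
      exact div_le_one_of_le₀ ((abs_coord_le_norm _ _).trans
        (le_add_of_nonneg_left (abs_nonneg _))) (by positivity)
  obtain ⟨σ, hσm, hσ, L, hLm, hL⟩ := @exists_random_subsequence Ω m _ _ y hym hyb
  have hσinf : ∀ ω, Tendsto (fun k => σ k ω) atTop atTop := fun ω =>
    tendsto_atTop_mono (fun k => hσ k ω) tendsto_id
  refine h.null_of_normalized (X := fun k ω => X (σ k ω) ω) (ξ := fun k ω => ξ (σ k ω) ω)
    (r := L none) (η := fun ω => WithLp.toLp 2 fun i => L (some i) ω)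
    (fun k => @measurable_paste Ω ℕ ℝ m _ _ _ _ _ (hσm k) X hX)
    (fun k => IsReduced.paste hξ (hσm k)) (fun k ω => hK _ ω) hB
    (fun ω hω => (hinf ω hω).comp (hσinf ω)) ?_
    (@measurable_of_coord d Ω m _ fun i => hLm (some i)) (hL none) (fun ω => ?_)
  · have e1 := fun k => condPos_paste (μ := μ) h.le (hσm k) fun n => gain v Y (X n) (ξ n)
    have e2 := fun k => condNeg_paste (μ := μ) h.le (hσm k) fun n => gain v Y (X n) (ξ n)
    filter_upwards [hM, ae_all_iff.2 e1, ae_all_iff.2 e2] with ω hM e1 e2 hωB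
    obtain ⟨M, hMtop, hM⟩ := hM hωB
    exact ⟨M, hMtop, fun k => (e2 k).le.trans ((hM _).trans_eq (by rw [← e1 k]; rfl))⟩
  · exact tendsto_of_coord fun i => hL (some i) ω

/-- Limits of attainable conditional utilities are attained. -/
theorem exists_condGe (h : IsMarketStep μ m U a b C v Y) {X : Ω → ℝ} (hX : Measurable[m] X)
    {ξ : ℕ → Ω → EuclideanSpace ℝ (Fin d)} (hξ : ∀ n, Measurable[m] (ξ n))
    {A : ℕ → Ω → ℝ} {L : Ω → ℝ} (hA : ∀ᵐ ω ∂μ, Tendsto (fun n => A n ω) atTop (𝓝 (L ω)))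
    (hge : ∀ n, CondGe μ m (gain v Y X (ξ n)) (A n)) :
    ∃ ζ, Measurable[m] ζ ∧ CondGe μ m (gain v Y X ζ) L := by
  classical
  choose ζ hζ hζξ using fun n => exists_isReduced (μ := μ) (Y := Y) h.le (hξ n)
  have hgeζ : ∀ n, CondGe μ m (gain v Y X (ζ n)) (A n) := fun n =>
    (hge n).congr (gain_congr (hζξ n)).symm
  have hnorm : ∀ n, Measurable[m] fun ω => ‖ζ n ω‖ := fun n => measurable_norm.comp (hζ n).1
  -- The set where the reduced positions are unbounded. Selecting an index of norm above `k` for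
  -- each `k` gives an exploding sequence on it, so coercivity makes it null.
  let B : Set Ω := {ω | ∀ k : ℕ, ∃ n, (k : ℝ) < ‖ζ n ω‖}
  have hB : MeasurableSet[m] B := by
    have : B = ⋂ k : ℕ, ⋃ n, {ω | (k : ℝ) < ‖ζ n ω‖} := by ext; simp [B]
    rw [this]
    exact MeasurableSet.iInter fun k => MeasurableSet.iUnion fun n =>
      hnorm n (measurableSet_Ioi (a := (k : ℝ)))
  have hBnull : ∀ᵐ ω ∂μ, ω ∉ B := by
    have hex : ∀ (k : ℕ) ω, ∃ n, ω ∈ B → (k : ℝ) < ‖ζ n ω‖ := fun k ω => by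
      by_cases hω : ω ∈ B
      · exact (hω k).imp fun n hn _ => hn
      · exact ⟨0, fun h => absurd h hω⟩
    let σ : ℕ → Ω → ℕ := fun k ω => Nat.find (hex k ω)
    have hσm : ∀ k, Measurable[m] (σ k) := fun k => by
      refine @measurable_find Ω m _ _ (hex k) fun n => ?_
      have : {ω | ω ∈ B → (k : ℝ) < ‖ζ n ω‖} = Bᶜ ∪ {ω | (k : ℝ) < ‖ζ n ω‖} := by
        ext; simp [imp_iff_not_or]
      rw [this]
      exact hB.compl.union (hnorm n (measurableSet_Ioi (a := (k : ℝ))))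
    have hσ : ∀ k : ℕ, ∀ ω ∈ B, (k : ℝ) < ‖ζ (σ k ω) ω‖ := fun k ω hω => Nat.find_spec (hex k ω) hω
    refine h.null_of_explosion (X := fun _ => X) (ξ := fun k ω => ζ (σ k ω) ω) (fun _ => hX)
      (fun k => IsReduced.paste hζ (hσm k)) (K := X) (fun _ _ => le_rfl) hB (fun ω hω => ?_) ?_
    · refine tendsto_atTop_mono (fun k => ?_) tendsto_natCast_atTop_atTop
      exact (hσ k ω hω).le.trans (le_add_of_nonneg_left (abs_nonneg _))
    · have e1 := fun k => condPos_paste (μ := μ) h.le (hσm k) fun n => gain v Y X (ζ n)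
      have e2 := fun k => condNeg_paste (μ := μ) h.le (hσm k) fun n => gain v Y X (ζ n)
      filter_upwards [hA, ae_all_iff.2 hgeζ, ae_all_iff.2 e1, ae_all_iff.2 e2]
        with ω hA hge e1 e2 _
      obtain ⟨M, hM⟩ := hA.neg.bddAbove_range
      refine ⟨ENNReal.ofReal M, ENNReal.ofReal_ne_top, fun k => (e2 k).le.trans ?_⟩
      refine (le_self_add.trans (hge (σ k ω))).trans ?_
      refine (add_le_add_right (ENNReal.ofReal_le_ofReal (hM ⟨σ k ω, rfl⟩)) _).trans_eq ?_
      rw [← e1 k]; rfl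
  -- Setting the positions to zero on this null set makes them bounded at every `ω`, as subsequence
  -- selection demands.
  let ρ : ℕ → Ω → EuclideanSpace ℝ (Fin d) := fun n => Bᶜ.indicator (ζ n)
  have hρm : ∀ n, Measurable[m] (ρ n) := fun n => (hζ n).1.indicator hB.compl
  have hgeρ : ∀ n, CondGe μ m (gain v Y X (ρ n)) (A n) := fun n => by
    refine (hgeζ n).congr ?_
    filter_upwards [hBnull] with ω hω
    simp [gain, ρ, hω]
  have hbdd : ∀ ω, ∃ k : ℕ, ∀ n, ‖ρ n ω‖ ≤ k := fun ω => by
    by_cases hω : ω ∈ B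
    · exact ⟨0, fun n => by simp [ρ, hω]⟩
    · have hω' := hω
      simp only [B, Set.mem_ofPred_eq, not_forall, not_exists, not_lt] at hω'
      obtain ⟨k, hk⟩ := hω'
      exact ⟨k, fun n => by simpa [ρ, hω] using hk n⟩
  let R : Ω → ℕ := fun ω => Nat.find (hbdd ω)
  have hR : ∀ n ω, ‖ρ n ω‖ ≤ R ω := fun n ω => Nat.find_spec (hbdd ω) n
  have hRm : Measurable[m] R := by
    refine @measurable_find Ω m _ _ hbdd fun k => ?_
    have : {ω | ∀ n, ‖ρ n ω‖ ≤ k} = ⋂ n, {ω | ‖ρ n ω‖ ≤ k} := by ext; simp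
    rw [this]
    exact MeasurableSet.iInter fun n => (measurable_norm.comp (hρm n))
      (measurableSet_Iic (a := (k : ℝ)))
  have hRm' : Measurable[m] fun ω => (R ω : ℝ) := measurable_from_top.comp hRm
  obtain ⟨σ, hσm, hσ, l, hlm, hl⟩ := @exists_random_subsequence Ω m (Fin d) _
    (fun i n ω => ρ n ω i) (fun i n => @measurable_coord d Ω m _ (hρm n) i)
    (fun i ω => ⟨R ω, fun n => (abs_coord_le_norm _ _).trans (hR n ω)⟩)
  have hσinf : ∀ ω, Tendsto (fun k => σ k ω) atTop atTop := fun ω =>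
    tendsto_atTop_mono (fun k => hσ k ω) tendsto_id
  refine ⟨fun ω => WithLp.toLp 2 fun i => l i ω, @measurable_of_coord d Ω m _ hlm, ?_⟩
  refine CondGe.lim h.le (X := fun k => gain v Y X fun ω => ρ (σ k ω) ω)
    (D := fun ω => v (X ω + R ω * ‖Y ω‖) ω) (A := fun k ω => A (σ k ω) ω) (fun k => ?_) ?_
    (fun k ω => ?_) ?_ (fun ω => ?_) ?_ fun k => ?_
  · exact h.measurable_gain hX (@measurable_paste Ω ℕ _ m _ _ _ _ _ (hσm k) ρ hρm)
  · exact h.field.measurable_comp ((hX.mono h.le le_rfl).add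
      ((hRm'.mono h.le le_rfl).mul (measurable_norm.comp h.measY)))
  · refine h.field.mono ω ?_
    have := (real_inner_le_norm (ρ (σ k ω) ω) (Y ω)).trans
      (mul_le_mul_of_nonneg_right (hR (σ k ω) ω) (norm_nonneg _))
    linarith
  · exact h.condPos_norm_lt_top hX hRm' fun ω => by positivity
  · refine ((h.field.continuous ω).tendsto _).comp (tendsto_const_nhds.add ?_)
    exact (tendsto_of_coord fun i => hl i ω).inner tendsto_const_nhds
  · filter_upwards [hA] with ω hA using hA.comp (hσinf ω)
  · exact CondGe.paste h.le (hσm k) (f := fun n => gain v Y X (ρ n)) hgeρ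

end IsMarketStep

end MarketStep

/-! ### Concave functions given on the rationals -/

section RationalExtension

/-- Concave nondecreasing functions on the rationals extend to left-continuous ones on the real
line, keeping lower bounds, unboundedness and growth conditions. -/
theorem exists_concave_extension {j : ℚ → ℝ} (hmono : Monotone j)
    (hconc : ∀ p r q : ℚ, p < r → r < q →
      ((q : ℝ) - r) * j p + ((r : ℝ) - p) * j q ≤ ((q : ℝ) - p) * j r) :
    ∃ w : ℝ → ℝ, (∀ x, (⨆ (q : ℚ) (_ : (q : ℝ) < x), (j q : EReal)) = w x) ∧
      ConcaveOn ℝ Set.univ w ∧ Monotone w ∧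
      (∀ (q : ℚ) x, (q : ℝ) < x → j q ≤ w x) ∧ (∀ (q : ℚ) x, x ≤ (q : ℝ) → w x ≤ j q) ∧
      ∀ x M, (∀ q : ℚ, (q : ℝ) < x → j q ≤ M) → w x ≤ M := by
  have hlub : ∀ x : ℝ, ∃ y, IsLUB {z | ∃ q : ℚ, (q : ℝ) < x ∧ j q = z} y := fun x => by
    obtain ⟨q, hq⟩ := exists_rat_lt x
    obtain ⟨q', hq'⟩ := exists_rat_gt x
    refine ⟨_, isLUB_csSup ⟨_, q, hq, rfl⟩ ⟨j q', ?_⟩⟩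
    rintro _ ⟨p, hp, rfl⟩
    exact hmono (by exact_mod_cast (hp.trans hq').le)
  choose w hw using hlub
  have h1 : ∀ (q : ℚ) x, (q : ℝ) < x → j q ≤ w x := fun q x h => (hw x).1 ⟨q, h, rfl⟩
  have h3 : ∀ x M, (∀ q : ℚ, (q : ℝ) < x → j q ≤ M) → w x ≤ M := fun x M h => by
    refine (hw x).2 ?_
    rintro _ ⟨q, hq, rfl⟩
    exact h q hq
  have h2 : ∀ (q : ℚ) x, x ≤ (q : ℝ) → w x ≤ j q := fun q x h =>
    h3 x _ fun p hp => hmono (by exact_mod_cast (hp.trans_le h).le)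
  have hwm : Monotone w := fun x y hxy => h3 x _ fun q hq => h1 q y (hq.trans_le hxy)
  have happrox : ∀ x ε, 0 < ε → ∃ q : ℚ, (q : ℝ) < x ∧ w x - ε < j q := fun x ε hε => by
    by_contra! h
    have := h3 x _ h
    linarith
  refine ⟨w, fun x => ?_, ⟨convex_univ, fun x _ y _ s t hs ht hst => ?_⟩, hwm, h1, h2, h3⟩
  · refine le_antisymm (iSup₂_le fun q hq => EReal.coe_le_coe_iff.2 (h1 q x hq)) ?_
    refine EReal.ge_of_forall_gt_iff_ge.1 fun z hz => ?_
    obtain ⟨q, hq, hzq⟩ := happrox x (w x - z) (sub_pos.2 (EReal.coe_lt_coe_iff.1 hz))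
    refine le_trans ?_ (le_iSup₂ (f := fun (q : ℚ) (_ : (q : ℝ) < x) => (j q : EReal)) q hq)
    exact EReal.coe_le_coe_iff.2 (by linarith)
  · simp only [smul_eq_mul]
    -- With real weights the convex combination may be irrational, so concavity is stated with a
    -- rational `r` above it; monotonicity pays for the gap.
    have hpt : ∀ p q r : ℚ, s * p + t * q < r → s * j p + t * j q ≤ j r := by
      intro p q r hr
      rcases le_or_gt (max p q) r with hmax | hmax
      · have hp := hmono ((le_max_left p q).trans hmax)
        have hq := hmono ((le_max_right p q).trans hmax)
        have h4 := mul_le_mul_of_nonneg_left hp hs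
        have h5 := mul_le_mul_of_nonneg_left hq ht
        have h6 : s * j r + t * j r = j r := by rw [← add_mul, hst, one_mul]
        linarith
      · rcases lt_trichotomy p q with hpq | hpq | hpq
        · rw [max_eq_right hpq.le] at hmax
          have hpq' : (p : ℝ) < q := by exact_mod_cast hpq
          have hpr : p < r := by
            have : (p : ℝ) < r := by
              have h4 := mul_le_mul_of_nonneg_left hpq'.le ht
              have h6 : s * (p : ℝ) + t * p = p := by rw [← add_mul, hst, one_mul]
              linarith
            exact_mod_cast this
          have hc := hconc p r q hpr hmax
          have hj := hmono hpq.le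
          have hδ : 0 ≤ ((r : ℝ) - (s * p + t * q)) * (j q - j p) :=
            mul_nonneg (by linarith) (by linarith)
          have hs' : s = 1 - t := by linarith
          subst hs'
          have : 0 ≤ ((q : ℝ) - p) * (j r - ((1 - t) * j p + t * j q)) := by nlinarith
          have := nonneg_of_mul_nonneg_right this (by linarith)
          linarith
        · subst hpq
          rw [max_self] at hmax
          have : (r : ℝ) < p := by exact_mod_cast hmax
          have : s * (p : ℝ) + t * p = p := by rw [← add_mul, hst, one_mul]
          linarith
        · rw [max_eq_left hpq.le] at hmax
          have hpq' : (q : ℝ) < p := by exact_mod_cast hpq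
          have hpr : q < r := by
            have : (q : ℝ) < r := by
              have h4 := mul_le_mul_of_nonneg_left hpq'.le hs
              have h6 : s * (q : ℝ) + t * q = q := by rw [← add_mul, hst, one_mul]
              linarith
            exact_mod_cast this
          have hc := hconc q r p hpr hmax
          have hj := hmono hpq.le
          have hδ : 0 ≤ ((r : ℝ) - (s * p + t * q)) * (j p - j q) :=
            mul_nonneg (by linarith) (by linarith)
          have ht' : t = 1 - s := by linarith
          subst ht'
          have : 0 ≤ ((p : ℝ) - q) * (j r - (s * j p + (1 - s) * j q)) := by nlinarith
          have := nonneg_of_mul_nonneg_right this (by linarith)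
          linarith
    refine le_of_forall_pos_lt_add fun ε hε => ?_
    obtain ⟨p, hp, hjp⟩ := happrox x ε hε
    obtain ⟨q, hq, hjq⟩ := happrox y ε hε
    have hlt : s * (p : ℝ) + t * q < s * x + t * y := by
      rcases hs.eq_or_lt with rfl | hs
      · have : t = 1 := by linarith
        subst this; linarith
      · nlinarith
    obtain ⟨r, hr1, hr2⟩ := exists_rat_btwn hlt
    have h4 := hpt p q r hr1
    have h5 := h1 r _ hr2
    have h6 : s * (w x - ε) + t * (w y - ε) < s * j p + t * j q := by
      rcases hs.eq_or_lt with rfl | hs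
      · have : t = 1 := by linarith
        subst this; linarith
      · nlinarith
    have h7 : s * ε + t * ε = ε := by rw [← add_mul, hst, one_mul]
    linarith

end RationalExtension

/-! ### Essential suprema as countable suprema -/

section EssSup

variable {Ω : Type*} {m mΩ : MeasurableSpace Ω} {μ : Measure Ω} [IsFiniteMeasure μ]

/-- An essential supremum is the supremum of a countable subfamily. -/
theorem IsEssSup.exists_seq (hm : m ≤ mΩ) {ι : Type*} {I : Set ι} (hI : I.Nonempty)
    {f : ι → Ω → EReal} {g : Ω → EReal} (hg : IsEssSup μ m I f g)
    (hf : ∀ i ∈ I, Measurable[m] (f i)) :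
    ∃ u : ℕ → ι, (∀ n, u n ∈ I) ∧ ∀ᵐ ω ∂μ, g ω = ⨆ n, f (u n) ω := by
  -- A bounded strictly decreasing function: a countable supremum minimizing the integral of `ψ`
  -- cannot be increased on a set of positive measure.
  let ψ : EReal → ℝ≥0∞ := fun x => (1 + EReal.exp x)⁻¹
  have hψm : Measurable ψ := (measurable_const.add EReal.measurable_exp).inv
  have hψlt : ∀ x y, x < y → ψ y < ψ x := fun x y h =>
    ENNReal.inv_lt_inv.2 (ENNReal.add_lt_add_left ENNReal.one_ne_top (EReal.exp_lt_exp_iff.2 h))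
  have hψle : ∀ x y, x ≤ y → ψ y ≤ ψ x := fun x y h =>
    h.eq_or_lt.elim (fun e => e ▸ le_rfl) (fun h => (hψlt x y h).le)
  have hψ1 : ∀ x, ψ x ≤ 1 := fun x => ENNReal.inv_le_one.2 le_self_add
  let G : (ℕ → ι) → Ω → EReal := fun u ω => ⨆ n, f (u n) ω
  let A : Set (ℕ → ι) := {u | ∀ n, u n ∈ I}
  have hGm : ∀ u ∈ A, Measurable (G u) := fun u hu =>
    Measurable.iSup fun n => (hf _ (hu n)).mono hm le_rfl
  let Φ : (ℕ → ι) → ℝ≥0∞ := fun u => ∫⁻ ω, ψ (G u ω) ∂μ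
  obtain ⟨i₀, hi₀⟩ := hI
  have hne : (Φ '' A).Nonempty := ⟨_, fun _ => i₀, fun _ => hi₀, rfl⟩
  obtain ⟨s, -, hs, hsA⟩ := exists_seq_tendsto_sInf hne (OrderBot.bddBelow _)
  choose u huA hu using hsA
  -- The sequences of a minimizing sequence are merged into one, whose supremum dominates theirs and
  -- attains the infimum.
  let w : ℕ → ι := fun n => u n.unpair.1 n.unpair.2
  have hwA : w ∈ A := fun n => huA _ _
  have hwu : ∀ k ω, G (u k) ω ≤ G w ω := fun k ω => iSup_le fun n => by
    have := le_iSup (fun n => f (w n) ω) (Nat.pair k n)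
    simpa [w] using this
  have hmin : ∀ t ∈ A, Φ w ≤ Φ t := fun t ht => by
    refine le_trans (ge_of_tendsto' hs fun n => ?_) (sInf_le ⟨t, ht, rfl⟩)
    rw [← hu n]
    exact lintegral_mono fun ω => hψle _ _ (hwu n ω)
  have hdom : ∀ i ∈ I, f i ≤ᵐ[μ] G w := fun i hi => by
    let t : ℕ → ι := fun n => Nat.casesOn n i w
    have ht : t ∈ A := fun n => by
      cases n with
      | zero => exact hi
      | succ n => exact hwA n
    have hle : ∀ ω, ψ (G t ω) ≤ ψ (G w ω) := fun ω =>
      hψle _ _ (iSup_le fun n => le_iSup (fun n => f (t n) ω) (n + 1))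
    have hfinite : ∫⁻ ω, ψ (G t ω) ∂μ ≠ ∞ :=
      ((lintegral_mono fun ω => hψ1 _).trans_lt (by simp)).ne
    have hae := ae_eq_of_ae_le_of_lintegral_le (Eventually.of_forall hle) hfinite
      (hψm.comp (hGm _ hwA)).aemeasurable (hmin _ ht)
    filter_upwards [hae] with ω hω
    have h1 : f i ω ≤ G t ω := le_iSup (fun n => f (t n) ω) 0
    refine h1.trans (le_of_not_gt fun hlt => ?_)
    exact absurd hω (hψlt _ _ hlt).ne
  refine ⟨w, hwA, ?_⟩
  filter_upwards [hg.2.2 _ (hGm _ hwA) hdom, ae_all_iff.2 fun n => hg.2.1 _ (hwA n)] with ω h1 h2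
  exact le_antisymm h1 (iSup_le h2)

end EssSup

/-! ### Order and algebra of conditional inequalities -/

section Calculus

/-- Links extended-real conditional expectations to the subtraction-free `CondGe`; the negative part
`n` may be infinite. -/
theorem coe_le_sub_iff {p n : ℝ≥0∞} (hp : p ≠ ∞) (A : ℝ) :
    (A : EReal) ≤ (p : EReal) - (n : EReal) ↔
      n + ENNReal.ofReal A ≤ p + ENNReal.ofReal (-A) := by
  lift p to NNReal using hp
  rcases eq_or_ne n ∞ with rfl | hn
  · simp [EReal.sub_top]
  lift n to NNReal using hn
  have h1 : A = max A 0 - max (-A) 0 := (max_zero_sub_max_neg_zero_eq_self A).symm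
  have e1 : ((p : ℝ≥0∞) : EReal) - ((n : ℝ≥0∞) : EReal) = (((p : ℝ) - n : ℝ) : EReal) := by
    norm_cast
  rw [e1, EReal.coe_le_coe_iff, ENNReal.ofReal, ENNReal.ofReal, ← ENNReal.coe_add,
    ← ENNReal.coe_add, ENNReal.coe_le_coe, ← NNReal.coe_le_coe]
  push_cast
  simp only [Real.coe_toNNReal']
  constructor <;> intro h <;> linarith

theorem sub_le_coe_iff {p n : ℝ≥0∞} (hp : p ≠ ∞) (A : ℝ) :
    (p : EReal) - (n : EReal) ≤ (A : EReal) ↔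
      p + ENNReal.ofReal (-A) ≤ n + ENNReal.ofReal A := by
  lift p to NNReal using hp
  rcases eq_or_ne n ∞ with rfl | hn
  · simp [EReal.sub_top]
  lift n to NNReal using hn
  have h1 : A = max A 0 - max (-A) 0 := (max_zero_sub_max_neg_zero_eq_self A).symm
  have e1 : ((p : ℝ≥0∞) : EReal) - ((n : ℝ≥0∞) : EReal) = (((p : ℝ) - n : ℝ) : EReal) := by
    norm_cast
  rw [e1, EReal.coe_le_coe_iff, ENNReal.ofReal, ENNReal.ofReal, ← ENNReal.coe_add,
    ← ENNReal.coe_add, ENNReal.coe_le_coe, ← NNReal.coe_le_coe]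
  push_cast
  simp only [Real.coe_toNNReal']
  constructor <;> intro h <;> linarith

theorem ofReal_add_identity (x y : ℝ) :
    ENNReal.ofReal (-(x + y)) + (ENNReal.ofReal x + ENNReal.ofReal y)
      = ENNReal.ofReal (x + y) + (ENNReal.ofReal (-x) + ENNReal.ofReal (-y)) := by
  simp only [ENNReal.ofReal, ← ENNReal.coe_add, ENNReal.coe_inj]
  rw [← NNReal.coe_inj]
  push_cast
  simp only [Real.coe_toNNReal']
  have h1 := max_zero_sub_max_neg_zero_eq_self x
  have h2 := max_zero_sub_max_neg_zero_eq_self y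
  have h3 := max_zero_sub_max_neg_zero_eq_self (x + y)
  linarith

theorem le_of_ofReal_add_le {x y : ℝ}
    (h : ENNReal.ofReal x + ENNReal.ofReal (-y) ≤ ENNReal.ofReal (-x) + ENNReal.ofReal y) :
    x ≤ y := by
  simp only [ENNReal.ofReal, ← ENNReal.coe_add, ENNReal.coe_le_coe] at h
  rw [← NNReal.coe_le_coe] at h
  push_cast at h
  simp only [Real.coe_toNNReal'] at h
  have h1 := max_zero_sub_max_neg_zero_eq_self x
  have h2 := max_zero_sub_max_neg_zero_eq_self y
  linarith

variable {Ω : Type*} {m mΩ : MeasurableSpace Ω} {μ : Measure Ω} {X X' A A' : Ω → ℝ}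

theorem CondGe.mono (h : CondGe μ m X A) (hX : X ≤ᵐ[μ] X') : CondGe μ m X' A := by
  filter_upwards [h, condPos_mono (m := m) hX, condNeg_anti (m := m) hX] with ω h h1 h2
  exact (add_le_add_left h2 _).trans (h.trans (add_le_add_left h1 _))

/-- Chaining `A ≤ E(X) ≤ E(X') ≤ A'`. The lower bound together with the finite positive part of `X'`
makes its negative part finite, so both may be cancelled. -/
theorem CondGe.le_of_condLe (h : CondGe μ m X A) (h' : CondLe μ m X' A') (hX : X ≤ᵐ[μ] X')
    (hfin : ∀ᵐ ω ∂μ, condPos μ m X' ω < ∞) : A ≤ᵐ[μ] A' := by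
  filter_upwards [h.mono hX, h', hfin] with ω h1 h2 hfin
  set p := condPos μ m X' ω
  set n := condNeg μ m X' ω
  have hn : n ≠ ∞ := ne_top_of_le_ne_top (b := p + ENNReal.ofReal (-A ω)) (by simp [hfin.ne])
    (le_self_add.trans h1)
  refine le_of_ofReal_add_le ((ENNReal.add_le_add_iff_left
    (ENNReal.add_ne_top.2 ⟨hfin.ne, hn⟩)).1 ?_)
  calc p + n + (ENNReal.ofReal (A ω) + ENNReal.ofReal (-A' ω))
      = (n + ENNReal.ofReal (A ω)) + (p + ENNReal.ofReal (-A' ω)) := by ring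
    _ ≤ (p + ENNReal.ofReal (-A ω)) + (n + ENNReal.ofReal (A' ω)) := add_le_add h1 h2
    _ = _ := by ring

theorem CondGe.add (h : CondGe μ m X A) (h' : CondGe μ m X' A') (hXm : Measurable[mΩ] X)
    (hXm' : Measurable[mΩ] X') (hfin : ∀ᵐ ω ∂μ, condPos μ m X ω < ∞)
    (hfin' : ∀ᵐ ω ∂μ, condPos μ m X' ω < ∞) :
    CondGe μ m (fun ω => X ω + X' ω) fun ω => A ω + A' ω := by
  have e1 := condLExp_add_left' (m := m) (μ := μ)
    (X := fun ω => ENNReal.ofReal (-(X ω + X' ω)))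
    (Y := fun ω => ENNReal.ofReal (X ω) + ENNReal.ofReal (X' ω)) (hXm.add hXm').neg.ennreal_ofReal
  have e2 := condLExp_add_left' (m := m) (μ := μ)
    (X := fun ω => ENNReal.ofReal (X ω + X' ω))
    (Y := fun ω => ENNReal.ofReal (-X ω) + ENNReal.ofReal (-X' ω)) (hXm.add hXm').ennreal_ofReal
  have e3 := condLExp_add_left' (m := m) (μ := μ) (X := fun ω => ENNReal.ofReal (X ω))
    (Y := fun ω => ENNReal.ofReal (X' ω)) hXm.ennreal_ofReal
  have e4 := condLExp_add_left' (m := m) (μ := μ) (X := fun ω => ENNReal.ofReal (-X ω))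
    (Y := fun ω => ENNReal.ofReal (-X' ω)) hXm.neg.ennreal_ofReal
  simp only [ofReal_add_identity] at e1
  filter_upwards [h, h', hfin, hfin', e1, e2, e3, e4] with ω h h' hfin hfin' e1 e2 e3 e4
  have e : condNeg μ m (fun ω => X ω + X' ω) ω + (condPos μ m X ω + condPos μ m X' ω)
      = condPos μ m (fun ω => X ω + X' ω) ω + (condNeg μ m X ω + condNeg μ m X' ω) := by
    simp only [condPos, condNeg]
    rw [← e3, ← e4, ← e1, ← e2]
  have hI := ofReal_add_identity (A ω) (A' ω)
  set N := condNeg μ m (fun ω => X ω + X' ω) ω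
  set P := condPos μ m (fun ω => X ω + X' ω) ω
  set p := condPos μ m X ω
  set p' := condPos μ m X' ω
  set n := condNeg μ m X ω
  set n' := condNeg μ m X' ω
  refine (ENNReal.add_le_add_iff_left (a := p + p' + (ENNReal.ofReal (-A ω) +
    ENNReal.ofReal (-A' ω))) (by simp [hfin.ne, hfin'.ne])).1 ?_
  calc p + p' + (ENNReal.ofReal (-A ω) + ENNReal.ofReal (-A' ω)) +
        (N + ENNReal.ofReal (A ω + A' ω))
      = (N + (p + p')) + (ENNReal.ofReal (A ω + A' ω) +
          (ENNReal.ofReal (-A ω) + ENNReal.ofReal (-A' ω))) := by ring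
    _ = P + ENNReal.ofReal (-(A ω + A' ω)) + (n + ENNReal.ofReal (A ω)) +
          (n' + ENNReal.ofReal (A' ω)) := by rw [e, ← hI]; ring
    _ ≤ P + ENNReal.ofReal (-(A ω + A' ω)) + (p + ENNReal.ofReal (-A ω)) +
          (p' + ENNReal.ofReal (-A' ω)) := by gcongr
    _ = _ := by ring

variable [IsProbabilityMeasure μ]

theorem CondGe.const_mul (hm : m ≤ mΩ) (h : CondGe μ m X A) (hXm : Measurable[mΩ] X) {c : ℝ}
    (hc : 0 ≤ c) : CondGe μ m (fun ω => c * X ω) fun ω => c * A ω := by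
  have e1 := condLExp_mul_left (μ := μ) hm (f := fun _ => ENNReal.ofReal c) measurable_const
    hXm.ennreal_ofReal.aemeasurable
  have e2 := condLExp_mul_left (μ := μ) hm (f := fun _ => ENNReal.ofReal c)
    (g := fun ω => ENNReal.ofReal (-X ω)) measurable_const hXm.neg.ennreal_ofReal.aemeasurable
  filter_upwards [h, e1, e2] with ω h e1 e2
  simp only [condPos, condNeg, ← mul_neg, ENNReal.ofReal_mul hc] at *
  rw [e1, e2, ← mul_add, ← mul_add]
  exact mul_le_mul' le_rfl h

theorem condGe_of_le (hm : m ≤ mΩ) (hA : Measurable[m] A)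
    (h : ∀ ω, A ω ≤ X ω) : CondGe μ m X A := by
  have hp : condPos μ m A ≤ᵐ[μ] condPos μ m X := condPos_mono (Eventually.of_forall h)
  have hn : condNeg μ m X ≤ᵐ[μ] condNeg μ m A := condNeg_anti (Eventually.of_forall h)
  have e1 : condPos μ m A = fun ω => ENNReal.ofReal (A ω) :=
    condLExp_eq_self hm μ hA.ennreal_ofReal
  have e2 : condNeg μ m A = fun ω => ENNReal.ofReal (-A ω) :=
    condLExp_eq_self hm μ hA.neg.ennreal_ofReal
  filter_upwards [hp, hn] with ω hp hn
  rw [e1] at hp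
  rw [e2] at hn
  rw [add_comm (condPos μ m X ω)]
  exact add_le_add hn hp

theorem condPos_const_mul_lt_top (hm : m ≤ mΩ) (hXm : Measurable[mΩ] X) {c : ℝ} (hc : 0 ≤ c)
    (h : ∀ᵐ ω ∂μ, condPos μ m X ω < ∞) : ∀ᵐ ω ∂μ, condPos μ m (fun ω => c * X ω) ω < ∞ := by
  have e1 := condLExp_mul_left (μ := μ) hm (f := fun _ => ENNReal.ofReal c) measurable_const
    hXm.ennreal_ofReal.aemeasurable
  filter_upwards [h, e1] with ω h e1
  simp only [condPos, ENNReal.ofReal_mul hc]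
  rw [e1]
  exact ENNReal.mul_lt_top ENNReal.ofReal_lt_top h

end Calculus

/-! ### The one-step value at fixed capital -/

section OneStep

variable {Ω : Type*} {m mΩ : MeasurableSpace Ω} {μ : Measure Ω} {d : ℕ}
  {U : ℝ → ℝ} {a b C : ℝ} {v : ℝ → Ω → ℝ} {Y : Ω → EuclideanSpace ℝ (Fin d)}
  {V : ℝ → Ω → EReal}

theorem toENNReal_coe_real (r : ℝ) : (r : EReal).toENNReal = ENNReal.ofReal r := by
  simp [EReal.toENNReal]

theorem extCondExp_coe {X : Ω → ℝ} {Z : Ω → EReal} (h : ∀ᵐ ω ∂μ, Z ω = X ω) :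
    extCondExp μ m Z =ᵐ[μ] fun ω => (condPos μ m X ω : EReal) - (condNeg μ m X ω : EReal) := by
  have h1 : condLExp m μ (fun ω => (Z ω).toENNReal) =ᵐ[μ] condPos μ m X :=
    condLExp_congr_ae (by filter_upwards [h] with ω h; rw [h, toENNReal_coe_real])
  have h2 : condLExp m μ (fun ω => (-Z ω).toENNReal) =ᵐ[μ] condNeg μ m X :=
    condLExp_congr_ae (by
      filter_upwards [h] with ω h
      rw [h, ← EReal.coe_neg, toENNReal_coe_real])
  filter_upwards [h1, h2] with ω h1 h2
  rw [extCondExp, h1, h2]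

theorem extCondExp_stepGain (hV : ∀ᵐ ω ∂μ, ∀ x, V x ω = v x ω) (x : ℝ)
    (ξ : Ω → EuclideanSpace ℝ (Fin d)) :
    extCondExp μ m (stepGain V Y x ξ) =ᵐ[μ] fun ω =>
      (condPos μ m (gain v Y (fun _ => x) ξ) ω : EReal)
        - (condNeg μ m (gain v Y (fun _ => x) ξ) ω : EReal) :=
  extCondExp_coe (by filter_upwards [hV] with ω hV using hV _)

theorem measurableSet_lt_of_ereal {α : Type*} [MeasurableSpace α] {f g : α → EReal}
    (hf : Measurable f) (hg : Measurable g) : MeasurableSet {x | f x < g x} :=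
  measurableSet_lt hf hg

/-- Real version of the one-step essential supremum. -/
noncomputable def stepReal (μ : Measure Ω) (m : MeasurableSpace Ω) (V : ℝ → Ω → EReal)
    (Y : Ω → EuclideanSpace ℝ (Fin d)) (x : ℝ) (ω : Ω) : ℝ :=
  (stepEssSup μ m V Y x ω).toReal

namespace IsMarketStep

variable [IsProbabilityMeasure μ]

/-- The zero position yields at least `U x`, which excludes the value `⊥`. -/
theorem stepEssSup_eq (h : IsMarketStep μ m U a b C v Y) (hV : ∀ᵐ ω ∂μ, ∀ x, V x ω = v x ω)
    {x : ℝ} (hlt : ∀ᵐ ω ∂μ, stepEssSup μ m V Y x ω < ⊤) :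
    ∀ᵐ ω ∂μ, stepEssSup μ m V Y x ω = stepReal μ m V Y x ω ∧ U x ≤ stepReal μ m V Y x ω := by
  have h0 : Measurable[m] fun _ : Ω => (0 : EuclideanSpace ℝ (Fin d)) := measurable_const
  have hg : CondGe μ m (gain v Y (fun _ => x) fun _ => 0) fun _ => U x :=
    condGe_of_le h.le measurable_const fun ω => by simpa [gain] using h.field.lower x ω
  have hsup := (isEssSup_stepEssSup μ m h.le V Y x).2.1 _ h0
  filter_upwards [hlt, hg, h.fin x _ h0, hsup, extCondExp_stepGain (m := m) (Y := Y) hV x fun _ => 0]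
    with ω hlt hg hfin hsup he
  rw [he] at hsup
  have h1 : (U x : EReal) ≤ stepEssSup μ m V Y x ω :=
    ((coe_le_sub_iff hfin.ne _).2 hg).trans hsup
  have h2 : stepEssSup μ m V Y x ω = stepReal μ m V Y x ω :=
    (EReal.coe_toReal hlt.ne ((EReal.bot_lt_coe _).trans_le h1).ne').symm
  refine ⟨h2, ?_⟩
  rw [h2] at h1
  exact EReal.coe_le_coe_iff.1 h1

theorem measurable_stepReal (h : IsMarketStep μ m U a b C v Y) (x : ℝ) :
    Measurable[m] (stepReal μ m V Y x) :=
  measurable_ereal_toReal.comp (isEssSup_stepEssSup μ m h.le V Y x).1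

theorem condLe_stepReal (h : IsMarketStep μ m U a b C v Y) (hV : ∀ᵐ ω ∂μ, ∀ x, V x ω = v x ω)
    {x : ℝ} (hlt : ∀ᵐ ω ∂μ, stepEssSup μ m V Y x ω < ⊤) {ξ : Ω → EuclideanSpace ℝ (Fin d)}
    (hξ : Measurable[m] ξ) : CondLe μ m (gain v Y (fun _ => x) ξ) (stepReal μ m V Y x) := by
  filter_upwards [h.stepEssSup_eq hV hlt, (isEssSup_stepEssSup μ m h.le V Y x).2.1 _ hξ,
    h.fin x _ hξ, extCondExp_stepGain (m := m) (Y := Y) hV x ξ] with ω h1 h2 hfin he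
  rw [he, h1.1] at h2
  exact (sub_le_coe_iff hfin.ne _).1 h2

/-- The essential supremum is a countable one, so selecting the first position that comes within `1
/ (n + 1)` of it gives near-optimizers; `exists_condGe` turns them into an optimizer. -/
theorem exists_condGe_stepReal (h : IsMarketStep μ m U a b C v Y)
    (hV : ∀ᵐ ω ∂μ, ∀ x, V x ω = v x ω) {x : ℝ}
    (hlt : ∀ᵐ ω ∂μ, stepEssSup μ m V Y x ω < ⊤) :
    ∃ ξ, Measurable[m] ξ ∧ CondGe μ m (gain v Y (fun _ => x) ξ) (stepReal μ m V Y x) := by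
  classical
  obtain ⟨u, hu, hsup⟩ := (isEssSup_stepEssSup μ m h.le V Y x).exists_seq h.le
    ⟨fun _ => 0, (measurable_const : Measurable[m] fun _ : Ω => (0 : EuclideanSpace ℝ (Fin d)))⟩
    fun _ _ => measurable_extCondExp μ m _
  let e : ℕ → Ω → EReal := fun i => extCondExp μ m (stepGain V Y x (u i))
  have hem : ∀ i, Measurable[m] (e i) := fun i => measurable_extCondExp μ m _
  let j := stepReal μ m V Y x
  have hjm : Measurable[m] j := h.measurable_stepReal x
  let A : ℕ → Ω → ℝ := fun n ω => j ω - 1 / ((n : ℝ) + 1)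
  have hAm : ∀ n, Measurable[m] fun ω => (A n ω : EReal) := fun n =>
    measurable_coe_real_ereal.comp (hjm.sub measurable_const)
  let G : ℕ → Set Ω := fun n => {ω | ∃ i, (A n ω : EReal) < e i ω}
  have hlm : ∀ n i, MeasurableSet[m] {ω | (A n ω : EReal) < e i ω} := fun n i =>
    @measurableSet_lt_of_ereal Ω m _ _ (hAm n) (hem i)
  have hGm : ∀ n, MeasurableSet[m] (G n) := fun n => by
    have : G n = ⋃ i, {ω | (A n ω : EReal) < e i ω} := by ext; simp [G]
    rw [this]
    exact MeasurableSet.iUnion fun i => hlm n i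
  have hex : ∀ n ω, ∃ i, ω ∈ G n → (A n ω : EReal) < e i ω := fun n ω => by
    by_cases hω : ω ∈ G n
    · exact hω.imp fun i hi _ => hi
    · exact ⟨0, fun h => absurd h hω⟩
  let τ : ℕ → Ω → ℕ := fun n ω => Nat.find (hex n ω)
  have hτm : ∀ n, Measurable[m] (τ n) := fun n => by
    refine @measurable_find Ω m _ _ (hex n) fun i => ?_
    have : {ω | ω ∈ G n → (A n ω : EReal) < e i ω} = (G n)ᶜ ∪ {ω | (A n ω : EReal) < e i ω} := by
      ext; simp [imp_iff_not_or]
    rw [this]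
    exact (hGm n).compl.union (hlm n i)
  refine h.exists_condGe measurable_const (ξ := fun n ω => u (τ n ω) ω)
    (fun n => @measurable_paste Ω ℕ _ m _ _ _ _ _ (hτm n) u hu) (A := A)
    (Eventually.of_forall fun ω => ?_) fun n => ?_
  · simpa [A, j] using (tendsto_const_nhds (x := j ω)).sub
      (tendsto_one_div_add_atTop_nhds_zero_nat (𝕜 := ℝ))
  · filter_upwards [hsup, h.stepEssSup_eq hV hlt, ae_all_iff.2 fun i => h.fin x (u i) (hu i),
      ae_all_iff.2 fun i => extCondExp_stepGain (m := m) (Y := Y) hV x (u i),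
      condPos_paste (μ := μ) h.le (hτm n) fun i => gain v Y (fun _ => x) (u i),
      condNeg_paste (μ := μ) h.le (hτm n) fun i => gain v Y (fun _ => x) (u i)]
      with ω hsup hj hfin he e1 e2
    have hG : ω ∈ G n := by
      have h1 : (A n ω : EReal) < ⨆ i, e i ω := by
        rw [← hsup, hj.1]
        refine EReal.coe_lt_coe_iff.2 (sub_lt_self _ ?_)
        positivity
      exact lt_iSup_iff.1 h1
    have h1 : (A n ω : EReal) < e (τ n ω) ω := Nat.find_spec (hex n ω) hG
    have h2 := h1.le.trans_eq (he (τ n ω))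
    have h3 := (coe_le_sub_iff (hfin _).ne _).1 h2
    rw [← e1, ← e2] at h3
    exact h3

theorem stepReal_mono (h : IsMarketStep μ m U a b C v Y)
    (hV : ∀ᵐ ω ∂μ, ∀ x, V x ω = v x ω) (hlt : ∀ x, ∀ᵐ ω ∂μ, stepEssSup μ m V Y x ω < ⊤)
    {x y : ℝ} (hxy : x ≤ y) :
    stepReal μ m V Y x ≤ᵐ[μ] stepReal μ m V Y y := by
  obtain ⟨ξ, hξ, hge⟩ := h.exists_condGe_stepReal hV (hlt x)
  exact hge.le_of_condLe (h.condLe_stepReal hV (hlt y) hξ)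
    (Eventually.of_forall fun ω => h.field.mono ω (by simpa using hxy)) (h.fin y ξ hξ)

/-- The convex combination of the optimizers at `x` and `y` is a competitor at the mixed capital. -/
theorem stepReal_concave (h : IsMarketStep μ m U a b C v Y)
    (hV : ∀ᵐ ω ∂μ, ∀ x, V x ω = v x ω) (hlt : ∀ x, ∀ᵐ ω ∂μ, stepEssSup μ m V Y x ω < ⊤)
    {x y s t : ℝ} (hs : 0 ≤ s) (ht : 0 ≤ t) (hst : s + t = 1) :
    ∀ᵐ ω ∂μ, s * stepReal μ m V Y x ω + t * stepReal μ m V Y y ω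
      ≤ stepReal μ m V Y (s * x + t * y) ω := by
  obtain ⟨ξ, hξ, hgx⟩ := h.exists_condGe_stepReal hV (hlt x)
  obtain ⟨ζ, hζ, hgy⟩ := h.exists_condGe_stepReal hV (hlt y)
  have hmx := h.measurable_gain (X := fun _ => x) measurable_const hξ
  have hmy := h.measurable_gain (X := fun _ => y) measurable_const hζ
  have hge := (hgx.const_mul h.le hmx hs).add (hgy.const_mul h.le hmy ht)
    (measurable_const.mul hmx) (measurable_const.mul hmy)
    (condPos_const_mul_lt_top h.le hmx hs (h.fin x ξ hξ))
    (condPos_const_mul_lt_top h.le hmy ht (h.fin y ζ hζ))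
  have hm : Measurable[m] fun ω => s • ξ ω + t • ζ ω :=
    (hξ.const_smul s).add (hζ.const_smul t)
  refine hge.le_of_condLe (h.condLe_stepReal hV (hlt _) hm) (Eventually.of_forall fun ω => ?_)
    (h.fin _ _ hm)
  have := (h.field.concave ω).2 (Set.mem_univ (x + inner ℝ (ξ ω) (Y ω)))
    (Set.mem_univ (y + inner ℝ (ζ ω) (Y ω))) hs ht hst
  simp only [smul_eq_mul] at this
  refine this.trans_eq ?_
  simp only [gain, inner_add_left, real_inner_smul_left]
  congr 1
  ring

/-- If `ξ` is optimal from `n x`, then `ξ / n` is a competitor from `x`, and its total gain is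
exactly `1 / n` of the original. -/
theorem stepReal_scale (h : IsMarketStep μ m U a b C v Y)
    (hV : ∀ᵐ ω ∂μ, ∀ x, V x ω = v x ω) (hlt : ∀ x, ∀ᵐ ω ∂μ, stepEssSup μ m V Y x ω < ⊤)
    {e : ℝ}
    (he : ∀ ω x (n : ℕ), 1 ≤ n → v (n * x) ω ≤ (n : ℝ) ^ e * (v x ω + C)) {x : ℝ} {n : ℕ}
    (hn : 1 ≤ n) : ∀ᵐ ω ∂μ, stepReal μ m V Y (n * x) ω
      ≤ (n : ℝ) ^ e * (stepReal μ m V Y x ω + C) := by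
  have hn0 : (0 : ℝ) < n := by exact_mod_cast hn
  have hpow : 0 < (n : ℝ) ^ e := Real.rpow_pos_of_pos hn0 e
  obtain ⟨ξ, hξ, hg⟩ := h.exists_condGe_stepReal hV (hlt (n * x))
  have hmg := h.measurable_gain (X := fun _ => n * x) measurable_const hξ
  have hge := (hg.const_mul h.le hmg (inv_nonneg.2 hpow.le)).add
    (condGe_of_le (X := fun _ => -C) (A := fun _ => -C) h.le measurable_const fun _ => le_rfl)
    (measurable_const.mul hmg) measurable_const
    (condPos_const_mul_lt_top h.le hmg (inv_nonneg.2 hpow.le) (h.fin _ ξ hξ))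
    (by simp only [condPos]; rw [condLExp_const h.le]; simp)
  have hm : Measurable[m] fun ω => (n : ℝ)⁻¹ • ξ ω := (measurable_const (a := (n : ℝ)⁻¹)).smul hξ
  have := hge.le_of_condLe (h.condLe_stepReal hV (hlt x) hm) (Eventually.of_forall fun ω => by
    have h1 := he ω (x + inner ℝ ((n : ℝ)⁻¹ • ξ ω) (Y ω)) n hn
    have h2 : (n : ℝ) * (x + inner ℝ ((n : ℝ)⁻¹ • ξ ω) (Y ω)) = n * x + inner ℝ (ξ ω) (Y ω) := by
      rw [real_inner_smul_left]; field_simp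
    rw [h2] at h1
    simp only [gain]
    rw [← sub_eq_add_neg, sub_le_iff_le_add, inv_mul_le_iff₀ hpow]
    exact h1) (h.fin x _ hm)
  filter_upwards [this] with ω hω
  rw [← sub_eq_add_neg, sub_le_iff_le_add, inv_mul_le_iff₀ hpow] at hω
  exact hω

/-- Where the values at `-n` stay bounded below, the pairs of capital `-n` and reduced optimizer
explode with conditional utility bounded below, which coercivity forbids. This is why coercivity is
proved for varying capitals. -/
theorem stepReal_unbdd (h : IsMarketStep μ m U a b C v Y)
    (hV : ∀ᵐ ω ∂μ, ∀ x, V x ω = v x ω) (hlt : ∀ x, ∀ᵐ ω ∂μ, stepEssSup μ m V Y x ω < ⊤) :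
    ∀ᵐ ω ∂μ, ∀ M, ∃ n : ℕ, stepReal μ m V Y (-(n : ℝ)) ω < M := by
  choose ξ hξ hg using fun n : ℕ => h.exists_condGe_stepReal hV (hlt (-(n : ℝ)))
  choose ζ hζ hζξ using fun n => exists_isReduced (μ := μ) (Y := Y) h.le (hξ n)
  have hgζ : ∀ n : ℕ, CondGe μ m (gain v Y (fun _ => -(n : ℝ)) (ζ n))
      (stepReal μ m V Y (-(n : ℝ))) := fun n => (hg n).congr (gain_congr (hζξ n)).symm
  let B : Set Ω := {ω | ∃ M : ℕ, ∀ n : ℕ, -(M : ℝ) ≤ stepReal μ m V Y (-(n : ℝ)) ω}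
  have hB : MeasurableSet[m] B := by
    have : B = ⋃ M : ℕ, ⋂ n : ℕ, {ω | -(M : ℝ) ≤ stepReal μ m V Y (-(n : ℝ)) ω} := by
      ext; simp [B]
    rw [this]
    exact MeasurableSet.iUnion fun M => MeasurableSet.iInter fun n =>
      h.measurable_stepReal (-(n : ℝ)) (measurableSet_Ici (a := -(M : ℝ)))
  have hnull : ∀ᵐ ω ∂μ, ω ∉ B := by
    refine h.null_of_explosion (X := fun n _ => -(n : ℝ)) (fun _ => measurable_const) hζ
      (K := fun _ => 0) (fun n ω => by simp) hB (fun ω _ => ?_) ?_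
    · refine tendsto_atTop_mono (fun n => ?_) tendsto_natCast_atTop_atTop
      rw [abs_neg, Nat.abs_cast]
      exact le_add_of_nonneg_right (norm_nonneg _)
    · filter_upwards [ae_all_iff.2 hgζ] with ω hge hωB
      obtain ⟨M, hM⟩ := hωB
      refine ⟨ENNReal.ofReal M, ENNReal.ofReal_ne_top, fun n => ?_⟩
      refine (le_self_add.trans (hge n)).trans (add_le_add_right (ENNReal.ofReal_le_ofReal ?_) _)
      linarith [hM n]
  filter_upwards [hnull] with ω hω M
  by_contra! hM
  obtain ⟨k, hk⟩ := exists_nat_ge (-M)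
  exact hω ⟨k, fun n => le_trans (by linarith) (hM n)⟩

end IsMarketStep

end OneStep

/-- A deterministic statement, applied at each good `ω`; `Unit` serves as the sample space so that
`UtilityField` can be reused. Continuity of `U` carries the lower bound from rationals to reals. -/
theorem exists_utility_extension {U : ℝ → ℝ} {a b C : ℝ} (hU : Continuous U) {j : ℚ → ℝ}
    (hmono : Monotone j)
    (hconc : ∀ p r q : ℚ, p < r → r < q →
      ((q : ℝ) - r) * j p + ((r : ℝ) - p) * j q ≤ ((q : ℝ) - p) * j r)
    (hlow : ∀ q : ℚ, U q ≤ j q) (hunb : ∀ M, ∃ q, j q < M)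
    (hscale : ∀ (q : ℚ) (n : ℕ), 1 ≤ n →
      j (n * q) ≤ (n : ℝ) ^ a * (j q + C) ∧ j (n * q) ≤ (n : ℝ) ^ b * (j q + C)) :
    ∃ w : ℝ → ℝ, (∀ x, (⨆ (q : ℚ) (_ : (q : ℝ) < x), (j q : EReal)) = w x) ∧
      UtilityField (Ω := Unit) ⊤ U a b C (fun x _ => w x) ∧
      (∀ (q : ℚ) x, (q : ℝ) < x → j q ≤ w x) ∧ ∀ (q : ℚ) x, x ≤ (q : ℝ) → w x ≤ j q := by
  obtain ⟨w, h1, h2, h3, h4, h5, h6⟩ := exists_concave_extension hmono hconc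
  have hsc : ∀ e : ℝ, (∀ (q : ℚ) (n : ℕ), 1 ≤ n → j (n * q) ≤ (n : ℝ) ^ e * (j q + C)) →
      ∀ (x : ℝ) (n : ℕ), 1 ≤ n → w (n * x) ≤ (n : ℝ) ^ e * (w x + C) := by
    intro e he x n hn
    have hn0 : (0 : ℝ) < n := by exact_mod_cast hn
    have hn0' : (n : ℚ) ≠ 0 := by exact_mod_cast hn0.ne'
    refine h6 _ _ fun q hq => ?_
    have h7 := he (q / n) n hn
    rw [mul_div_cancel₀ _ hn0'] at h7
    refine h7.trans ?_
    gcongr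
    refine h4 _ _ ?_
    push_cast
    rwa [div_lt_iff₀ hn0, mul_comm]
  refine ⟨w, h1, ⟨fun _ => measurable_from_top, fun _ => h2, fun _ => h3, fun x _ => ?_,
    fun _ M => ?_, fun _ => hsc a fun q n hn => (hscale q n hn).1,
    fun _ => hsc b fun q n hn => (hscale q n hn).2⟩, h4, h5⟩
  · by_contra! hlt
    obtain ⟨ε, hε, hball⟩ := Metric.eventually_nhds_iff.1 ((hU.tendsto x).eventually_const_lt hlt)
    obtain ⟨q, hq1, hq2⟩ := exists_rat_btwn (show x - ε < x by linarith)
    have := hball (y := (q : ℝ)) (by rw [Real.dist_eq, abs_lt]; constructor <;> linarith)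
    have := hlow q
    have := h4 q x hq2
    linarith
  · obtain ⟨q, hq⟩ := hunb M
    exact ⟨q, (h5 q q le_rfl).trans_lt hq⟩

/-! ### The value function at random capitals -/

section OneStep

variable {Ω : Type*} {m mΩ : MeasurableSpace Ω} {μ : Measure Ω} {d : ℕ}
  {U : ℝ → ℝ} {a b C : ℝ} {v : ℝ → Ω → ℝ} {Y : Ω → EuclideanSpace ℝ (Fin d)}
  {V : ℝ → Ω → EReal}

theorem exists_measurableSet_of_ae (hnull : ∀ A, MeasurableSet[mΩ] A → μ A = 0 → MeasurableSet[m] A)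
    {p : Ω → Prop} (h : ∀ᵐ ω ∂μ, p ω) :
    ∃ G, MeasurableSet[m] G ∧ (∀ᵐ ω ∂μ, ω ∈ G) ∧ ∀ ω ∈ G, p ω := by
  have h0 : μ (toMeasurable μ {ω | ¬ p ω}) = 0 := by rw [measure_toMeasurable]; exact h
  refine ⟨(toMeasurable μ {ω | ¬ p ω})ᶜ, (hnull _ (measurableSet_toMeasurable _ _) h0).compl,
    ?_, fun ω hω => ?_⟩
  · exact measure_eq_zero_iff_ae_notMem.1 h0
  · by_contra hp
    exact hω (subset_toMeasurable _ _ hp)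

/-- One step of dynamic programming: the value function is again a random utility function, it
bounds the conditional utilities from random initial capitals, and the bound is attained. -/
theorem IsMarketStep.exists_value [IsProbabilityMeasure μ] (h : IsMarketStep μ m U a b C v Y)
    (hUf : UtilityField m U a b C fun x _ => U x)
    (hnull : ∀ A, MeasurableSet[mΩ] A → μ A = 0 → MeasurableSet[m] A)
    (hV : ∀ᵐ ω ∂μ, ∀ x, V x ω = v x ω) (hlt : ∀ x, ∀ᵐ ω ∂μ, stepEssSup μ m V Y x ω < ⊤) :
    ∃ w : ℝ → Ω → ℝ, UtilityField m U a b C w ∧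
      (∀ᵐ ω ∂μ, ∀ x, stepValue μ m V Y x ω = w x ω) ∧
      (∀ (X : Ω → ℝ) (ξ : Ω → EuclideanSpace ℝ (Fin d)), Measurable[m] X → Measurable[m] ξ →
        CondLe μ m (gain v Y X ξ) fun ω => w (X ω) ω) ∧
      ∀ X : Ω → ℝ, Measurable[m] X → ∃ ξ : Ω → EuclideanSpace ℝ (Fin d), Measurable[m] ξ ∧
        CondGe μ m (gain v Y X ξ) fun ω => w (X ω) ω := by
  classical
  let j := stepReal μ m V Y
  have hUc : Ω → Continuous U := fun ω => hUf.continuous ω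
  have hconc : ∀ᵐ ω ∂μ, ∀ p r q : ℚ, p < r → r < q →
      ((q : ℝ) - r) * j p ω + ((r : ℝ) - p) * j q ω ≤ ((q : ℝ) - p) * j r ω := by
    refine ae_all_iff.2 fun p => ae_all_iff.2 fun r => ae_all_iff.2 fun q => ?_
    by_cases hpr : p < r
    swap
    · exact Eventually.of_forall fun _ h => absurd h hpr
    by_cases hrq : r < q
    swap
    · exact Eventually.of_forall fun _ _ h => absurd h hrq
    have h1 : (p : ℝ) < r := by exact_mod_cast hpr
    have h2 : (r : ℝ) < q := by exact_mod_cast hrq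
    have h3 : (0 : ℝ) < q - p := by linarith
    have h4 : ((q : ℝ) - r) / (q - p) * p + ((r : ℝ) - p) / (q - p) * q = r := by
      field_simp; ring
    have := h.stepReal_concave hV hlt (x := p) (y := q) (s := ((q : ℝ) - r) / (q - p))
      (t := ((r : ℝ) - p) / (q - p)) (div_nonneg (by linarith) h3.le)
      (div_nonneg (by linarith) h3.le) (by field_simp; ring)
    rw [h4] at this
    filter_upwards [this] with ω hω _ _
    have h5 := mul_le_mul_of_nonneg_left hω h3.le
    refine le_trans (le_of_eq ?_) h5
    simp only [j]
    field_simp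
  have hgood : ∀ᵐ ω ∂μ, (∀ q : ℚ, stepEssSup μ m V Y q ω = j q ω) ∧ ∃ w : ℝ → ℝ,
      (∀ x, (⨆ (q : ℚ) (_ : (q : ℝ) < x), (j q ω : EReal)) = w x) ∧
      UtilityField (Ω := Unit) ⊤ U a b C (fun x _ => w x) ∧
      (∀ (q : ℚ) x, (q : ℝ) < x → j q ω ≤ w x) ∧
      ∀ (q : ℚ) x, x ≤ (q : ℝ) → w x ≤ j q ω := by
    have hmono : ∀ᵐ ω ∂μ, ∀ p q : ℚ, p ≤ q → j p ω ≤ j q ω := by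
      refine ae_all_iff.2 fun p => ae_all_iff.2 fun q => ?_
      by_cases hpq : p ≤ q
      · filter_upwards [h.stepReal_mono hV hlt (x := p) (y := q) (by exact_mod_cast hpq)]
          with ω hω _ using hω
      · exact Eventually.of_forall fun _ h => absurd h hpq
    have hscale : ∀ᵐ ω ∂μ, ∀ (q : ℚ) (n : ℕ), 1 ≤ n →
        j ((n : ℝ) * q) ω ≤ (n : ℝ) ^ a * (j q ω + C) ∧
        j ((n : ℝ) * q) ω ≤ (n : ℝ) ^ b * (j q ω + C) := by
      refine ae_all_iff.2 fun q => ae_all_iff.2 fun n => ?_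
      by_cases hn : 1 ≤ n
      · filter_upwards [h.stepReal_scale hV hlt h.field.scale_left (x := q) hn,
          h.stepReal_scale hV hlt h.field.scale_right (x := q) hn] with ω h1 h2 _ using ⟨h1, h2⟩
      · exact Eventually.of_forall fun _ h => absurd h hn
    filter_upwards [ae_all_iff.2 fun q : ℚ => h.stepEssSup_eq hV (hlt q), hmono, hconc, hscale,
      h.stepReal_unbdd hV hlt] with ω h1 h2 h3 h4 h5
    refine ⟨fun q => (h1 q).1, exists_utility_extension (hUc ω) (j := fun q => j q ω)
      (fun p q hpq => h2 p q hpq) h3 (fun q => (h1 q).2) (fun M => ?_) fun q n hn => ?_⟩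
    · obtain ⟨n, hn⟩ := h5 M
      exact ⟨-(n : ℚ), by push_cast; exact hn⟩
    · push_cast
      exact h4 q n hn
  obtain ⟨G, hG, hGae, hGp⟩ := exists_measurableSet_of_ae (m := m) hnull hgood
  -- Falling back on `U` outside the good set makes the utility-field properties hold at every `ω`;
  -- the null-set hypothesis makes `G` itself `m`-measurable.
  let w : ℝ → Ω → ℝ := fun x ω => if ω ∈ G then (stepValue μ m V Y x ω).toReal else U x
  have hval : ∀ ω ∈ G, ∃ w0 : ℝ → ℝ, (∀ x, stepValue μ m V Y x ω = w0 x) ∧ (∀ x, w x ω = w0 x) ∧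
      UtilityField (Ω := Unit) ⊤ U a b C (fun x _ => w0 x) ∧
      (∀ (q : ℚ) x, (q : ℝ) < x → j q ω ≤ w0 x) ∧ ∀ (q : ℚ) x, x ≤ (q : ℝ) → w0 x ≤ j q ω := by
    intro ω hω
    obtain ⟨h1, w0, h2, h3, h4, h5⟩ := hGp ω hω
    have h6 : ∀ x, stepValue μ m V Y x ω = w0 x := fun x => by
      rw [stepValue, ← h2 x]
      simp only [h1]
    exact ⟨w0, h6, fun x => by simp only [w, hω, if_true, h6, EReal.toReal_coe], h3, h4, h5⟩
  have hwm : ∀ x, Measurable[m] (w x) := fun x => by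
    refine Measurable.ite hG ?_ measurable_const
    refine measurable_ereal_toReal.comp (Measurable.iSup fun q => Measurable.iSup fun _ => ?_)
    exact (isEssSup_stepEssSup μ m h.le V Y q).1
  have hw : UtilityField m U a b C w := by
    have hp : ∀ ω, ∃ w0 : ℝ → ℝ, (∀ x, w x ω = w0 x) ∧
        UtilityField (Ω := Unit) ⊤ U a b C (fun x _ => w0 x) := fun ω => by
      by_cases hω : ω ∈ G
      · obtain ⟨w0, -, h2, h3, -⟩ := hval ω hω
        exact ⟨w0, h2, h3⟩
      · exact ⟨U, fun x => by simp [w, hω], fun _ => measurable_from_top, fun _ => hUf.concave ω,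
          fun _ => hUf.mono ω, fun x _ => hUf.lower x ω, fun _ => hUf.unbdd ω,
          fun _ => hUf.scale_left ω, fun _ => hUf.scale_right ω⟩
    choose w0 h1 h2 using hp
    refine ⟨hwm, fun ω => ?_, fun ω => ?_, fun x ω => ?_, fun ω => ?_, fun ω => ?_, fun ω => ?_⟩
    all_goals simp only [h1]
    exacts [(h2 ω).concave (), (h2 ω).mono (), (h2 ω).lower x (), (h2 ω).unbdd (),
      (h2 ω).scale_left (), (h2 ω).scale_right ()]
  have hjw : ∀ᵐ ω ∂μ, (∀ (q : ℚ) x, (q : ℝ) < x → j q ω ≤ w x ω) ∧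
      ∀ (q : ℚ) x, x ≤ (q : ℝ) → w x ω ≤ j q ω := by
    filter_upwards [hGae] with ω hω
    obtain ⟨w0, -, h2, -, h4, h5⟩ := hval ω hω
    simp only [h2]
    exact ⟨h4, h5⟩
  refine ⟨w, hw, ?_, fun X ξ hX hξ => ?_, fun X hX => ?_⟩
  · filter_upwards [hGae] with ω hω x
    obtain ⟨w0, h1, h2, -⟩ := hval ω hω
    rw [h1, h2]
  · let τ : ℕ → Ω → ℤ := fun n ω => ⌊((n : ℝ) + 1) * X ω⌋
    let q : ℕ → ℤ → ℚ := fun n i => ((i : ℚ) + 1) / ((n : ℚ) + 1)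
    have hτ : ∀ n, Measurable[m] (τ n) := fun n =>
      Int.measurable_floor.comp (measurable_const.mul hX)
    have hq1 : ∀ n ω, X ω < (q n (τ n ω) : ℝ) := fun n ω => by
      have hn : (0 : ℝ) < (n : ℝ) + 1 := by positivity
      simp only [q, τ]
      push_cast
      rw [lt_div_iff₀ hn, mul_comm]
      exact Int.lt_floor_add_one _
    have hq2 : ∀ (n : ℕ) ω, (q n (τ n ω) : ℝ) ≤ X ω + 1 / ((n : ℝ) + 1) := fun n ω => by
      have hn : (0 : ℝ) < (n : ℝ) + 1 := by positivity
      simp only [q, τ]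
      push_cast
      have h1 : (X ω + 1 / ((n : ℝ) + 1)) * ((n : ℝ) + 1) = ((n : ℝ) + 1) * X ω + 1 := by
        field_simp
      rw [div_le_iff₀ hn, h1]
      have := Int.floor_le (((n : ℝ) + 1) * X ω)
      linarith
    have hfr : Tendsto (fun n : ℕ => 1 / ((n : ℝ) + 1)) atTop (𝓝 0) :=
      tendsto_one_div_add_atTop_nhds_zero_nat (𝕜 := ℝ)
    have hpaste : ∀ n, ∀ᵐ ω ∂μ,
        condPos μ m (gain v Y X ξ) ω + ENNReal.ofReal (-j (q n (τ n ω)) ω)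
          ≤ condNeg μ m (gain v Y X ξ) ω + ENNReal.ofReal (j (q n (τ n ω)) ω) := fun n => by
      have hle : gain v Y X ξ ≤ᵐ[μ] fun ω => gain v Y (fun _ => (q n (τ n ω) : ℝ)) ξ ω :=
        Eventually.of_forall fun ω => h.field.mono ω (by have := hq1 n ω; linarith)
      filter_upwards [condPos_mono (m := m) hle, condNeg_anti (m := m) hle,
        condPos_paste (μ := μ) h.le (hτ n) fun i => gain v Y (fun _ => (q n i : ℝ)) ξ,
        condNeg_paste (μ := μ) h.le (hτ n) fun i => gain v Y (fun _ => (q n i : ℝ)) ξ,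
        ae_all_iff.2 fun i => h.condLe_stepReal hV (hlt (q n i)) hξ] with ω e1 e2 e3 e4 e5
      rw [e3] at e1
      rw [e4] at e2
      exact (add_le_add_left e1 _).trans ((e5 _).trans (add_le_add_left e2 _))
    filter_upwards [ae_all_iff.2 hpaste, hjw] with ω h1 h2
    have hlim : Tendsto (fun n => j (q n (τ n ω)) ω) atTop (𝓝 (w (X ω) ω)) := by
      -- The factor `2` makes the grid point strictly smaller, as the comparison `j q ≤ w x` for `q
      -- < x` requires.
      have hup : Tendsto (fun n : ℕ => w (X ω + 2 * (1 / ((n : ℝ) + 1))) ω) atTop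
          (𝓝 (w (X ω) ω)) := by
        refine ((hw.continuous ω).tendsto _).comp ?_
        simpa using (tendsto_const_nhds (x := X ω)).add (hfr.const_mul 2)
      refine tendsto_of_tendsto_of_tendsto_of_le_of_le tendsto_const_nhds hup (fun n => ?_)
        fun n => ?_
      · exact h2.2 _ _ (hq1 n ω).le
      · refine h2.1 _ _ ((hq2 n ω).trans_lt ?_)
        have : (0 : ℝ) < 1 / ((n : ℝ) + 1) := by positivity
        linarith
    exact le_of_tendsto_of_tendsto' (tendsto_const_nhds.add (ENNReal.tendsto_ofReal hlim.neg))
      (tendsto_const_nhds.add (ENNReal.tendsto_ofReal hlim)) h1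
  · let τ : ℕ → Ω → ℤ := fun n ω => ⌈((n : ℝ) + 1) * X ω⌉
    let q : ℕ → ℤ → ℚ := fun n i => ((i : ℚ) - 1) / ((n : ℚ) + 1)
    have hτ : ∀ n, Measurable[m] (τ n) := fun n =>
      Int.measurable_ceil.comp (measurable_const.mul hX)
    have hq1 : ∀ n ω, (q n (τ n ω) : ℝ) < X ω := fun n ω => by
      have hn : (0 : ℝ) < (n : ℝ) + 1 := by positivity
      simp only [q, τ]
      push_cast
      rw [div_lt_iff₀ hn, mul_comm (X ω)]
      have := Int.ceil_lt_add_one (((n : ℝ) + 1) * X ω)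
      linarith
    have hq2 : ∀ (n : ℕ) ω, X ω - 1 / ((n : ℝ) + 1) ≤ (q n (τ n ω) : ℝ) := fun n ω => by
      have hn : (0 : ℝ) < (n : ℝ) + 1 := by positivity
      simp only [q, τ]
      push_cast
      have h1 : (X ω - 1 / ((n : ℝ) + 1)) * ((n : ℝ) + 1) = ((n : ℝ) + 1) * X ω - 1 := by
        field_simp
      rw [le_div_iff₀ hn, h1]
      have := Int.le_ceil (((n : ℝ) + 1) * X ω)
      linarith
    choose ξ hξ hge using fun x : ℚ => h.exists_condGe_stepReal hV (hlt x)
    refine h.exists_condGe hX (ξ := fun n ω => ξ (q n (τ n ω)) ω)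
      (fun n => @measurable_paste Ω ℤ _ m _ _ _ _ _ (hτ n) (fun i => ξ (q n i)) fun i => hξ _)
      (A := fun n ω => j (q n (τ n ω)) ω) ?_ fun n => ?_
    · filter_upwards [hjw] with ω h2
      have hlow : Tendsto (fun n : ℕ => w (X ω - 1 / ((n : ℝ) + 1)) ω) atTop
          (𝓝 (w (X ω) ω)) := by
        refine ((hw.continuous ω).tendsto _).comp ?_
        simpa using (tendsto_const_nhds (x := X ω)).sub
          (tendsto_one_div_add_atTop_nhds_zero_nat (𝕜 := ℝ))
      exact tendsto_of_tendsto_of_tendsto_of_le_of_le hlow tendsto_const_nhds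
        (fun n => h2.2 _ _ (hq2 n ω)) fun n => h2.1 _ _ (hq1 n ω)
    · refine (CondGe.paste h.le (hτ n) (f := fun i => gain v Y (fun _ => (q n i : ℝ)) (ξ (q n i)))
        (A := fun i => j (q n i)) fun i => hge (q n i)).mono (Eventually.of_forall fun ω => ?_)
      exact h.field.mono ω (by have := hq1 n ω; simp only; linarith)

end OneStep

/-! ### Growth exponents of the utility function -/

section Utility

variable {U : ℝ → ℝ}

/-- Concavity between `0` and `n x`; this is the exponent `1` available for every utility function.
-/
theorem IsUtility.le_mul (hU : IsUtility U) (x : ℝ) {n : ℕ} (hn : 1 ≤ n) :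
    U (n * x) ≤ n * U x := by
  have hn0 : (1 : ℝ) ≤ n := by exact_mod_cast hn
  have hn1 : (0 : ℝ) < n := by linarith
  have h := hU.1.2 (Set.mem_univ (n * x)) (Set.mem_univ 0) (inv_nonneg.2 hn1.le)
    (sub_nonneg.2 (inv_le_one_of_one_le₀ hn0)) (by ring : (n : ℝ)⁻¹ + (1 - (n : ℝ)⁻¹) = 1)
  simp only [smul_eq_mul, mul_zero, add_zero, hU.2.2] at h
  rw [inv_mul_cancel_left₀ hn1.ne', inv_mul_le_iff₀ hn1] at h
  exact h

theorem IsUtility.eq_zero_of_nonneg (hU : IsUtility U) (h : ∀ x, 0 ≤ U x) (x : ℝ) : U x = 0 := by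
  have h1 := hU.1.2 (Set.mem_univ x) (Set.mem_univ (-x)) (by norm_num : (0 : ℝ) ≤ 1 / 2)
    (by norm_num : (0 : ℝ) ≤ 1 / 2) (by norm_num)
  simp only [smul_eq_mul] at h1
  rw [show 1 / 2 * x + 1 / 2 * -x = 0 by ring, hU.2.2] at h1
  have := h x
  have := h (-x)
  linarith

theorem IsUtility.exists_lt (hU : IsUtility U) (h : ∃ x, U x < 0) (M : ℝ) : ∃ x, U x < M := by
  obtain ⟨x, hx⟩ := h
  obtain ⟨n, hn⟩ := exists_nat_gt (|M| / -U x)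
  rw [div_lt_iff₀ (by linarith)] at hn
  refine ⟨((n + 1 : ℕ) : ℝ) * x, (hU.le_mul x (Nat.le_add_left 1 n)).trans_lt ?_⟩
  push_cast
  have := neg_abs_le M
  linarith

/-- Under one of the elasticity conditions the utility function has two distinct growth
exponents along integer scalings. -/
theorem IsUtility.exists_exponents (hU : IsUtility U)
    (hAE : ElasticityAtTop U ∨ ElasticityAtBot U) :
    ∃ a b C : ℝ, 0 < a ∧ a < b ∧ 0 ≤ C ∧ ∀ (x : ℝ) (n : ℕ), 1 ≤ n →
      U (n * x) ≤ (n : ℝ) ^ a * (U x + C) ∧ U (n * x) ≤ (n : ℝ) ^ b * (U x + C) := by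
  have hpos : ∀ x, 0 ≤ x → 0 ≤ U x := fun x hx => hU.2.2 ▸ hU.2.1 hx
  have hnp : ∀ x, x ≤ 0 → U x ≤ 0 := fun x hx => hU.2.2 ▸ hU.2.1 hx
  have hlin : ∀ C : ℝ, 0 ≤ C → ∀ (x : ℝ) (n : ℕ), 1 ≤ n →
      U (n * x) ≤ (n : ℝ) ^ (1 : ℝ) * (U x + C) := fun C hC x n hn => by
    have := hU.le_mul x hn
    rw [Real.rpow_one]
    nlinarith [mul_nonneg (Nat.cast_nonneg (α := ℝ) n) hC]
  rcases hAE with ⟨x₀, hx₀, γ, hγ0, hγ1, h⟩ | ⟨α, hα, x₀, hx₀, h⟩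
  · have hC := hpos x₀ hx₀.le
    -- The constant `U x₀` covers `0 ≤ x ≤ x₀`, where `U (n x) ≤ U (n x₀)`. For `x ≤ 0` the linear
    -- bound suffices, since `n ^ γ ≤ n` and `U x ≤ 0`.
    refine ⟨γ, 1, U x₀, hγ0, hγ1, hC, fun x n hn => ⟨?_, hlin _ hC x n hn⟩⟩
    have hn0 : (1 : ℝ) ≤ n := by exact_mod_cast hn
    have hpow : 0 ≤ (n : ℝ) ^ γ := by positivity
    rcases le_total x₀ x with hx | hx
    · have h1 := h x hx n hn0
      nlinarith
    rcases le_total 0 x with hx0 | hx0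
    · have h1 := h x₀ le_rfl n hn0
      have h2 : U (n * x) ≤ U (n * x₀) := hU.2.1 (by gcongr)
      nlinarith [mul_nonneg hpow (hpos x hx0)]
    · have h1 := hU.le_mul x hn
      have h2 := hnp x hx0
      have h3 : (n : ℝ) ^ γ ≤ n := by
        conv_rhs => rw [← Real.rpow_one (n : ℝ)]
        exact Real.rpow_le_rpow_of_exponent_le hn0 hγ1.le
      nlinarith [mul_nonneg hpow hC]
  · have hC : 0 ≤ -U x₀ := neg_nonneg.2 (hnp x₀ hx₀)
    -- For `x₀ ≤ x ≤ 0` this constant makes the right side nonnegative while `U (n x) ≤ 0`; for `x ≥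
    -- 0` the linear bound suffices.
    refine ⟨1, 1 + α, -U x₀, one_pos, by linarith, hC, fun x n hn => ⟨hlin _ hC x n hn, ?_⟩⟩
    have hn0 : (1 : ℝ) ≤ n := by exact_mod_cast hn
    have hpow : 0 ≤ (n : ℝ) ^ (1 + α) := by positivity
    rcases le_total x x₀ with hx | hx
    · have h1 := h x hx n hn0
      nlinarith
    rcases le_total 0 x with hx0 | hx0
    · have h1 := hU.le_mul x hn
      have h2 := hpos x hx0
      have h3 : (n : ℝ) ≤ (n : ℝ) ^ (1 + α) := by
        conv_lhs => rw [← Real.rpow_one (n : ℝ)]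
        exact Real.rpow_le_rpow_of_exponent_le hn0 (by linarith)
      nlinarith [mul_nonneg hpow hC]
    · have h1 : U (n * x) ≤ 0 := hnp _ (mul_nonpos_of_nonneg_of_nonpos (by linarith) hx0)
      have h2 := hU.2.1 hx
      exact h1.trans (mul_nonneg hpow (by linarith))

end Utility

/-! ### Integrability of the utility of optimal positions -/

section Integrability

variable {Ω : Type*} {m mΩ : MeasurableSpace Ω} {μ : Measure Ω} [IsProbabilityMeasure μ] {d : ℕ}
  {U : ℝ → ℝ} {a b C : ℝ} {v w : ℝ → Ω → ℝ} {Y : Ω → EuclideanSpace ℝ (Fin d)}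

theorem lintegral_condPos (hm : m ≤ mΩ) (X : Ω → ℝ) :
    ∫⁻ ω, condPos μ m X ω ∂μ = ∫⁻ ω, ENNReal.ofReal (X ω) ∂μ :=
  lintegral_condLExp hm μ _

theorem lintegral_condNeg (hm : m ≤ mΩ) (X : Ω → ℝ) :
    ∫⁻ ω, condNeg μ m X ω ∂μ = ∫⁻ ω, ENNReal.ofReal (-X ω) ∂μ :=
  lintegral_condLExp hm μ _

theorem CondGe.lintegral (hm : m ≤ mΩ) {X A : Ω → ℝ} (h : CondGe μ m X A)
    (hA : Measurable[m] A) :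
    ∫⁻ ω, ENNReal.ofReal (-X ω) ∂μ + ∫⁻ ω, ENNReal.ofReal (A ω) ∂μ
      ≤ ∫⁻ ω, ENNReal.ofReal (X ω) ∂μ + ∫⁻ ω, ENNReal.ofReal (-A ω) ∂μ := by
  have hA1 : Measurable fun ω => ENNReal.ofReal (A ω) := (hA.mono hm le_rfl).ennreal_ofReal
  have hA2 : Measurable fun ω => ENNReal.ofReal (-A ω) := (hA.mono hm le_rfl).neg.ennreal_ofReal
  rw [← lintegral_condPos hm X, ← lintegral_condNeg hm X,
    ← lintegral_add_right _ hA1, ← lintegral_add_right _ hA2]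
  exact lintegral_mono_ae h

theorem CondLe.lintegral (hm : m ≤ mΩ) {X A : Ω → ℝ} (h : CondLe μ m X A)
    (hA : Measurable[m] A) :
    ∫⁻ ω, ENNReal.ofReal (X ω) ∂μ + ∫⁻ ω, ENNReal.ofReal (-A ω) ∂μ
      ≤ ∫⁻ ω, ENNReal.ofReal (-X ω) ∂μ + ∫⁻ ω, ENNReal.ofReal (A ω) ∂μ := by
  have hA1 : Measurable fun ω => ENNReal.ofReal (A ω) := (hA.mono hm le_rfl).ennreal_ofReal
  have hA2 : Measurable fun ω => ENNReal.ofReal (-A ω) := (hA.mono hm le_rfl).neg.ennreal_ofReal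
  rw [← lintegral_condPos hm X, ← lintegral_condNeg hm X,
    ← lintegral_add_right _ hA1, ← lintegral_add_right _ hA2]
  exact lintegral_mono_ae h

/-- Where `A` is negative, its absolute value is at most the conditional negative part of `X`. No
integrability is needed, so finite negative parts propagate backwards in time. -/
theorem CondLe.lintegral_neg_le (hm : m ≤ mΩ) {X A : Ω → ℝ} (h : CondLe μ m X A) :
    ∫⁻ ω, ENNReal.ofReal (-A ω) ∂μ ≤ ∫⁻ ω, ENNReal.ofReal (-X ω) ∂μ := by
  rw [← lintegral_condNeg hm X]
  refine lintegral_mono_ae ?_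
  filter_upwards [h] with ω h
  rcases le_total 0 (A ω) with hA | hA
  · simp [ENNReal.ofReal_of_nonpos (neg_nonpos.2 hA)]
  · rw [ENNReal.ofReal_of_nonpos hA, add_zero] at h
    exact le_add_self.trans h

/-- The two growth exponents force optimal positions to have integrable utility. -/
theorem IsMarketStep.lintegral_gain_lt_top (h : IsMarketStep μ m U a b C v Y)
    (hw : UtilityField m U a b C w) {X : Ω → ℝ} {ξ : Ω → EuclideanSpace ℝ (Fin d)}
    (hX : Measurable[m] X) (hξ : Measurable[m] ξ)
    (hge : CondGe μ m (gain v Y X ξ) fun ω => w (X ω) ω)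
    (hle : CondLe μ m (gain v Y (fun ω => X ω / 2) fun ω => (2 : ℝ)⁻¹ • ξ ω)
      fun ω => w (X ω / 2) ω)
    (h1 : ∫⁻ ω, ENNReal.ofReal (w (X ω) ω) ∂μ < ∞)
    (h2 : ∫⁻ ω, ENNReal.ofReal (-w (X ω) ω) ∂μ < ∞)
    (h0 : ∫⁻ ω, ENNReal.ofReal (w 0 ω) ∂μ < ∞) :
    ∫⁻ ω, ENNReal.ofReal (gain v Y X ξ ω) ∂μ < ∞ ∧
      ∫⁻ ω, ENNReal.ofReal (-gain v Y X ξ ω) ∂μ < ∞ := by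
  let g := gain v Y X ξ
  let z := gain v Y (fun ω => X ω / 2) fun ω => (2 : ℝ)⁻¹ • ξ ω
  have hX2 : Measurable[m] fun ω => X ω / 2 := hX.div_const 2
  have hξ2 : Measurable[m] fun ω => (2 : ℝ)⁻¹ • ξ ω := (measurable_const (a := (2 : ℝ)⁻¹)).smul hξ
  have hgm : Measurable g := h.measurable_gain hX hξ
  have hzm : Measurable z := h.measurable_gain hX2 hξ2
  let α : ℝ := (2 : ℝ) ^ (-a)
  let β : ℝ := (2 : ℝ) ^ (-b)
  have hα : 0 < α := Real.rpow_pos_of_pos two_pos _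
  have hβ : 0 < β := Real.rpow_pos_of_pos two_pos _
  have hαβ : β < α := Real.rpow_lt_rpow_of_exponent_lt one_lt_two (neg_lt_neg h.a_lt_b)
  have hgz : ∀ ω, α * g ω ≤ z ω + C ∧ β * g ω ≤ z ω + C := fun ω => by
    have e : ((2 : ℕ) : ℝ) * (X ω / 2 + inner ℝ ((2 : ℝ)⁻¹ • ξ ω) (Y ω))
        = X ω + inner ℝ (ξ ω) (Y ω) := by
      rw [real_inner_smul_left]; push_cast; ring
    have s1 := h.field.scale_left ω (X ω / 2 + inner ℝ ((2 : ℝ)⁻¹ • ξ ω) (Y ω)) 2 (by norm_num)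
    have s2 := h.field.scale_right ω (X ω / 2 + inner ℝ ((2 : ℝ)⁻¹ • ξ ω) (Y ω)) 2 (by norm_num)
    rw [e] at s1 s2
    constructor
    · simp only [α, g, z, gain]
      rw [Real.rpow_neg two_pos.le, inv_mul_le_iff₀ (by positivity)]
      exact_mod_cast s1
    · simp only [β, g, z, gain]
      rw [Real.rpow_neg two_pos.le, inv_mul_le_iff₀ (by positivity)]
      exact_mod_cast s2
  -- For `g ≥ 0` the exponent `a` is used, for `g ≤ 0` the exponent `b`; the gap `α - β` survives
  -- after the conditional bounds for `g` and `z` are inserted.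
  have hpt : ∀ ω, ENNReal.ofReal (-z ω) + ENNReal.ofReal α * ENNReal.ofReal (g ω)
      ≤ ENNReal.ofReal (z ω) + (ENNReal.ofReal β * ENNReal.ofReal (-g ω) + ENNReal.ofReal C) := by
    intro ω
    obtain ⟨s1, s2⟩ := hgz ω
    rw [← ENNReal.ofReal_mul hα.le, ← ENNReal.ofReal_mul hβ.le]
    simp only [ENNReal.ofReal, ← ENNReal.coe_add, ENNReal.coe_le_coe]
    rw [← NNReal.coe_le_coe]
    push_cast
    simp only [Real.coe_toNNReal']
    have hC := h.C_nonneg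
    rw [max_eq_left hC]
    have hz := max_zero_sub_max_neg_zero_eq_self (z ω)
    rcases le_total 0 (g ω) with hg | hg
    · rw [max_eq_left (mul_nonneg hα.le hg), max_eq_right (by nlinarith : β * -g ω ≤ 0)]
      linarith
    · rw [max_eq_right (mul_nonpos_of_nonneg_of_nonpos hα.le hg),
        max_eq_left (by nlinarith : 0 ≤ β * -g ω)]
      linarith
  have hcond : ∀ᵐ ω ∂μ, condNeg μ m z ω + ENNReal.ofReal α * condPos μ m g ω
      ≤ condPos μ m z ω + (ENNReal.ofReal β * condNeg μ m g ω + ENNReal.ofReal C) := by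
    have e1 := condLExp_add_left' (m := m) (μ := μ) (X := fun ω => ENNReal.ofReal (-z ω))
      (Y := fun ω => ENNReal.ofReal α * ENNReal.ofReal (g ω)) hzm.neg.ennreal_ofReal
    have e2 := condLExp_mul_left (μ := μ) h.le (f := fun _ => ENNReal.ofReal α) measurable_const
      (g := fun ω => ENNReal.ofReal (g ω)) hgm.ennreal_ofReal.aemeasurable
    have e3 := condLExp_add_left' (m := m) (μ := μ) (X := fun ω => ENNReal.ofReal (z ω))
      (Y := fun ω => ENNReal.ofReal β * ENNReal.ofReal (-g ω) + ENNReal.ofReal C)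
      hzm.ennreal_ofReal
    have e4 := condLExp_add_left' (m := m) (μ := μ)
      (X := fun ω => ENNReal.ofReal β * ENNReal.ofReal (-g ω)) (Y := fun _ => ENNReal.ofReal C)
      (measurable_const.mul hgm.neg.ennreal_ofReal)
    have e5 := condLExp_mul_left (μ := μ) h.le (f := fun _ => ENNReal.ofReal β) measurable_const
      (g := fun ω => ENNReal.ofReal (-g ω)) hgm.neg.ennreal_ofReal.aemeasurable
    have e6 := condLExp_mono (mΩ := m) (P := μ) (Eventually.of_forall hpt)
    rw [condLExp_const h.le] at e4
    filter_upwards [e1, e2, e3, e4, e5, e6] with ω e1 e2 e3 e4 e5 e6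
    rw [e1, e2, e3, e4, e5] at e6
    exact e6
  have hbound : ∀ᵐ ω ∂μ, ENNReal.ofReal (α - β) * condPos μ m g ω
      ≤ ENNReal.ofReal (w (X ω) ω) + ENNReal.ofReal (w 0 ω)
        + (ENNReal.ofReal β * ENNReal.ofReal (-w (X ω) ω) + ENNReal.ofReal C) := by
    filter_upwards [hcond, hge, hle, h.condPos_gain_lt_top hX hξ, h.condPos_gain_lt_top hX2 hξ2]
      with ω hcond hge hle hfg hfz
    set p := condPos μ m g ω
    set n := condNeg μ m g ω
    set pz := condPos μ m z ω
    set nz := condNeg μ m z ω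
    have hp : p ≠ ∞ := hfg.ne
    have hpz : pz ≠ ∞ := hfz.ne
    have hn : n ≤ p + ENNReal.ofReal (-w (X ω) ω) := le_self_add.trans hge
    have hn' : n ≠ ∞ := ne_top_of_le_ne_top (by simp [hp]) hn
    have hnz : nz ≠ ∞ := ne_top_of_le_ne_top (by
      simp [hpz, ENNReal.mul_ne_top ENNReal.ofReal_ne_top hn']) (le_self_add.trans hcond)
    have hpz' : pz ≤ nz + ENNReal.ofReal (w (X ω / 2) ω) := le_self_add.trans hle
    -- Half the capital lies between `0` and `X`; hence only integrability at `X` and at `0` is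
    -- required.
    have hhalf : ENNReal.ofReal (w (X ω / 2) ω)
        ≤ ENNReal.ofReal (w (X ω) ω) + ENNReal.ofReal (w 0 ω) := by
      rcases le_total 0 (X ω) with h0 | h0
      · exact (ENNReal.ofReal_le_ofReal (hw.mono ω (by linarith))).trans le_self_add
      · exact (ENNReal.ofReal_le_ofReal (hw.mono ω (by linarith))).trans le_add_self
    have hsplit : ENNReal.ofReal α * p
        = ENNReal.ofReal β * p + ENNReal.ofReal (α - β) * p := by
      rw [← add_mul, ← ENNReal.ofReal_add hβ.le (by linarith)]
      congr 2; ring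
    refine (ENNReal.add_le_add_iff_left (a := nz + ENNReal.ofReal β * p)
      (ENNReal.add_ne_top.2 ⟨hnz, ENNReal.mul_ne_top ENNReal.ofReal_ne_top hp⟩)).1 ?_
    calc nz + ENNReal.ofReal β * p + ENNReal.ofReal (α - β) * p
        = nz + ENNReal.ofReal α * p := by rw [hsplit, add_assoc]
      _ ≤ pz + (ENNReal.ofReal β * n + ENNReal.ofReal C) := hcond
      _ ≤ (nz + (ENNReal.ofReal (w (X ω) ω) + ENNReal.ofReal (w 0 ω))) +
          (ENNReal.ofReal β * (p + ENNReal.ofReal (-w (X ω) ω)) + ENNReal.ofReal C) := by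
        gcongr
        exact hpz'.trans (add_le_add_right hhalf _)
      _ = _ := by ring
  have hwX : Measurable fun ω => w (X ω) ω := (hw.measurable_comp hX).mono h.le le_rfl
  have hwX' : Measurable fun ω => ENNReal.ofReal (-w (X ω) ω) := hwX.neg.ennreal_ofReal
  have hw0 : Measurable fun ω => w 0 ω := (hw.meas 0).mono h.le le_rfl
  have hsum : Measurable fun ω => ENNReal.ofReal (w (X ω) ω) + ENNReal.ofReal (w 0 ω) :=
    hwX.ennreal_ofReal.add hw0.ennreal_ofReal
  have hp : ∫⁻ ω, condPos μ m g ω ∂μ < ∞ := by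
    have e1 : ENNReal.ofReal (α - β) * ∫⁻ ω, condPos μ m g ω ∂μ < ∞ := by
      have hpm : Measurable (condPos μ m g) := measurable_condLExp' m μ _
      rw [← lintegral_const_mul _ hpm]
      refine (lintegral_mono_ae hbound).trans_lt ?_
      rw [lintegral_add_left hsum,
        lintegral_add_left hwX.ennreal_ofReal, lintegral_add_right _ measurable_const,
        lintegral_const_mul _ hwX']
      have e2 : ENNReal.ofReal β * ∫⁻ ω, ENNReal.ofReal (-w (X ω) ω) ∂μ < ∞ :=
        ENNReal.mul_lt_top ENNReal.ofReal_lt_top h2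
      simp [h1, h0, e2]
    refine lt_top_iff_ne_top.2 fun htop => ?_
    rw [htop, ENNReal.mul_top (by simp [hαβ])] at e1
    exact lt_irrefl _ e1
  have hn : ∫⁻ ω, condNeg μ m g ω ∂μ < ∞ := by
    have e1 : ∀ᵐ ω ∂μ, condNeg μ m g ω ≤ condPos μ m g ω + ENNReal.ofReal (-w (X ω) ω) := by
      filter_upwards [hge] with ω hge using le_self_add.trans hge
    refine (lintegral_mono_ae e1).trans_lt ?_
    rw [lintegral_add_right _ hwX']
    exact ENNReal.add_lt_top.2 ⟨hp, h2⟩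
  rw [lintegral_condPos h.le] at hp
  rw [lintegral_condNeg h.le] at hn
  exact ⟨hp, hn⟩

end Integrability

/-! ### Wealth processes -/

section Wealth

variable {Ω : Type*} {mΩ : MeasurableSpace Ω} {d : ℕ}
  {S φ ψ : ℕ → Ω → EuclideanSpace ℝ (Fin d)} {c : ℝ}

theorem wealth_zero (ω : Ω) : wealth S c φ 0 ω = c := by simp [wealth]

theorem wealth_succ (t : ℕ) (ω : Ω) : wealth S c φ (t + 1) ω
    = wealth S c φ t ω + inner ℝ (φ (t + 1) ω) (increment S (t + 1) ω) := by
  rw [wealth, wealth, Finset.sum_Icc_succ_top (by omega), add_assoc]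

theorem wealth_congr {t : ℕ} (h : ∀ i ≤ t, φ i = ψ i) : wealth S c φ t = wealth S c ψ t := by
  funext ω
  simp only [wealth]
  congr 1
  refine Finset.sum_congr rfl fun i hi => ?_
  rw [h i (Finset.mem_Icc.1 hi).2]

theorem gain_wealth (v : ℝ → Ω → ℝ) (t : ℕ) :
    gain v (increment S (t + 1)) (wealth S c φ t) (φ (t + 1))
      = fun ω => v (wealth S c φ (t + 1) ω) ω := by
  funext ω
  rw [gain, wealth_succ]

variable {ℱ : Filtration ℕ mΩ} {T : ℕ}

theorem measurable_increment (hS : ∀ t ≤ T, Measurable[ℱ t] (S t)) {t : ℕ} (ht : t < T) :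
    Measurable[ℱ (t + 1)] (increment S (t + 1)) :=
  (hS (t + 1) ht).sub ((hS t ht.le).mono (ℱ.mono t.le_succ) le_rfl)

theorem measurable_wealth (hS : ∀ t ≤ T, Measurable[ℱ t] (S t)) {t : ℕ} (ht : t ≤ T)
    (hφ : ∀ s < t, Measurable[ℱ s] (φ (s + 1))) : Measurable[ℱ t] (wealth S c φ t) := by
  induction t with
  | zero =>
    have : wealth S c φ 0 = fun _ => c := funext wealth_zero
    rw [this]
    exact measurable_const
  | succ t ih =>
    have : wealth S c φ (t + 1) = fun ω =>
        wealth S c φ t ω + inner ℝ (φ (t + 1) ω) (increment S (t + 1) ω) :=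
      funext (wealth_succ t)
    rw [this]
    have hle := ℱ.mono t.le_succ
    exact ((ih (by omega) fun s hs => hφ s (by omega)).mono hle le_rfl).add
      (((hφ t (by omega)).mono hle le_rfl).inner (measurable_increment hS ht))

end Wealth

/-! ### Dynamic programming over all periods -/

section Market

variable {Ω : Type*} {mΩ : MeasurableSpace Ω} {μ : Measure Ω} {d T : ℕ}
  {ℱ : Filtration ℕ mΩ} {S : ℕ → Ω → EuclideanSpace ℝ (Fin d)} {U : ℝ → ℝ} {a b C : ℝ}

theorem NoArbitrage.one_step (hNA : NoArbitrage μ ℱ T S) {t : ℕ} (ht : t < T)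
    {ξ : Ω → EuclideanSpace ℝ (Fin d)} (hξ : Measurable[ℱ t] ξ)
    (h : ∀ᵐ ω ∂μ, 0 ≤ (inner ℝ (ξ ω) (increment S (t + 1) ω) : ℝ)) :
    ∀ᵐ ω ∂μ, (inner ℝ (ξ ω) (increment S (t + 1) ω) : ℝ) = 0 := by
  let φ : ℕ → Ω → EuclideanSpace ℝ (Fin d) := fun i => if i = t + 1 then ξ else 0
  have hw : ∀ ω, wealth S 0 φ T ω = inner ℝ (ξ ω) (increment S (t + 1) ω) := fun ω => by
    rw [wealth, zero_add, Finset.sum_eq_single (t + 1)]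
    · simp [φ]
    · intro i _ hi
      simp [φ, hi]
    · intro hi
      exact absurd (Finset.mem_Icc.2 ⟨by omega, ht⟩) hi
  have hφ : φ ∈ Strategies (d := d) ℱ T := fun s _ => by
    by_cases hs : s = t
    · subst hs
      simpa [φ] using hξ
    · simp only [φ, Nat.add_right_cancel_iff, hs, if_false]
      exact measurable_const
  have := hNA φ hφ (by simpa only [hw] using h)
  simpa only [hw] using this

/-- Where the positive part is infinite, well-definedness makes the conditional expectation equal to
`⊤`, contrary to the finite essential supremum. -/
theorem condPos_gain_lt_top_of_condExpDefined [IsFiniteMeasure μ] {m : MeasurableSpace Ω}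
    (hm : m ≤ mΩ) {V : ℝ → Ω → EReal} {v : ℝ → Ω → ℝ} {Y : Ω → EuclideanSpace ℝ (Fin d)}
    (hV : ∀ᵐ ω ∂μ, ∀ x, V x ω = v x ω) {x : ℝ} {ξ : Ω → EuclideanSpace ℝ (Fin d)}
    (hξ : Measurable[m] ξ) (hdef : CondExpDefined μ m (stepGain V Y x ξ))
    (hlt : ∀ᵐ ω ∂μ, stepEssSup μ m V Y x ω < ⊤) :
    ∀ᵐ ω ∂μ, condPos μ m (gain v Y (fun _ => x) ξ) ω < ∞ := by
  have h1 : condLExp m μ (fun ω => (stepGain V Y x ξ ω).toENNReal)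
      =ᵐ[μ] condPos μ m (gain v Y (fun _ => x) ξ) := condLExp_congr_ae (by
    filter_upwards [hV] with ω hV
    rw [stepGain, hV, toENNReal_coe_real]
    rfl)
  filter_upwards [h1, hdef, hlt, (isEssSup_stepEssSup μ m hm V Y x).2.1 _ hξ]
    with ω h1 hdef hlt hle
  rw [← h1, lt_top_iff_ne_top]
  intro htop
  have hn := fun hn => hdef ⟨htop, hn⟩
  have : extCondExp μ m (stepGain V Y x ξ) ω = ⊤ := by
    rw [extCondExp, htop]
    exact EReal.top_sub (by simpa using hn)
  rw [this] at hle
  exact absurd (hle.trans_lt hlt) (lt_irrefl _)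

theorem isMarketStep [IsProbabilityMeasure μ] (hS : ∀ t ≤ T, Measurable[ℱ t] (S t))
    (hNA : NoArbitrage μ ℱ T S) (hfin : ValueFinite μ ℱ T S U) (ha : 0 < a) (hab : a < b)
    (hC : 0 ≤ C) {t : ℕ} (ht : t < T) {v : ℝ → Ω → ℝ} (hv : UtilityField (ℱ (t + 1)) U a b C v)
    (hV : ∀ᵐ ω ∂μ, ∀ x, valueFn μ ℱ T S U (t + 1) x ω = v x ω) :
    IsMarketStep μ (ℱ t) U a b C v (increment S (t + 1)) where
  le := ℱ.le t
  measY := (measurable_increment hS ht).mono (ℱ.le _) le_rfl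
  field := hv.le (ℱ.le _)
  fin := fun x _ hξ => condPos_gain_lt_top_of_condExpDefined (ℱ.le t) hV hξ
    ((hfin.1 t ht x).1 _ hξ) (hfin.1 t ht x).2
  na := fun _ hξ h => hNA.one_step ht hξ h
  a_pos := ha
  a_lt_b := hab
  C_nonneg := hC

/-- The dynamic programming principle: regular versions of the value functions, the bound of
conditional utilities by them, and attainment of the bound. -/
theorem exists_value_process [IsProbabilityMeasure μ]
    (hnull : ∀ A : Set Ω, MeasurableSet A → μ A = 0 → MeasurableSet[ℱ 0] A)
    (hS : ∀ t ≤ T, Measurable[ℱ t] (S t)) (hNA : NoArbitrage μ ℱ T S)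
    (hfin : ValueFinite μ ℱ T S U) (ha : 0 < a) (hab : a < b) (hC : 0 ≤ C)
    (hUf : ∀ m : MeasurableSpace Ω, UtilityField m U a b C fun x _ => U x) :
    ∃ v : ℕ → ℝ → Ω → ℝ, (∀ t ≤ T, UtilityField (ℱ t) U a b C (v t)) ∧
      (∀ᵐ ω ∂μ, ∀ x, valueFn μ ℱ T S U 0 x ω = v 0 x ω) ∧
      (∀ᵐ ω ∂μ, ∀ x, v T x ω = U x) ∧
      ∀ t < T, IsMarketStep μ (ℱ t) U a b C (v (t + 1)) (increment S (t + 1)) ∧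
        (∀ (X : Ω → ℝ) (ξ : Ω → EuclideanSpace ℝ (Fin d)), Measurable[ℱ t] X → Measurable[ℱ t] ξ →
          CondLe μ (ℱ t) (gain (v (t + 1)) (increment S (t + 1)) X ξ) fun ω => v t (X ω) ω) ∧
        ∀ X : Ω → ℝ, Measurable[ℱ t] X → ∃ ξ : Ω → EuclideanSpace ℝ (Fin d), Measurable[ℱ t] ξ ∧
          CondGe μ (ℱ t) (gain (v (t + 1)) (increment S (t + 1)) X ξ) fun ω => v t (X ω) ω := by
  have hnull' : ∀ t, ∀ A : Set Ω, MeasurableSet A → μ A = 0 → MeasurableSet[ℱ t] A :=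
    fun t A hA h0 => ℱ.mono (Nat.zero_le t) A (hnull A hA h0)
  have hstep : ∀ t < T, ∀ v : ℝ → Ω → ℝ, UtilityField (ℱ (t + 1)) U a b C v →
      (∀ᵐ ω ∂μ, ∀ x, valueFn μ ℱ T S U (t + 1) x ω = v x ω) → ∃ w : ℝ → Ω → ℝ,
      UtilityField (ℱ t) U a b C w ∧ (∀ᵐ ω ∂μ, ∀ x, valueFn μ ℱ T S U t x ω = w x ω) ∧
      (∀ (X : Ω → ℝ) (ξ : Ω → EuclideanSpace ℝ (Fin d)), Measurable[ℱ t] X → Measurable[ℱ t] ξ →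
        CondLe μ (ℱ t) (gain v (increment S (t + 1)) X ξ) fun ω => w (X ω) ω) ∧
      ∀ X : Ω → ℝ, Measurable[ℱ t] X → ∃ ξ : Ω → EuclideanSpace ℝ (Fin d), Measurable[ℱ t] ξ ∧
        CondGe μ (ℱ t) (gain v (increment S (t + 1)) X ξ) fun ω => w (X ω) ω := by
    intro t ht v hv hV
    rw [valueFn_of_lt μ ℱ ht]
    exact (isMarketStep hS hNA hfin ha hab hC ht hv hV).exists_value (hUf _) (hnull' t) hV
      fun x => (hfin.1 t ht x).2
  have hex : ∀ k ≤ T, ∃ v : ℝ → Ω → ℝ, UtilityField (ℱ (T - k)) U a b C v ∧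
      ∀ᵐ ω ∂μ, ∀ x, valueFn μ ℱ T S U (T - k) x ω = v x ω := by
    intro k
    induction k with
    | zero =>
      intro _
      refine ⟨fun x _ => U x, hUf _, Eventually.of_forall fun ω x => ?_⟩
      rw [Nat.sub_zero, valueFn_horizon]
    | succ k ih =>
      intro hk
      obtain ⟨v, hv, hV⟩ := ih (by omega)
      have e : T - k = T - (k + 1) + 1 := by omega
      rw [e] at hv hV
      obtain ⟨w, h1, h2, -⟩ := hstep (T - (k + 1)) (by omega) v hv hV
      exact ⟨w, h1, h2⟩
  have hex' : ∀ t, ∃ v : ℝ → Ω → ℝ, t ≤ T → UtilityField (ℱ t) U a b C v ∧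
      ∀ᵐ ω ∂μ, ∀ x, valueFn μ ℱ T S U t x ω = v x ω := fun t => by
    by_cases ht : t ≤ T
    · obtain ⟨v, hv⟩ := hex (T - t) (by omega)
      rw [Nat.sub_sub_self ht] at hv
      exact ⟨v, fun _ => hv⟩
    · exact ⟨fun _ _ => 0, fun h => absurd h ht⟩
  choose v hv using hex'
  refine ⟨v, fun t ht => (hv t ht).1, (hv 0 (Nat.zero_le T)).2, ?_, fun t ht => ?_⟩
  · filter_upwards [(hv T le_rfl).2] with ω hω x
    have := hω x
    rw [valueFn_horizon] at this
    exact (EReal.coe_eq_coe_iff.1 this).symm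
  · obtain ⟨hv1, hV1⟩ := hv (t + 1) ht
    obtain ⟨w, -, h2, h3, h4⟩ := hstep t ht (v (t + 1)) hv1 hV1
    -- The versions were chosen independently for each time, so the one built from `v (t + 1)` must
    -- be identified with `v t`. Agreement for all `x` simultaneously allows random arguments.
    have hwv : ∀ᵐ ω ∂μ, ∀ x, w x ω = v t x ω := by
      filter_upwards [h2, (hv t ht.le).2] with ω e1 e2 x
      exact EReal.coe_eq_coe_iff.1 ((e1 x).symm.trans (e2 x))
    refine ⟨isMarketStep hS hNA hfin ha hab hC ht hv1 hV1, fun X ξ hX hξ => ?_, fun X hX => ?_⟩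
    · filter_upwards [h3 X ξ hX hξ, hwv] with ω e1 e2
      rwa [← e2]
    · obtain ⟨ξ, hξ, hge⟩ := h4 X hX
      refine ⟨ξ, hξ, ?_⟩
      filter_upwards [hge, hwv] with ω e1 e2
      rwa [← e2]

end Market

section Extended

theorem extExp_coe {Ω : Type*} {mΩ : MeasurableSpace Ω} {μ : Measure Ω} {X : Ω → ℝ}
    {Z : Ω → EReal} (h : ∀ᵐ ω ∂μ, Z ω = X ω) :
    extExp μ Z = ((∫⁻ ω, ENNReal.ofReal (X ω) ∂μ : ℝ≥0∞) : EReal)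
      - ((∫⁻ ω, ENNReal.ofReal (-X ω) ∂μ : ℝ≥0∞) : EReal) := by
  have h1 : ∫⁻ ω, (Z ω).toENNReal ∂μ = ∫⁻ ω, ENNReal.ofReal (X ω) ∂μ :=
    lintegral_congr_ae (by filter_upwards [h] with ω h; rw [h, toENNReal_coe_real])
  have h2 : ∫⁻ ω, (-Z ω).toENNReal ∂μ = ∫⁻ ω, ENNReal.ofReal (-X ω) ∂μ :=
    lintegral_congr_ae (by
      filter_upwards [h] with ω h
      rw [h, ← EReal.coe_neg, toENNReal_coe_real])
  rw [extExp, h1, h2]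

theorem coe_sub_le_coe_sub {p n p' n' : ℝ≥0∞} (hn : n ≠ ∞) (hn' : n' ≠ ∞) (hp' : p' ≠ ∞)
    (h : p + n' ≤ n + p') : (p : EReal) - (n : EReal) ≤ (p' : EReal) - (n' : EReal) := by
  have hp : p ≠ ∞ := ne_top_of_le_ne_top (ENNReal.add_ne_top.2 ⟨hn, hp'⟩) (le_self_add.trans h)
  lift p to NNReal using hp
  lift n to NNReal using hn
  lift p' to NNReal using hp'
  lift n' to NNReal using hn'
  have h' : (p : ℝ) + n' ≤ n + p' := by exact_mod_cast h
  have e : ∀ x y : NNReal, ((x : ℝ≥0∞) : EReal) - ((y : ℝ≥0∞) : EReal)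
      = (((x : ℝ) - y : ℝ) : EReal) := fun x y => by norm_cast
  rw [e, e, EReal.coe_le_coe_iff]
  linarith

end Extended

/-! ### Construction of the optimizer and comparison with other strategies -/

section Optimal

variable {Ω : Type*} {mΩ : MeasurableSpace Ω} {μ : Measure Ω} {d T : ℕ}
  {ℱ : Filtration ℕ mΩ} {S : ℕ → Ω → EuclideanSpace ℝ (Fin d)} {U : ℝ → ℝ} {a b C : ℝ}
  {v : ℕ → ℝ → Ω → ℝ}

/-- Concatenation of one-step optimizers. -/
theorem exists_optimal_strategy (hS : ∀ t ≤ T, Measurable[ℱ t] (S t))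
    (hopt : ∀ t < T, ∀ X : Ω → ℝ, Measurable[ℱ t] X →
      ∃ ξ : Ω → EuclideanSpace ℝ (Fin d), Measurable[ℱ t] ξ ∧
        CondGe μ (ℱ t) (gain (v (t + 1)) (increment S (t + 1)) X ξ) fun ω => v t (X ω) ω)
    (c : ℝ) :
    ∃ φ ∈ Strategies (d := d) ℱ T, ∀ t < T,
      CondGe μ (ℱ t) (gain (v (t + 1)) (increment S (t + 1)) (wealth S c φ t) (φ (t + 1)))
        fun ω => v t (wealth S c φ t ω) ω := by
  suffices h : ∀ n ≤ T, ∃ φ : ℕ → Ω → EuclideanSpace ℝ (Fin d),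
      (∀ t < n, Measurable[ℱ t] (φ (t + 1))) ∧ ∀ t < n,
      CondGe μ (ℱ t) (gain (v (t + 1)) (increment S (t + 1)) (wealth S c φ t) (φ (t + 1)))
        fun ω => v t (wealth S c φ t ω) ω from h T le_rfl
  intro n
  induction n with
  | zero => exact fun _ => ⟨fun _ _ => 0, by simp, by simp⟩
  | succ n ih =>
    intro hn
    obtain ⟨φ, h1, h2⟩ := ih (by omega)
    have hX := measurable_wealth (c := c) hS (by omega : n ≤ T) h1
    obtain ⟨ξ, hξ, hge⟩ := hopt n hn _ hX
    have hw : ∀ t ≤ n, wealth S c (Function.update φ (n + 1) ξ) t = wealth S c φ t := fun t ht =>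
      wealth_congr fun i hi => Function.update_of_ne (by omega) _ _
    refine ⟨Function.update φ (n + 1) ξ, fun t ht => ?_, fun t ht => ?_⟩
    · rcases Nat.lt_succ_iff_lt_or_eq.1 ht with ht | rfl
      · rw [Function.update_of_ne (by omega)]
        exact h1 t ht
      · rwa [Function.update_self]
    · rw [hw t (by omega)]
      rcases Nat.lt_succ_iff_lt_or_eq.1 ht with ht | rfl
      · rw [Function.update_of_ne (by omega)]
        exact h2 t ht
      · rwa [Function.update_self]

variable [IsProbabilityMeasure μ]

/-- A strategy whose terminal utility has integrable negative part does not beat the value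
function at time zero. -/
theorem lintegral_terminal_le (hS : ∀ t ≤ T, Measurable[ℱ t] (S t))
    (hv : ∀ t ≤ T, UtilityField (ℱ t) U a b C (v t))
    (hle : ∀ t < T, ∀ (X : Ω → ℝ) (ξ : Ω → EuclideanSpace ℝ (Fin d)), Measurable[ℱ t] X →
      Measurable[ℱ t] ξ →
      CondLe μ (ℱ t) (gain (v (t + 1)) (increment S (t + 1)) X ξ) fun ω => v t (X ω) ω)
    {c : ℝ} {φ : ℕ → Ω → EuclideanSpace ℝ (Fin d)} (hφ : φ ∈ Strategies (d := d) ℱ T)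
    (hneg : ∫⁻ ω, ENNReal.ofReal (-v T (wealth S c φ T ω) ω) ∂μ < ∞) :
    ∫⁻ ω, ENNReal.ofReal (v T (wealth S c φ T ω) ω) ∂μ + ∫⁻ ω, ENNReal.ofReal (-v 0 c ω) ∂μ
      ≤ ∫⁻ ω, ENNReal.ofReal (-v T (wealth S c φ T ω) ω) ∂μ
        + ∫⁻ ω, ENNReal.ofReal (v 0 c ω) ∂μ := by
  let p : ℕ → ℝ≥0∞ := fun t => ∫⁻ ω, ENNReal.ofReal (v t (wealth S c φ t ω) ω) ∂μ
  let n : ℕ → ℝ≥0∞ := fun t => ∫⁻ ω, ENNReal.ofReal (-v t (wealth S c φ t ω) ω) ∂μ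
  -- Backward induction: only the finite negative parts are cancelled, so positive parts may be
  -- infinite along the way.
  have key : ∀ k ≤ T, n (T - k) < ∞ ∧ p T + n (T - k) ≤ n T + p (T - k) := by
    intro k
    induction k with
    | zero => exact fun _ => ⟨hneg, by rw [Nat.sub_zero, add_comm]⟩
    | succ k ih =>
      intro hk
      obtain ⟨h1, h2⟩ := ih (by omega)
      obtain ⟨t, ht⟩ : ∃ t, T - (k + 1) = t := ⟨_, rfl⟩
      have ht1 : T - k = t + 1 := by omega
      have htT : t < T := by omega
      rw [ht1] at h1 h2
      rw [ht]
      have hX := measurable_wealth (c := c) hS htT.le fun s hs => hφ s (hs.trans htT)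
      have h3 := hle t htT _ _ hX (hφ t htT)
      rw [gain_wealth] at h3
      have h4 : n t ≤ n (t + 1) := h3.lintegral_neg_le (ℱ.le t)
      have h5 : p (t + 1) + n t ≤ n (t + 1) + p t :=
        h3.lintegral (ℱ.le t) ((hv t htT.le).measurable_comp hX)
      refine ⟨h4.trans_lt h1, (ENNReal.add_le_add_iff_left h1.ne).1 ?_⟩
      calc n (t + 1) + (p T + n t) = (p T + n (t + 1)) + n t := by ring
        _ ≤ (n T + p (t + 1)) + n t := add_le_add_left h2 _
        _ = n T + (p (t + 1) + n t) := by ring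
        _ ≤ n T + (n (t + 1) + p t) := add_le_add_right h5 _
        _ = _ := by ring
  have := (key T le_rfl).2
  rw [Nat.sub_self] at this
  simpa only [p, n, wealth_zero] using this

/-- The concatenation of one-step optimizers has integrable terminal utility and attains the value
function at time zero. -/
theorem lintegral_terminal_ge (hS : ∀ t ≤ T, Measurable[ℱ t] (S t)) (hU0 : U 0 = 0)
    (hv : ∀ t ≤ T, UtilityField (ℱ t) U a b C (v t))
    (hstep : ∀ t < T, IsMarketStep μ (ℱ t) U a b C (v (t + 1)) (increment S (t + 1)))
    (hle : ∀ t < T, ∀ (X : Ω → ℝ) (ξ : Ω → EuclideanSpace ℝ (Fin d)), Measurable[ℱ t] X →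
      Measurable[ℱ t] ξ →
      CondLe μ (ℱ t) (gain (v (t + 1)) (increment S (t + 1)) X ξ) fun ω => v t (X ω) ω)
    (hint : ∀ x, ∫⁻ ω, ENNReal.ofReal (v 0 x ω) ∂μ < ∞ ∧
      ∫⁻ ω, ENNReal.ofReal (-v 0 x ω) ∂μ < ∞)
    {c : ℝ} {φ : ℕ → Ω → EuclideanSpace ℝ (Fin d)} (hφ : φ ∈ Strategies (d := d) ℱ T)
    (hge : ∀ t < T,
      CondGe μ (ℱ t) (gain (v (t + 1)) (increment S (t + 1)) (wealth S c φ t) (φ (t + 1)))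
        fun ω => v t (wealth S c φ t ω) ω) :
    ∫⁻ ω, ENNReal.ofReal (v T (wealth S c φ T ω) ω) ∂μ < ∞ ∧
    ∫⁻ ω, ENNReal.ofReal (-v T (wealth S c φ T ω) ω) ∂μ < ∞ ∧
    ∫⁻ ω, ENNReal.ofReal (v 0 c ω) ∂μ + ∫⁻ ω, ENNReal.ofReal (-v T (wealth S c φ T ω) ω) ∂μ
      ≤ ∫⁻ ω, ENNReal.ofReal (-v 0 c ω) ∂μ
        + ∫⁻ ω, ENNReal.ofReal (v T (wealth S c φ T ω) ω) ∂μ := by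
  let p : ℕ → ℝ≥0∞ := fun t => ∫⁻ ω, ENNReal.ofReal (v t (wealth S c φ t ω) ω) ∂μ
  let n : ℕ → ℝ≥0∞ := fun t => ∫⁻ ω, ENNReal.ofReal (-v t (wealth S c φ t ω) ω) ∂μ
  have hp0 : p 0 = ∫⁻ ω, ENNReal.ofReal (v 0 c ω) ∂μ := by simp only [p, wealth_zero]
  have hn0 : n 0 = ∫⁻ ω, ENNReal.ofReal (-v 0 c ω) ∂μ := by simp only [n, wealth_zero]
  -- The zero position at capital `0` shows that the expectation of `v t 0` does not increase with
  -- `t`; there is no negative part because `v t 0 ≥ U 0 = 0`.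
  have hzero : ∀ t ≤ T, ∫⁻ ω, ENNReal.ofReal (v t 0 ω) ∂μ < ∞ := by
    intro t
    induction t with
    | zero => exact fun _ => (hint 0).1
    | succ t ih =>
      intro ht
      have h1 := (hle t ht (fun _ => 0) (fun _ => 0) measurable_const measurable_const).lintegral
        (ℱ.le t) ((hv t (by omega)).meas 0)
      have h2 : gain (v (t + 1)) (increment S (t + 1)) (fun _ => 0) (fun _ => 0)
          = v (t + 1) 0 := by
        funext ω; simp [gain]
      have h3 : ∀ ω, ENNReal.ofReal (-v (t + 1) 0 ω) = 0 := fun ω =>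
        ENNReal.ofReal_of_nonpos (neg_nonpos.2 (hU0.symm.le.trans ((hv (t + 1) ht).lower 0 ω)))
      rw [h2] at h1
      simp only [h3, lintegral_zero, zero_add] at h1
      exact (le_self_add.trans h1).trans_lt (ih (by omega))
  -- Forward induction, since integrability at time `t + 1` is derived from integrability at time
  -- `t`.
  have key : ∀ t ≤ T, p t < ∞ ∧ n t < ∞ ∧ p 0 + n t ≤ n 0 + p t := by
    intro t
    induction t with
    | zero =>
      intro _
      refine ⟨?_, ?_, by rw [add_comm]⟩
      · rw [hp0]; exact (hint c).1
      · rw [hn0]; exact (hint c).2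
    | succ t ih =>
      intro ht
      obtain ⟨h1, h2, h3⟩ := ih (by omega)
      have hX := measurable_wealth (c := c) hS (by omega : t ≤ T) fun s hs => hφ s (by omega)
      have hX2 : Measurable[ℱ t] fun ω => wealth S c φ t ω / 2 := hX.div_const 2
      have hξ2 : Measurable[ℱ t] fun ω => (2 : ℝ)⁻¹ • φ (t + 1) ω :=
        (measurable_const (a := (2 : ℝ)⁻¹)).smul (hφ t ht)
      have h4 := (hstep t ht).lintegral_gain_lt_top (hv t (by omega)) hX (hφ t ht) (hge t ht)
        (hle t ht _ _ hX2 hξ2) h1 h2 (hzero t (by omega))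
      have h5 := (hge t ht).lintegral (ℱ.le t) ((hv t (by omega)).measurable_comp hX)
      rw [gain_wealth] at h4 h5
      obtain ⟨h6, h7⟩ := h4
      have h5' : n (t + 1) + p t ≤ p (t + 1) + n t := h5
      refine ⟨h6, h7, (ENNReal.add_le_add_iff_left (ENNReal.add_ne_top.2 ⟨h1.ne, h2.ne⟩)).1 ?_⟩
      calc p t + n t + (p 0 + n (t + 1)) = (p 0 + n t) + (n (t + 1) + p t) := by ring
        _ ≤ (n 0 + p t) + (p (t + 1) + n t) := add_le_add h3 h5'
        _ = _ := by ring
  obtain ⟨h1, h2, h3⟩ := key T le_rfl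
  rw [hp0, hn0] at h3
  exact ⟨h1, h2, h3⟩

end Optimal

theorem lintegral_ofReal_neg_lt_top {Ω : Type*} {mΩ : MeasurableSpace Ω} {μ : Measure Ω}
    [IsFiniteMeasure μ] {X : Ω → ℝ} {k : ℝ} (h : ∀ ω, k ≤ X ω) :
    ∫⁻ ω, ENNReal.ofReal (-X ω) ∂μ < ∞ := by
  refine (lintegral_mono fun ω => ENNReal.ofReal_le_ofReal (neg_le_neg (h ω))).trans_lt ?_
  rw [lintegral_const]
  exact ENNReal.mul_lt_top ENNReal.ofReal_lt_top (measure_lt_top _ _)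

end UtilityMax

/-! ### Existence of an optimal strategy -/

theorem theorem2p7 {Ω : Type*} {mΩ : MeasurableSpace Ω} (μ : Measure Ω) [IsProbabilityMeasure μ]
    {d T : ℕ} (ℱ : Filtration ℕ mΩ)
    (hnull : ∀ A : Set Ω, MeasurableSet A → μ A = 0 → MeasurableSet[ℱ 0] A)
    (S : ℕ → Ω → EuclideanSpace ℝ (Fin d))
    (hS : ∀ t ≤ T, Measurable[ℱ t] (S t))
    (U : ℝ → ℝ) (hU : UtilityMax.IsUtility U)
    (hAE : UtilityMax.ElasticityAtTop U ∨ UtilityMax.ElasticityAtBot U)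
    (hNA : UtilityMax.NoArbitrage μ ℱ T S)
    (hfin : UtilityMax.ValueFinite μ ℱ T S U)
    (c : ℝ) :
    ∃ φ ∈ UtilityMax.AdmissibleStrategies μ ℱ T S U c,
      UtilityMax.optimalValue μ ℱ T S U c =
          UtilityMax.extExp μ (UtilityMax.terminalUtility U T S c φ) ∧
        ⊥ < UtilityMax.optimalValue μ ℱ T S U c ∧
        UtilityMax.optimalValue μ ℱ T S U c < ⊤ := by
  open UtilityMax in
  have hterm : ∀ φ : ℕ → Ω → EuclideanSpace ℝ (Fin d),
      extExp μ (terminalUtility U T S c φ)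
        = ((∫⁻ ω, ENNReal.ofReal (U (wealth S c φ T ω)) ∂μ : ℝ≥0∞) : EReal)
          - ((∫⁻ ω, ENNReal.ofReal (-U (wealth S c φ T ω)) ∂μ : ℝ≥0∞) : EReal) := fun φ =>
    extExp_coe (Filter.Eventually.of_forall fun ω => rfl)
  have hdef : ∀ φ : ℕ → Ω → EuclideanSpace ℝ (Fin d),
      ExpDefined μ (terminalUtility U T S c φ) ↔
        ¬ (∫⁻ ω, ENNReal.ofReal (U (wealth S c φ T ω)) ∂μ = ∞ ∧
          ∫⁻ ω, ENNReal.ofReal (-U (wealth S c φ T ω)) ∂μ = ∞) := fun φ => by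
    simp only [ExpDefined, terminalUtility, ← EReal.coe_neg, toENNReal_coe_real]
  suffices hmain : ∃ φ ∈ Strategies (d := d) ℱ T,
      ∫⁻ ω, ENNReal.ofReal (U (wealth S c φ T ω)) ∂μ < ∞ ∧
      ∫⁻ ω, ENNReal.ofReal (-U (wealth S c φ T ω)) ∂μ < ∞ ∧
      ∀ ψ ∈ Strategies (d := d) ℱ T, ∫⁻ ω, ENNReal.ofReal (-U (wealth S c ψ T ω)) ∂μ < ∞ →
        ∫⁻ ω, ENNReal.ofReal (U (wealth S c ψ T ω)) ∂μ
          + ∫⁻ ω, ENNReal.ofReal (-U (wealth S c φ T ω)) ∂μ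
        ≤ ∫⁻ ω, ENNReal.ofReal (-U (wealth S c ψ T ω)) ∂μ
          + ∫⁻ ω, ENNReal.ofReal (U (wealth S c φ T ω)) ∂μ by
    obtain ⟨φ, hφ, hp, hn, hbest⟩ := hmain
    have hadm : φ ∈ AdmissibleStrategies μ ℱ T S U c :=
      ⟨hφ, (hdef φ).2 fun h => hp.ne h.1⟩
    have heq : optimalValue μ ℱ T S U c = extExp μ (terminalUtility U T S c φ) := by
      refine le_antisymm (iSup₂_le fun ψ hψ => ?_)
        (le_iSup₂ (f := fun ψ (_ : ψ ∈ AdmissibleStrategies μ ℱ T S U c) =>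
          extExp μ (terminalUtility U T S c ψ)) φ hadm)
      rw [hterm, hterm]
      -- A competitor with infinite negative part has expected utility `⊥`, so only integrable
      -- negative parts need comparison.
      by_cases hψn : ∫⁻ ω, ENNReal.ofReal (-U (wealth S c ψ T ω)) ∂μ = ∞
      · rw [hψn, EReal.coe_ennreal_top, EReal.sub_top]
        exact bot_le
      · exact coe_sub_le_coe_sub hψn hn.ne hp.ne
          (hbest ψ hψ.1 (lt_top_iff_ne_top.2 hψn))
    refine ⟨φ, hadm, heq, ?_, ?_⟩
    all_goals
      rw [heq, hterm, ← ENNReal.coe_toNNReal hp.ne, ← ENNReal.coe_toNNReal hn.ne]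
    · exact EReal.bot_lt_coe _
    · exact EReal.coe_lt_top _
  by_cases hneg : ∃ x, U x < 0
  · obtain ⟨a, b, C, ha, hab, hC, hscale⟩ := hU.exists_exponents hAE
    have hUf : ∀ m : MeasurableSpace Ω, UtilityField m U a b C fun x _ => U x := fun m =>
      ⟨fun _ => measurable_const, fun _ => hU.1, fun _ => hU.2.1, fun _ _ => le_rfl,
        fun _ => hU.exists_lt hneg, fun _ x n hn => (hscale x n hn).1,
        fun _ x n hn => (hscale x n hn).2⟩
    obtain ⟨v, hv, hv0, hvT, hstep⟩ :=
      exists_value_process hnull hS hNA hfin ha hab hC hUf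
    have hint : ∀ x, ∫⁻ ω, ENNReal.ofReal (v 0 x ω) ∂μ < ∞ ∧
        ∫⁻ ω, ENNReal.ofReal (-v 0 x ω) ∂μ < ∞ := fun x => by
      have h1 := lintegral_ofReal_neg_lt_top (μ := μ) ((hv 0 (Nat.zero_le T)).lower x)
      refine ⟨lt_top_iff_ne_top.2 fun htop => ?_, h1⟩
      have h2 := hfin.2 x
      rw [extExp_coe (X := v 0 x) (by filter_upwards [hv0] with ω h using h x), htop,
        EReal.coe_ennreal_top, EReal.top_sub (by simpa using h1.ne)] at h2
      exact lt_irrefl _ h2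
    obtain ⟨φ, hφ, hge⟩ := exists_optimal_strategy hS (fun t ht => (hstep t ht).2.2) c
    obtain ⟨h1, h2, h3⟩ := lintegral_terminal_ge hS hU.2.2 hv (fun t ht => (hstep t ht).1)
      (fun t ht => (hstep t ht).2.1) hint hφ hge
    have hUv : ∀ ψ : ℕ → Ω → EuclideanSpace ℝ (Fin d),
        ∫⁻ ω, ENNReal.ofReal (v T (wealth S c ψ T ω) ω) ∂μ
          = ∫⁻ ω, ENNReal.ofReal (U (wealth S c ψ T ω)) ∂μ ∧
        ∫⁻ ω, ENNReal.ofReal (-v T (wealth S c ψ T ω) ω) ∂μ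
          = ∫⁻ ω, ENNReal.ofReal (-U (wealth S c ψ T ω)) ∂μ := fun ψ =>
      ⟨lintegral_congr_ae (by filter_upwards [hvT] with ω h; rw [h]),
        lintegral_congr_ae (by filter_upwards [hvT] with ω h; rw [h])⟩
    rw [(hUv φ).1] at h1
    rw [(hUv φ).2] at h2
    rw [(hUv φ).1, (hUv φ).2] at h3
    refine ⟨φ, hφ, h1, h2, fun ψ hψ hψn => ?_⟩
    have h4 := lintegral_terminal_le hS hv (fun t ht => (hstep t ht).2.1) (c := c) hψ
      (by rwa [(hUv ψ).2])
    rw [(hUv ψ).1, (hUv ψ).2] at h4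
    -- Both bounds pass through the expectation of `v 0 c`, whose finite parts are cancelled.
    refine (ENNReal.add_le_add_iff_left
      (ENNReal.add_ne_top.2 ⟨(hint c).1.ne, (hint c).2.ne⟩)).1 ?_
    refine le_trans (le_of_eq ?_) ((add_le_add h3 h4).trans_eq ?_)
    · ring
    · ring
  · have hzero := hU.eq_zero_of_nonneg (by simpa using hneg)
    exact ⟨fun _ _ => 0, fun _ _ => measurable_const, by simp [hzero], by simp [hzero],
      fun _ _ _ => by simp [hzero]⟩
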